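/- Let $X=\mathbb{CP}^1$, $U=\{[1:z]\}\subset X$ with coordinate $\xi([1:z])=z$, let $m\in\{1,2\}$, let $p_1,\dots,p_{2m}\in U$ be distinct points and $\mu_i=\xi(p_i)$. Definitions. A Hecke modification at $p$ of a holomorphic rank 2 vector bundle $E$ on $X$ is a morphism $\alpha:F\to E$ from a holomorphic rank 2 bundle that is an isomorphism on fibres away from $p$ and that near $p$, in suitable local trivializations and a local coordinate $\zeta$, is given by $\mathrm{diag}(1,\zeta-\zeta(p))$. Let $\mathcal H(S^2,2m)$ be the set of sequences $E_0\xleftarrow{\alpha_1}E_1\xleftarrow{\alpha_2}\cdots\xleftarrow{\alpha_{2m}}E_{2m}$, with $E_0=\mathcal O\oplus\mathcal O$ and $\alpha_i$ a Hecke modification at $p_i$, for which $E_{2m}\cong\mathcal O(k)\oplus\mathcal O(k)$ for some $k\in\mathbb Z$, modulo isomorphisms of the $E_i$ that commute with the $\alpha_i$ and are the identity on $E_0$. Let $\mathcal M(S^2,2m)\subset(\mathbb{CP}^1)^{2m}$ be the set of tuples in which at most $m$ entries are equal to any given point. Let $\mathcal Y(S^2,2m)$ be the set of complex $2m\times 2m$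 matrices, divided into $2\times2$ blocks, with arbitrary first block column, identity blocks on the superdiagonal, zeros elsewhere, and multiset of eigenvalues $\{\mu_1,\dots,\mu_{2m}\}$. * Kamnitzer map $K:\mathcal H(S^2,2m)\to\mathcal Y(S^2,2m)$: a class is sent to the matrix of multiplication by $z$ on $V=\operatorname{coker}(\Gamma(U,E_{2m})\to\Gamma(U,E_0))$ (algebraic sections over $U$) relative to the basis $z^{m-1}e^1,z^{m-1}e^2,\dots,ze^1,ze^2,e^1,e^2$, where $e^1,e^2$ are the standard sections of $\mathcal O\oplus\mathcal O$; columns of the matrix are the coordinates of the images of the basis vectors. * Hecke embedding $H:\mathcal H(S^2,2m)\to\mathcal M(S^2,2m)$: the $i$-th coordinate is $[a:c]$, where the matrix of $\alpha_1\circ\cdots\circ\alpha_i:E_i\to E_0$ near $p_i$, in the standard trivialization of $E_0$ and any local trivialization of $E_i$, is written as $A(z)\,\mathrm{diag}(1,z-\mu_i)\,B(z)$ with $A,B$ holomorphic and invertible near $\mu_i$, and $(a,c)^T$ is the first column of $A(\mu_i)$. * Woodward embedding $W:\mathcal Y(S^2,2m)\to\mathcal M(S^2,2m)$: the $k$-th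 coordinate of $W(A)$ is $[X:Y]$, where $(X,Y)\in\mathbb C^2$ is the last block of a left eigenvector $v\neq0$, $vA=\mu_kv$. Theorem. For $m=1$ and $m=2$ these three maps are well defined, $K$ is bijective, $H$ and $W$ are injective, and $$W\circ K=\Phi\circ H,$$ where $\Phi:\mathcal M(S^2,2m)\to\mathcal M(S^2,2m)$ is the bijection that applies $\phi([x:y])=[-y:x]$ to each coordinate. -/

import Mathlib

open Bundle Topology Set
open scoped Manifold ContDiff LinearAlgebra.Projectivization

noncomputable section

/-- The projective line over the complex numbers; `[x : y]` is `Projectivization.mk ℂ ![x, y] _`. -/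
abbrev CP1 : Type := ℙ ℂ (Fin 2 → ℂ)

namespace CP1

/-- The quotient topology. -/
instance : TopologicalSpace CP1 :=
  TopologicalSpace.coinduced
    (fun v : {v : Fin 2 → ℂ // v ≠ 0} => Projectivization.mk ℂ v.1 v.2) inferInstance

/-- `U i` is the open set of the points whose `i`-th homogeneous coordinate is not zero. -/
def U (i : Fin 2) : Set CP1 := {x | x.rep i ≠ 0}

/-- The affine coordinate on `U i`: `ξ 0 [x : y] = y / x` and `ξ 1 [x : y] = x / y`
(with the junk value `0` outside `U i`). -/
def ξ (i : Fin 2) (x : CP1) : ℂ := x.rep (i + 1) / x.rep i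

/-- The vector `(1, z)` for `i = 0` and `(z, 1)` for `i = 1`. -/
def vec (i : Fin 2) (z : ℂ) : Fin 2 → ℂ := fun k => if k = i then 1 else z

lemma vec_ne (i : Fin 2) (z : ℂ) : vec i z ≠ 0 := fun h => by
  simpa [vec] using congrFun h i

/-- The point of `U i` with affine coordinate `z`. -/
def pt (i : Fin 2) (z : ℂ) : CP1 := Projectivization.mk ℂ (vec i z) (vec_ne i z)

lemma mk_mem_U (i : Fin 2) (v : Fin 2 → ℂ) (hv : v ≠ 0) :
    Projectivization.mk ℂ v hv ∈ U i ↔ v i ≠ 0 := by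
  obtain ⟨a, ha⟩ := Projectivization.exists_smul_eq_mk_rep ℂ v hv
  simp [U, ← ha, Units.smul_def]

lemma ξ_mk (i : Fin 2) (v : Fin 2 → ℂ) (hv : v ≠ 0) :
    ξ i (Projectivization.mk ℂ v hv) = v (i + 1) / v i := by
  obtain ⟨a, ha⟩ := Projectivization.exists_smul_eq_mk_rep ℂ v hv
  simp [ξ, ← ha, Units.smul_def, mul_div_mul_left]

lemma fin2_ne (i : Fin 2) : i + 1 ≠ i := by fin_cases i <;> decide

lemma fin2_eq {i k : Fin 2} (h : k ≠ i) : k = i + 1 := by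
  fin_cases i <;> fin_cases k <;> first | rfl | exact absurd rfl h

lemma continuous_coord (i : Fin 2) :
    Continuous (fun v : {v : Fin 2 → ℂ // v ≠ 0} => v.1 i) :=
  (continuous_apply i).comp continuous_subtype_val

lemma pt_mem (i : Fin 2) (z : ℂ) : pt i z ∈ U i := by
  simp [pt, mk_mem_U, vec]

lemma ξ_pt (i : Fin 2) (z : ℂ) : ξ i (pt i z) = z := by
  simp [pt, ξ_mk, vec]

lemma pt_ξ (i : Fin 2) (x : CP1) (hx : x ∈ U i) : pt i (ξ i x) = x := by
  induction x using Projectivization.ind with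
  | h v hv =>
    rw [mk_mem_U] at hx
    rw [ξ_mk, pt, Projectivization.mk_eq_mk_iff']
    refine ⟨(v i)⁻¹, ?_⟩
    funext k
    by_cases hk : k = i
    · subst hk; simp [vec, hx]
    · rw [fin2_eq hk]; simp [vec, div_eq_inv_mul]

lemma continuous_mk :
    Continuous (fun v : {v : Fin 2 → ℂ // v ≠ 0} => Projectivization.mk ℂ v.1 v.2) :=
  continuous_coinduced_rng

lemma isOpen_U (i : Fin 2) : IsOpen (U i) := by
  rw [isOpen_coinduced]
  have : (fun v : {v : Fin 2 → ℂ // v ≠ 0} => Projectivization.mk ℂ v.1 v.2) ⁻¹' (U i)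
      = {v | v.1 i ≠ 0} := by
    ext v; exact mk_mem_U i v.1 v.2
  rw [this]
  exact isOpen_ne_fun (continuous_coord i) continuous_const

lemma continuous_pt (i : Fin 2) : Continuous (pt i) := by
  have h : Continuous (fun z : ℂ => (⟨vec i z, vec_ne i z⟩ : {v : Fin 2 → ℂ // v ≠ 0})) := by
    refine Continuous.subtype_mk (continuous_pi fun k => ?_) _
    by_cases hk : k = i <;> simp [vec, hk] <;> fun_prop
  exact continuous_mk.comp h

lemma continuousOn_ξ (i : Fin 2) : ContinuousOn (ξ i) (U i) := by
  rw [continuousOn_open_iff (isOpen_U i)]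
  intro t ht
  rw [isOpen_coinduced]
  have : (fun v : {v : Fin 2 → ℂ // v ≠ 0} => Projectivization.mk ℂ v.1 v.2) ⁻¹'
      (U i ∩ ξ i ⁻¹' t) = {v | v.1 i ≠ 0} ∩ (fun v => v.1 (i + 1) / v.1 i) ⁻¹' t := by
    ext v
    simp only [mem_preimage, mem_inter_iff, mk_mem_U, ξ_mk, mem_ofPred_eq]
  rw [this]
  refine ContinuousOn.isOpen_inter_preimage ?_ ?_ ht
  · exact ContinuousOn.div (continuous_coord (i + 1)).continuousOn
      (continuous_coord i).continuousOn (fun v hv => hv)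
  · exact isOpen_ne_fun (continuous_coord i) continuous_const

/-- The affine charts `ξ i : U i → ℂ`. -/
def chart (i : Fin 2) : OpenPartialHomeomorph CP1 ℂ where
  toFun := ξ i
  invFun := pt i
  source := U i
  target := univ
  map_source' _ _ := mem_univ _
  map_target' z _ := pt_mem i z
  left_inv' x hx := pt_ξ i x hx
  right_inv' z _ := ξ_pt i z
  open_source := isOpen_U i
  open_target := isOpen_univ
  continuousOn_toFun := continuousOn_ξ i
  continuousOn_invFun := (continuous_pt i).continuousOn

lemma mem_U_one_of_not_mem {x : CP1} (hx : x ∉ U 0) : x ∈ U 1 := by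
  intro h1
  refine x.rep_nonzero (funext fun k => ?_)
  fin_cases k
  · simpa [U] using hx
  · exact h1

open Classical in
/-- The Riemann surface structure of the projective line, given by the two affine charts. -/
instance : ChartedSpace ℂ CP1 where
  atlas := range chart
  chartAt x := if x ∈ U 0 then chart 0 else chart 1
  mem_chart_source x := by
    by_cases h : x ∈ U 0
    · rw [if_pos h]; exact h
    · rw [if_neg h]; exact mem_U_one_of_not_mem h
  chart_mem_atlas x := by
    by_cases h : x ∈ U 0 <;> simp [h]

lemma ξ_mul_ξ {x : CP1} (i : Fin 2) (h0 : x ∈ U i) (h1 : x ∈ U (i + 1)) :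
    ξ i x * ξ (i + 1) x = 1 := by
  have e : i + 1 + 1 = i := by fin_cases i <;> rfl
  simp only [U, mem_ofPred_eq] at h0 h1
  simp only [ξ, e]
  field_simp

instance : IsManifold 𝓘(ℂ) ω CP1 := by
  refine isManifold_of_contDiffOn 𝓘(ℂ) ω CP1 ?_
  rintro _ _ ⟨i, rfl⟩ ⟨j, rfl⟩
  simp only [modelWithCornersSelf_coe, modelWithCornersSelf_coe_symm, Function.comp_id,
    Function.id_comp, range_id, inter_univ, preimage_id]
  by_cases hij : j = i
  · subst hij
    refine contDiffOn_id.congr fun z _ => ?_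
    exact ξ_pt j z
  · obtain rfl := fin2_eq hij
    have key : ∀ z ∈ ((chart i).symm.trans (chart (i + 1))).source, z ≠ 0 ∧
        ((chart i).symm.trans (chart (i + 1))) z = z⁻¹ := by
      intro z hz
      have h1 : pt i z ∈ U (i + 1) := hz.2
      have := ξ_mul_ξ i (pt_mem i z) h1
      rw [ξ_pt] at this
      exact ⟨left_ne_zero_of_mul_eq_one this, eq_inv_of_mul_eq_one_right this⟩
    refine ContDiffOn.congr (f := fun z => z⁻¹) ?_ (fun z hz => (key z hz).2)
    exact fun z hz => (contDiffAt_inv ℂ (key z hz).1).contDiffWithinAt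

lemma chart_mem_maximalAtlas (i : Fin 2) : chart i ∈ IsManifold.maximalAtlas 𝓘(ℂ) ω CP1 :=
  IsManifold.subset_maximalAtlas ⟨i, rfl⟩

lemma contMDiffOn_ξ (i : Fin 2) : ContMDiffOn 𝓘(ℂ) 𝓘(ℂ) ω (ξ i) (U i) :=
  contMDiffOn_of_mem_maximalAtlas (chart_mem_maximalAtlas i)

lemma ξ_ne_zero {x : CP1} (i : Fin 2) (h0 : x ∈ U i) (h1 : x ∈ U (i + 1)) : ξ (i + 1) x ≠ 0 :=
  right_ne_zero_of_mul_eq_one (ξ_mul_ξ i h0 h1)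

end CP1
/-! Holomorphic vector bundles of rank 2 on the projective line -/

/-- A holomorphic vector bundle of rank 2 on `CP1`. -/
structure HolBundle where
  Fib : CP1 → Type
  [fibGroup : ∀ x, AddCommGroup (Fib x)]
  [fibMod : ∀ x, Module ℂ (Fib x)]
  [fibTop : ∀ x, TopologicalSpace (Fib x)]
  [totTop : TopologicalSpace (TotalSpace (Fin 2 → ℂ) Fib)]
  [fiberBundle : FiberBundle (Fin 2 → ℂ) Fib]
  [vectorBundle : VectorBundle ℂ (Fin 2 → ℂ) Fib]
  [holomorphic : ContMDiffVectorBundle ω (Fin 2 → ℂ) Fib 𝓘(ℂ)]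

attribute [instance] HolBundle.fibGroup HolBundle.fibMod HolBundle.fibTop HolBundle.totTop
  HolBundle.fiberBundle HolBundle.vectorBundle HolBundle.holomorphic

namespace HolBundle

/-- The total space of a bundle. -/
abbrev Tot (E : HolBundle) : Type := TotalSpace (Fin 2 → ℂ) E.Fib

/-- The trivial bundle `𝒪 ⊕ 𝒪`. -/
abbrev triv : HolBundle where
  Fib := Bundle.Trivial CP1 (Fin 2 → ℂ)

/-- The linear map with diagonal matrix `diag(c 0, c 1)`. -/
def diagCLM : (Fin 2 → ℂ) →ₗ[ℂ] ((Fin 2 → ℂ) →L[ℂ] (Fin 2 → ℂ)) :=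
  LinearMap.toContinuousLinearMap.toLinearMap ∘ₗ Matrix.toLin'.toLinearMap ∘ₗ
    Matrix.diagonalLinearMap (Fin 2) ℂ ℂ

lemma diagCLM_apply (c v : Fin 2 → ℂ) (k : Fin 2) : diagCLM c v k = c k * v k := by
  simp [diagCLM, Matrix.mulVec_diagonal]

lemma contMDiffOn_diagCLM (d : Fin 2 → ℤ) (i : Fin 2) (s : Set CP1) (hs : s ⊆ CP1.U i)
    (h0 : ∀ x ∈ s, CP1.ξ i x ≠ 0) :
    ContMDiffOn 𝓘(ℂ) 𝓘(ℂ, (Fin 2 → ℂ) →L[ℂ] (Fin 2 → ℂ)) ω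
      (fun x => diagCLM fun k => CP1.ξ i x ^ d k) s := by
  have h1 : ContDiffOn ℂ ω (fun z : ℂ => diagCLM fun k => z ^ d k) {z | z ≠ 0} := by
    have h2 : ContDiff ℂ ω (fun c => diagCLM c) := diagCLM.toContinuousLinearMap.contDiff
    refine h2.comp_contDiffOn (contDiffOn_pi.2 fun k => ?_)
    intro z hz
    exact (AnalyticAt.zpow analyticAt_id hz).contDiffAt.contDiffWithinAt
  exact h1.contMDiffOn.comp ((CP1.contMDiffOn_ξ i).mono hs) h0

open Classical in
/-- Gluing data of `𝒪(d 0) ⊕ 𝒪(d 1)`: over `U 0 ∩ U 1` the point `(p, v)` of `U 0 × ℂ²` is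
identified with the point `(p, diag(w ^ d 0, w ^ d 1) v)` of `U 1 × ℂ²`, where `w = ξ 1 p`. -/
def core (d : Fin 2 → ℤ) : VectorBundleCore ℂ CP1 (Fin 2 → ℂ) (Fin 2) where
  baseSet := CP1.U
  isOpen_baseSet := CP1.isOpen_U
  indexAt x := if x ∈ CP1.U 0 then 0 else 1
  mem_baseSet_at x := by
    by_cases h : x ∈ CP1.U 0
    · rw [if_pos h]; exact h
    · rw [if_neg h]; exact CP1.mem_U_one_of_not_mem h
  coordChange i j x :=
    if i = j then ContinuousLinearMap.id ℂ _ else diagCLM fun k => CP1.ξ j x ^ d k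
  coordChange_self i x _ v := by simp
  continuousOn_coordChange i j := by
    by_cases hij : i = j
    · simp only [hij, if_true]; exact continuousOn_const
    · simp only [if_neg hij]
      obtain rfl := CP1.fin2_eq (Ne.symm hij)
      exact (contMDiffOn_diagCLM d (i + 1) _ inter_subset_right
        fun x hx => CP1.ξ_ne_zero i hx.1 hx.2).continuousOn
  coordChange_comp i j k x hx v := by
    obtain ⟨⟨hi, hj⟩, hk⟩ := hx
    by_cases hij : i = j
    · subst hij; simp
    · by_cases hjk : j = k
      · subst hjk; simp
      · have hik : k = i := by
          have h1 := CP1.fin2_eq hij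
          have h2 := CP1.fin2_eq (Ne.symm hjk)
          rw [h1, h2]
        subst hik
        obtain rfl := CP1.fin2_eq hij
        have := CP1.ξ_mul_ξ j hj hi
        ext l
        simp only [if_neg hij, if_neg hjk, if_true, diagCLM_apply, ContinuousLinearMap.id_apply]
        rw [← mul_assoc, ← mul_zpow, mul_comm (CP1.ξ (j + 1) x), this, one_zpow, one_mul]

instance (d : Fin 2 → ℤ) : (core d).IsContMDiff 𝓘(ℂ) ω where
  contMDiffOn_coordChange i j := by
    by_cases hij : i = j
    · simp only [core, hij, if_true]; exact contMDiffOn_const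
    · simp only [core, if_neg hij]
      obtain rfl := CP1.fin2_eq (Ne.symm hij)
      exact contMDiffOn_diagCLM d (i + 1) _ inter_subset_right
        fun x hx => CP1.ξ_ne_zero i hx.1 hx.2

/-- The bundle `𝒪(a) ⊕ 𝒪(b)`. -/
abbrev sumO (a b : ℤ) : HolBundle where
  Fib := (core ![a, b]).Fiber

end HolBundle

/-- A morphism of holomorphic vector bundles `F → E`. -/
structure HolHom (F E : HolBundle) where
  map : ∀ x, F.Fib x →ₗ[ℂ] E.Fib x
  hol : ContMDiff (𝓘(ℂ).prod 𝓘(ℂ, Fin 2 → ℂ)) (𝓘(ℂ).prod 𝓘(ℂ, Fin 2 → ℂ)) ω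
    (fun v : F.Tot => (⟨v.1, map v.1 v.2⟩ : E.Tot))

namespace HolHom

/-- The identity morphism. -/
def id (E : HolBundle) : HolHom E E where
  map _ := LinearMap.id
  hol := contMDiff_id

/-- Composition of morphisms. -/
def comp {G F E : HolBundle} (α : HolHom F E) (β : HolHom G F) : HolHom G E where
  map x := α.map x ∘ₗ β.map x
  hol := α.hol.comp β.hol

end HolHom

/-- An isomorphism of holomorphic vector bundles. -/
structure HolIso (F E : HolBundle) where
  hom : HolHom F E
  inv : HolHom E F
  hom_inv : ∀ x v, hom.map x (inv.map x v) = v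
  inv_hom : ∀ x v, inv.map x (hom.map x v) = v

namespace HolIso

/-- The identity isomorphism. -/
def refl (E : HolBundle) : HolIso E E := ⟨HolHom.id E, HolHom.id E, fun _ _ => rfl, fun _ _ => rfl⟩

/-- The inverse isomorphism. -/
def symm {F E : HolBundle} (φ : HolIso F E) : HolIso E F := ⟨φ.inv, φ.hom, φ.inv_hom, φ.hom_inv⟩

/-- Composition of isomorphisms. -/
def trans {G F E : HolBundle} (φ : HolIso G F) (ψ : HolIso F E) : HolIso G E where
  hom := ψ.hom.comp φ.hom
  inv := φ.inv.comp ψ.inv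
  hom_inv x v := by simp [HolHom.comp, φ.hom_inv, ψ.hom_inv]
  inv_hom x v := by simp [HolHom.comp, φ.inv_hom, ψ.inv_hom]

end HolIso

/-- `E` has Hecke length `l`: it is isomorphic to `𝒪(a) ⊕ 𝒪(b)` with `|a - b| = l`. -/
def HasHeckeLength (E : HolBundle) (l : ℕ) : Prop :=
  ∃ a b : ℤ, Nonempty (HolIso E (HolBundle.sumO a b)) ∧ (a - b).natAbs = l

/-- A holomorphic trivialization `E|_N ≅ N × ℂ²` over the set `N`
(the values of `map` outside `N` are not used). -/
structure HolTriv (E : HolBundle) (N : Set CP1) where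
  map : ∀ x, E.Fib x ≃ₗ[ℂ] (Fin 2 → ℂ)
  hol : ContMDiffOn (𝓘(ℂ).prod 𝓘(ℂ, Fin 2 → ℂ)) 𝓘(ℂ, Fin 2 → ℂ) ω
    (fun v : E.Tot => map v.1 v.2) {v | v.1 ∈ N}

/-! Hecke modifications -/

/-- The morphism `α : F → E` is a Hecke modification of `E` at the point `p`: it is an
isomorphism on the fibres away from `p`, and near `p`, in some holomorphic coordinate `ξ` and some
local trivializations, it has the matrix `diag(1, ξ - ξ p)`. -/
structure IsHecke {F E : HolBundle} (p : CP1) (α : HolHom F E) : Prop where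
  bijective_away : ∀ q, q ≠ p → Function.Bijective (α.map q)
  local_form : ∃ ξ ∈ IsManifold.maximalAtlas 𝓘(ℂ) ω CP1, p ∈ ξ.source ∧
    ∃ (ψE : HolTriv E ξ.source) (ψF : HolTriv F ξ.source), ∀ q ∈ ξ.source, ∀ v : F.Fib q,
      ψE.map q (α.map q v) = Matrix.mulVec !![1, 0; 0, ξ q - ξ p] (ψF.map q v)

/-- The sequence `E, E₁, …, Eₙ`. -/
def bundleSeq (E : HolBundle) {n : ℕ} (mods : Fin n → HolBundle) : Fin (n + 1) → HolBundle :=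
  Fin.cons E mods

/-- A sequence `E ← E₁ ← ⋯ ← Eₙ` of Hecke modifications of `E` at the points `p 0, …, p (n - 1)`. -/
structure HeckeSeq (E : HolBundle) {n : ℕ} (p : Fin n → CP1) where
  mods : Fin n → HolBundle
  map : ∀ i : Fin n, HolHom (bundleSeq E mods i.succ) (bundleSeq E mods i.castSucc)
  isHecke : ∀ i, IsHecke (p i) (map i)

namespace HeckeSeq

variable {E : HolBundle} {n : ℕ} {p : Fin n → CP1}

/-- The bundles `E₀ = E, E₁, …, Eₙ`. -/
abbrev bun (S : HeckeSeq E p) : Fin (n + 1) → HolBundle := bundleSeq E S.mods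

/-- The composite morphism `α₁ ∘ ⋯ ∘ αᵢ : Eᵢ → E`. -/
def toBase (S : HeckeSeq E p) (i : Fin (n + 1)) : HolHom (S.bun i) E :=
  Fin.induction (motive := fun i => HolHom (S.bun i) E) (HolHom.id E)
    (fun i f => f.comp (S.map i)) i

/-- Two sequences are equivalent if there are isomorphisms `φᵢ : Eᵢ → Eᵢ'` that commute with the
Hecke modifications, where `φ₀` is the identity of `E`. -/
def Equivalent (S T : HeckeSeq E p) : Prop :=
  ∃ φ : ∀ i, HolIso (S.bun i) (T.bun i),
    φ 0 = HolIso.refl E ∧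
    ∀ (i : Fin n) (x : CP1) (v : (S.bun i.succ).Fib x),
      (φ i.castSucc).hom.map x ((S.map i).map x v) = (T.map i).map x ((φ i.succ).hom.map x v)

lemma Equivalent.refl (S : HeckeSeq E p) : Equivalent S S :=
  ⟨fun _ => HolIso.refl _, rfl, fun _ _ _ => rfl⟩

lemma Equivalent.symm {S T : HeckeSeq E p} (h : Equivalent S T) : Equivalent T S := by
  obtain ⟨φ, h0, h⟩ := h
  refine ⟨fun i => (φ i).symm, congrArg HolIso.symm h0, fun i x v => ?_⟩
  have := h i x ((φ i.succ).inv.map x v)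
  rw [(φ i.succ).hom_inv] at this
  change (φ i.castSucc).inv.map x ((T.map i).map x v) = (S.map i).map x ((φ i.succ).inv.map x v)
  rw [← this, (φ i.castSucc).inv_hom]

lemma Equivalent.trans {S T R : HeckeSeq E p} (h : Equivalent S T) (k : Equivalent T R) :
    Equivalent S R := by
  obtain ⟨φ, h0, h⟩ := h
  obtain ⟨ψ, k0, k⟩ := k
  refine ⟨fun i => (φ i).trans (ψ i), congrArg₂ HolIso.trans h0 k0, fun i x v => ?_⟩
  change (ψ i.castSucc).hom.map x ((φ i.castSucc).hom.map x ((S.map i).map x v)) =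
    (R.map i).map x ((ψ i.succ).hom.map x ((φ i.succ).hom.map x v))
  rw [h, k]

instance setoid (E : HolBundle) {n : ℕ} (p : Fin n → CP1) : Setoid (HeckeSeq E p) :=
  ⟨Equivalent, Equivalent.refl, Equivalent.symm, Equivalent.trans⟩

end HeckeSeq

/-- The space `ℋ^tot(CP1, E; p)` of equivalence classes of sequences of Hecke modifications. -/
def HTot (E : HolBundle) {n : ℕ} (p : Fin n → CP1) : Type 1 := Quotient (HeckeSeq.setoid E p)

/-- The class of a sequence of Hecke modifications. -/
def HeckeSeq.cls {E : HolBundle} {n : ℕ} {p : Fin n → CP1} (S : HeckeSeq E p) : HTot E p :=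
  Quotient.mk _ S

/-- The space `ℋ(S², n)` of the classes of sequences of Hecke modifications of `𝒪 ⊕ 𝒪` whose last
bundle has the minimal possible Hecke length (`0` for even `n`, `1` for odd `n`). -/
def HeckeSpace {n : ℕ} (p : Fin n → CP1) : Set (HTot HolBundle.triv p) :=
  {x | ∃ S : HeckeSeq HolBundle.triv p, S.cls = x ∧ HasHeckeLength (S.bun (Fin.last n)) (n % 2)}

/-- The space `ℳ(S², n)`. -/
def MSpace (n : ℕ) : Set (Fin n → CP1) := {a | ∀ c : CP1, 2 * {i | a i = c}.ncard ≤ n}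

/-! The Hecke embedding -/

/-- `IsEta M μ x`: the germ at `μ` of the matrix function `M` represents a point of the Bruhat cell
`Gr(1)`, that is `M(z) = A(z) diag(1, z - μ) B(z)` with `A`, `B` holomorphic and invertible near
`μ`, and `x = η([M], μ)` is the point `[A(μ)₁₁ : A(μ)₂₁]`. -/
def IsEta (M : ℂ → Matrix (Fin 2) (Fin 2) ℂ) (μ : ℂ) (x : CP1) : Prop :=
  ∃ A B : ℂ → Matrix (Fin 2) (Fin 2) ℂ,
    (∀ i j, AnalyticAt ℂ (fun z => A z i j) μ) ∧ (∀ i j, AnalyticAt ℂ (fun z => B z i j) μ) ∧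
    (A μ).det ≠ 0 ∧ (B μ).det ≠ 0 ∧
    (∀ᶠ z in 𝓝 μ, M z = A z * !![1, 0; 0, z - μ] * B z) ∧
    ∃ h : ![A μ 0 0, A μ 1 0] ≠ 0, x = Projectivization.mk ℂ ![A μ 0 0, A μ 1 0] h

/-- `x` is the direction `hᵢ` of the sequence `S`: it is `η([ᾱ₁ ⋯ ᾱᵢ], ξ(pᵢ))`, where `ᾱ₁ ⋯ ᾱᵢ` is
the matrix of `α₁ ∘ ⋯ ∘ αᵢ : Eᵢ → E = 𝒪 ⊕ 𝒪` with respect to the global trivialization of `E`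
and a local trivialization of `Eᵢ` near `pᵢ`, as a function of the coordinate `ξ = ξ 0`. -/
def IsDirection {n : ℕ} {p : Fin n → CP1} (S : HeckeSeq HolBundle.triv p) (i : Fin n) (x : CP1) :
    Prop :=
  ∃ N : Set CP1, IsOpen N ∧ p i ∈ N ∧ N ⊆ CP1.U 0 ∧
    ∃ (ψ : HolTriv (S.bun i.succ) N) (M : ℂ → Matrix (Fin 2) (Fin 2) ℂ),
      (∀ q ∈ N, ∀ v : (S.bun i.succ).Fib q,
        ((S.toBase i.succ).map q v : Fin 2 → ℂ) = Matrix.mulVec (M (CP1.ξ 0 q)) (ψ.map q v)) ∧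
      IsEta M (CP1.ξ 0 (p i)) x

/-- `H` is the Hecke embedding: the map of the directions of the classes in `ℋ(S², n)`. -/
def IsHeckeEmbedding {n : ℕ} {p : Fin n → CP1} (H : HeckeSpace p → MSpace n) : Prop :=
  ∀ (x : HeckeSpace p) (S : HeckeSeq HolBundle.triv p), S.cls = x.1 →
    ∀ (i : Fin n) (c : CP1), IsDirection S i c ↔ c = (H x).1 i

/-! The Seidel-Smith space -/

/-- The Slodowy slice in `𝔤𝔩(2m, ℂ)`. The index set `Fin m × Fin 2` stands for the division into
blocks of size `2 × 2`: the first block column is arbitrary, the blocks on the superdiagonal are the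
identity, and all other entries are zero. -/
def Slodowy (m : ℕ) : Set (Matrix (Fin m × Fin 2) (Fin m × Fin 2) ℂ) :=
  {A | ∀ (i j : Fin m) (a b : Fin 2), j.val ≠ 0 →
    A (i, a) (j, b) = if i.val + 1 = j.val ∧ a = b then 1 else 0}

/-- The Seidel-Smith space: the matrices in the Slodowy slice whose multiset of eigenvalues is
`{μ 0, …, μ (2m - 1)}`. -/
def SeidelSmith (m : ℕ) (μ : Fin (2 * m) → ℂ) :
    Set (Matrix (Fin m × Fin 2) (Fin m × Fin 2) ℂ) :=
  {A | A ∈ Slodowy m ∧ A.charpoly.roots = Finset.univ.val.map μ}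

/-! The Kamnitzer isomorphism -/

namespace HolBundle

/-- The section `s` is holomorphic on `N`. -/
def HolOn (E : HolBundle) (s : ∀ x, E.Fib x) (N : Set CP1) : Prop :=
  ContMDiffOn 𝓘(ℂ) (𝓘(ℂ).prod 𝓘(ℂ, Fin 2 → ℂ)) ω (fun x => (⟨x, s x⟩ : E.Tot)) N

/-- The space `Γ(U, E)` of the algebraic sections of `E` over `U = U 0`: the holomorphic sections
over `U` with at most a pole at the point at infinity, that is, of the form `ξ ^ k • t` with `t`
holomorphic near infinity. A section over `U` is stored as its extension by zero. -/
def sections (E : HolBundle) : Submodule ℂ (∀ x, E.Fib x) where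
  carrier := {s | (∀ x ∉ CP1.U 0, s x = 0) ∧ E.HolOn s (CP1.U 0) ∧
    ∃ (k : ℕ) (t : ∀ x, E.Fib x), E.HolOn t (CP1.U 1) ∧
      ∀ x ∈ CP1.U 0 ∩ CP1.U 1, s x = CP1.ξ 0 x ^ k • t x}
  zero_mem' := ⟨fun _ _ => rfl, (contMDiff_zeroSection ℂ E.Fib).contMDiffOn, 0, 0,
    (contMDiff_zeroSection ℂ E.Fib).contMDiffOn, fun _ _ => by simp⟩
  add_mem' := by
    rintro s s' ⟨h1, h2, k, t, h3, h4⟩ ⟨h1', h2', k', t', h3', h4'⟩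
    refine ⟨fun x hx => by simp [h1 x hx, h1' x hx], h2.add_section h2', k + k',
      (fun x => CP1.ξ 1 x ^ k') • t + (fun x => CP1.ξ 1 x ^ k) • t', ?_, ?_⟩
    · exact (((CP1.contMDiffOn_ξ 1).pow k').smul_section h3).add_section
        (((CP1.contMDiffOn_ξ 1).pow k).smul_section h3')
    · intro x hx
      have h : CP1.ξ 0 x * CP1.ξ 1 x = 1 := CP1.ξ_mul_ξ 0 hx.1 hx.2
      have e1 : CP1.ξ 0 x ^ (k + k') * CP1.ξ 1 x ^ k' = CP1.ξ 0 x ^ k := by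
        rw [pow_add, mul_assoc, ← mul_pow, h, one_pow, mul_one]
      have e2 : CP1.ξ 0 x ^ (k + k') * CP1.ξ 1 x ^ k = CP1.ξ 0 x ^ k' := by
        rw [add_comm, pow_add, mul_assoc, ← mul_pow, h, one_pow, mul_one]
      change s x + s' x = _ • (CP1.ξ 1 x ^ k' • t x + CP1.ξ 1 x ^ k • t' x)
      rw [smul_add, smul_smul, smul_smul, e1, e2, h4 x hx, h4' x hx]
  smul_mem' := by
    rintro c s ⟨h1, h2, k, t, h3, h4⟩
    refine ⟨fun x hx => by simp [h1 x hx], h2.const_smul_section, k, c • t,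
      h3.const_smul_section, fun x hx => ?_⟩
    change c • s x = _ • c • t x
    rw [h4 x hx, smul_comm]

/-- Multiplication of sections by the coordinate `z = ξ 0`. -/
def mulZ (E : HolBundle) : Module.End ℂ E.sections where
  toFun s := ⟨fun x => CP1.ξ 0 x • s.1 x, by
    obtain ⟨s, h1, h2, k, t, h3, h4⟩ := s
    refine ⟨fun x hx => by simp [h1 x hx], (CP1.contMDiffOn_ξ 0).smul_section h2, k + 1, t, h3,
      fun x hx => ?_⟩
    change _ • s x = _
    rw [h4 x hx, smul_smul, pow_succ']⟩
  map_add' s s' := by ext x; exact smul_add _ _ _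
  map_smul' c s := by ext x; exact smul_comm _ _ _

open Classical in
/-- The standard sections `e¹`, `e²` of `𝒪 ⊕ 𝒪` over `U`. -/
def stdSection (j : Fin 2) : triv.sections :=
  ⟨fun x => if x ∈ CP1.U 0 then (Pi.single j 1 : Fin 2 → ℂ) else (0 : Fin 2 → ℂ), by
    have hc : triv.HolOn (fun _ => (Pi.single j 1 : Fin 2 → ℂ)) univ := by
      intro x _
      rw [contMDiffWithinAt_section]
      exact contMDiffWithinAt_const (c := (Pi.single j 1 : Fin 2 → ℂ))
    refine ⟨fun x hx => if_neg hx, ?_, 0, fun _ => (Pi.single j 1 : Fin 2 → ℂ),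
      hc.mono (subset_univ _), fun x hx => ?_⟩
    · refine (hc.mono (subset_univ _)).congr fun x hx => ?_
      change (⟨x, if x ∈ CP1.U 0 then (Pi.single j 1 : Fin 2 → ℂ) else 0⟩ : triv.Tot) = _
      rw [if_pos hx]
    · change (if x ∈ CP1.U 0 then (Pi.single j 1 : Fin 2 → ℂ) else 0) = _
      rw [if_pos hx.1, pow_zero, one_smul]⟩

end HolBundle

/-- The map `Γ(U, F) → Γ(U, E)` induced by a morphism `F → E`. -/
def HolHom.onSections {F E : HolBundle} (α : HolHom F E) : F.sections →ₗ[ℂ] E.sections where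
  toFun s := ⟨fun x => α.map x (s.1 x), by
    obtain ⟨s, h1, h2, k, t, h3, h4⟩ := s
    refine ⟨fun x hx => by simp [h1 x hx], α.hol.comp_contMDiffOn h2, k, fun x => α.map x (t x),
      α.hol.comp_contMDiffOn h3, fun x hx => ?_⟩
    change α.map x (s x) = _
    rw [h4 x hx, map_smul]⟩
  map_add' s s' := by ext x; exact map_add _ _ _
  map_smul' c s := by ext x; exact map_smul _ _ _

namespace HeckeSeq

variable {n : ℕ} {p : Fin n → CP1}

/-- The vector space `V = coker(Γ(U, Eₙ) → Γ(U, E))`. -/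
abbrev Coker (S : HeckeSeq HolBundle.triv p) : Type :=
  HolBundle.triv.sections ⧸ LinearMap.range (S.toBase (Fin.last n)).onSections

/-- The action of `z` on `V`. -/
def zAct (S : HeckeSeq HolBundle.triv p) : Module.End ℂ S.Coker :=
  Submodule.mapQ _ _ (HolBundle.mulZ HolBundle.triv) (by
    rintro _ ⟨s, rfl⟩
    exact ⟨HolBundle.mulZ _ s, Subtype.ext (funext fun x => map_smul _ _ _)⟩)

/-- `A` is the matrix of the action of `z` on `V` relative to the basis
`z^(m-1) e¹, z^(m-1) e², …, z e¹, z e², e¹, e²`. -/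
def IsKamnitzerMatrix {m : ℕ} (S : HeckeSeq HolBundle.triv p)
    (A : Matrix (Fin m × Fin 2) (Fin m × Fin 2) ℂ) : Prop :=
  ∃ b : Module.Basis (Fin m × Fin 2) ℂ S.Coker,
    (∀ (i : Fin m) (j : Fin 2), b (i, j) =
      Submodule.Quotient.mk ((HolBundle.mulZ _ ^ (m - 1 - i.val)) (HolBundle.stdSection j))) ∧
    A = LinearMap.toMatrix b b S.zAct

end HeckeSeq

/-- `K` is the Kamnitzer map. -/
def IsKamnitzerMap {m : ℕ} {p : Fin (2 * m) → CP1}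
    (K : HeckeSpace p → SeidelSmith m (fun i => CP1.ξ 0 (p i))) : Prop :=
  ∀ (x : HeckeSpace p) (S : HeckeSeq HolBundle.triv p), S.cls = x.1 →
    ∀ A, S.IsKamnitzerMatrix A ↔ A = (K x).1

/-! The Woodward embedding -/

/-- `c` is the point `[X : Y]`, where `(X, Y)` is the last block of a left eigenvector of `A` with
eigenvalue `μ`. -/
def IsWoodwardPoint {m : ℕ} (A : Matrix (Fin m × Fin 2) (Fin m × Fin 2) ℂ) (μ : ℂ) (c : CP1) :
    Prop :=
  ∃ v : Fin m × Fin 2 → ℂ, v ≠ 0 ∧ Matrix.vecMul v A = μ • v ∧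
    ∃ i : Fin m, i.val + 1 = m ∧
      ∃ h : ![v (i, 0), v (i, 1)] ≠ 0, c = Projectivization.mk ℂ ![v (i, 0), v (i, 1)] h

/-- `W` is the Woodward embedding, for the ordering `μ 0, …, μ (2m - 1)` of the eigenvalues. -/
def IsWoodwardEmbedding {m : ℕ} {μ : Fin (2 * m) → ℂ} (W : SeidelSmith m μ → MSpace (2 * m)) :
    Prop :=
  ∀ (A : SeidelSmith m μ) (k : Fin (2 * m)) (c : CP1),
    IsWoodwardPoint A.1 (μ k) c ↔ c = (W A).1 k

/-! The rotation of the projective line -/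

/-- The linear map `(x, y) ↦ (-y, x)`. -/
def rotLin : (Fin 2 → ℂ) →ₗ[ℂ] (Fin 2 → ℂ) := Matrix.toLin' !![0, -1; 1, 0]

lemma rotLin_apply (v : Fin 2 → ℂ) : rotLin v = ![-v 1, v 0] := by
  ext k; fin_cases k <;> simp [rotLin, Matrix.mulVec, Matrix.vecHead, Matrix.vecTail]

lemma rotLin_rotLin (v : Fin 2 → ℂ) : rotLin (rotLin v) = -v := by
  rw [rotLin_apply, rotLin_apply]; ext k; fin_cases k <;> simp

lemma rotLin_injective : Function.Injective rotLin := fun v w h => by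
  have := congrArg rotLin h
  simpa [rotLin_rotLin] using this

/-- The automorphism `[x : y] ↦ [-y : x]` of `CP1`. -/
def rot : CP1 → CP1 := Projectivization.map rotLin rotLin_injective

lemma rot_rot (c : CP1) : rot (rot c) = c := by
  induction c using Projectivization.ind with
  | h v hv =>
    simp only [rot, Projectivization.map_mk]
    rw [Projectivization.mk_eq_mk_iff']
    exact ⟨-1, by simp [rotLin_rotLin]⟩

/-- The isomorphism of `ℳ(S², n)` that applies `[x : y] ↦ [-y : x]` to each coordinate. -/
def rotM (n : ℕ) : MSpace n ≃ MSpace n :=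
  Function.Involutive.toPerm
    (fun a => ⟨fun i => rot (a.1 i), fun c => by
      have : {i | rot (a.1 i) = c} = {i | a.1 i = rot c} := by
        ext i
        exact ⟨fun h => by rw [← show rot (a.1 i) = c from h]; exact (rot_rot _).symm, fun h => by
          change rot (a.1 i) = c
          rw [show a.1 i = rot c from h, rot_rot]⟩
      rw [this]
      exact a.2 (rot c)⟩)
    (fun a => Subtype.ext (funext fun i => rot_rot _))

end

open Bundle Topology Set
open scoped Manifold ContDiff LinearAlgebra.Projectivization

noncomputable section

/-! Everything is read off from the directions. Let `h i` be the image, a line in ℂ², of the fibre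
at `p i` of the composite to 𝒪 ⊕ 𝒪. Since the `p i` are distinct, later modifications are
isomorphisms near `p i`. So the last bundle is the sheaf of sections of 𝒪 ⊕ 𝒪 whose value at each `p
i` lies in `h i` (`HeckeSeq.isMod_toBase`). Such a subsheaf is unique up to isomorphism over 𝒪 ⊕ 𝒪
(`IsMod.exists_iso`), so the directions determine the class, and every tuple of lines occurs
(`exists_heckeSeq`).

Let `l i = rotLin (h i).rep`, a linear form with kernel `h i`. The map `s ↦ (l i (s (p i)))` has
kernel the image of Γ(U, E₂ₘ) (`HeckeSeq.ker_evalForms`), so V embeds in ℂ²ᵐ with z acting as D =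
diag(μ). On the monomials zᵏeʲ the embedding has the matrix P with rows (μᵢᵐ⁻¹ lᵢ, …, lᵢ), called
`eigenRows` or `dirRows`. If P is invertible, the monomials form a basis of V, and the Kamnitzer
matrix is the unique A with PA = DP. The shape of P puts A in the Slodowy slice with spectrum μ. The
rows of P are its left eigenvectors, with last blocks `l i`. This is the identity W ∘ K = Φ ∘ H.

The analytic core is that P is invertible exactly when E₂ₘ is a sum of two copies of the same line
bundle. A kernel vector of P is a polynomial vector of degree < m with values in the lines, hence a
section of E₂ₘ with small pole at infinity. Degrees force a ≤ -m in E₂ₘ ≅ 𝒪(a) ⊕ 𝒪(a), so Liouville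
kills it (`IsMod.degree_le`, `IsMod.eigenRows_injective`). Conversely, if PA = DP, the first block
column Y of A gives the monic matrix polynomial zᵐ - ∑ zᵐ⁻¹⁻ʲ Yⱼ. Its value at μᵢ maps into `h i`
and its determinant is ∏ (z - μᵢ). It is thus a morphism 𝒪(-m) ⊕ 𝒪(-m) → 𝒪 ⊕ 𝒪 with the directions
`h`, and uniqueness identifies its source with E₂ₘ (`exists_isMod_of_monicMat`).

Surjectivity of K: a matrix in the slice with distinct eigenvalues has independent left
eigenvectors, and the slice forces them to be rows of the above form (`SeidelSmith.exists_dirRows`).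
Injectivity: A recovers the lines through its left eigenvectors. -/

open CP1 HolBundle

/-! ### Topology of the projective line and holomorphic functions on it -/

namespace CP1

lemma exists_mem_U (x : CP1) : ∃ i, x ∈ U i := by
  by_cases h : x ∈ U 0
  exacts [⟨0, h⟩, ⟨1, mem_U_one_of_not_mem h⟩]

lemma U_mem_nhds {i : Fin 2} {x : CP1} (hx : x ∈ U i) : U i ∈ 𝓝 x := (isOpen_U i).mem_nhds hx

instance : T1Space CP1 := by
  refine ⟨fun x => ⟨isOpen_iff_mem_nhds.2 fun y hy => ?_⟩⟩
  obtain ⟨i, hi⟩ := exists_mem_U y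
  by_cases hx : x ∈ U i
  · have h1 : ξ i y ≠ ξ i x := fun h => hy (by
      rw [mem_singleton_iff, ← pt_ξ i x hx, ← h, pt_ξ i y hi])
    filter_upwards [((continuousOn_ξ i).continuousAt (U_mem_nhds hi)).eventually_ne h1]
      with q hq hqx
    rw [mem_singleton_iff] at hqx
    exact hq (by rw [hqx])
  · filter_upwards [U_mem_nhds hi] with q hq hqx
    rw [mem_singleton_iff] at hqx
    exact hx (hqx ▸ hq)

lemma eventually_notMem_of_finite {P : Set CP1} (hP : P.Finite) (x : CP1) :
    ∀ᶠ q in 𝓝 x, q ≠ x → q ∉ P := by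
  have h : IsClosed (P \ {x}) := (hP.subset sdiff_subset).isClosed
  filter_upwards [h.isOpen_compl.mem_nhds (by simp)] with q hq hqx hqP
  exact hq ⟨hqP, hqx⟩

lemma tendsto_pt (i : Fin 2) {x : CP1} (hx : x ∈ U i) :
    Filter.Tendsto (pt i) (𝓝 (ξ i x)) (𝓝 x) := by
  simpa [ContinuousAt, pt_ξ i x hx] using (continuous_pt i).continuousAt (x := ξ i x)

lemma tendsto_ξ (i : Fin 2) {x : CP1} (hx : x ∈ U i) :
    Filter.Tendsto (ξ i) (𝓝 x) (𝓝 (ξ i x)) :=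
  (continuousOn_ξ i).continuousAt (U_mem_nhds hx)

lemma eventually_nhds_iff {i : Fin 2} {x : CP1} (hx : x ∈ U i) {r : CP1 → Prop} :
    (∀ᶠ q in 𝓝 x, r q) ↔ ∀ᶠ z in 𝓝 (ξ i x), r (pt i z) := by
  refine ⟨fun h => (tendsto_pt i hx).eventually h, fun h => ?_⟩
  filter_upwards [(tendsto_ξ i hx).eventually h, U_mem_nhds hx] with q hq hqU
  rwa [pt_ξ i q hqU] at hq

instance (x : CP1) : (𝓝[≠] x).NeBot := by
  obtain ⟨i, hi⟩ := exists_mem_U x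
  by_contra hn
  have h : ∀ᶠ q in 𝓝 x, q ≠ x → False := by
    have h : ∀ᶠ q in 𝓝[≠] x, False := by rw [Filter.not_neBot.1 hn]; exact Filter.eventually_bot
    exact eventually_nhdsWithin_iff.1 h
  rw [eventually_nhds_iff hi] at h
  have h2 : ∀ᶠ z in 𝓝[≠] (ξ i x), False := by
    filter_upwards [nhdsWithin_le_nhds h, self_mem_nhdsWithin] with z hz hzx
    refine hz fun h => hzx ?_
    rw [mem_singleton_iff, ← h, ξ_pt]
  exact h2.exists.elim fun _ h => h

/-- Holomorphic at a point: functions on the projective line with values in a vector space. -/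
def AnAt {V : Type*} [NormedAddCommGroup V] [NormedSpace ℂ V] (f : CP1 → V) (x : CP1) : Prop :=
  ContMDiffAt 𝓘(ℂ) 𝓘(ℂ, V) ω f x

section

variable {V : Type*} [NormedAddCommGroup V] [NormedSpace ℂ V]

lemma AnAt.congr {f g : CP1 → V} {x : CP1} (hf : AnAt f x) (h : ∀ᶠ q in 𝓝 x, g q = f q) :
    AnAt g x :=
  ContMDiffAt.congr_of_eventuallyEq hf h

lemma AnAt.continuousAt {f : CP1 → V} {x : CP1} (hf : AnAt f x) : ContinuousAt f x :=
  ContMDiffAt.continuousAt hf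

lemma anAt_const (c : V) (x : CP1) : AnAt (fun _ => c) x := contMDiffAt_const

variable [CompleteSpace V]

/-- Both affine charts and their inverses are holomorphic; this turns every later holomorphy check
into analyticity in one complex variable. -/
lemma anAt_iff {i : Fin 2} {f : CP1 → V} {x : CP1} (hx : x ∈ U i) :
    AnAt f x ↔ AnalyticAt ℂ (fun z => f (pt i z)) (ξ i x) := by
  constructor
  · intro h
    have h1 : ContMDiffAt 𝓘(ℂ) 𝓘(ℂ) ω (pt i) (ξ i x) :=
      (contMDiffOn_symm_of_mem_maximalAtlas (chart_mem_maximalAtlas i)).contMDiffAt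
        (Filter.univ_mem)
    have h2 : ContMDiffAt 𝓘(ℂ) 𝓘(ℂ, V) ω (fun z => f (pt i z)) (ξ i x) :=
      ContMDiffAt.comp (ξ i x) (by rw [pt_ξ i x hx]; exact h) h1
    exact (contMDiffAt_iff_contDiffAt.1 h2).analyticAt
  · intro h
    have h1 : ContMDiffAt 𝓘(ℂ) 𝓘(ℂ) ω (ξ i) x := (contMDiffOn_ξ i).contMDiffAt (U_mem_nhds hx)
    have h2 : ContMDiffAt 𝓘(ℂ) 𝓘(ℂ, V) ω (fun z => f (pt i z)) (ξ i x) :=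
      h.contDiffAt.contMDiffAt
    refine (h2.comp x h1).congr_of_eventuallyEq ?_
    filter_upwards [U_mem_nhds hx] with q hq
    simp [pt_ξ i q hq]

lemma AnAt.add {f g : CP1 → V} {x : CP1} (hf : AnAt f x) (hg : AnAt g x) :
    AnAt (fun q => f q + g q) x := by
  obtain ⟨i, hi⟩ := exists_mem_U x
  rw [anAt_iff hi] at *
  exact hf.add hg

lemma AnAt.smul {f : CP1 → ℂ} {g : CP1 → V} {x : CP1} (hf : AnAt f x) (hg : AnAt g x) :
    AnAt (fun q => f q • g q) x := by
  obtain ⟨i, hi⟩ := exists_mem_U x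
  rw [anAt_iff hi] at *
  exact hf.smul hg

lemma AnAt.mul {f g : CP1 → ℂ} {x : CP1} (hf : AnAt f x) (hg : AnAt g x) :
    AnAt (fun q => f q * g q) x := hf.smul hg

lemma anAt_pi {f : CP1 → Fin 2 → ℂ} {x : CP1} : AnAt f x ↔ ∀ k, AnAt (fun q => f q k) x := by
  obtain ⟨i, hi⟩ := exists_mem_U x
  simp only [anAt_iff hi]
  exact analyticAt_pi_iff

lemma anAt_ξ {i : Fin 2} {x : CP1} (hx : x ∈ U i) : AnAt (ξ i) x :=
  (contMDiffOn_ξ i).contMDiffAt (U_mem_nhds hx)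

end

end CP1

/-! ### Analytic 2 × 2 matrix functions -/

/-- A matrix of functions that are analytic at a point. -/
def MatAn (M : ℂ → Matrix (Fin 2) (Fin 2) ℂ) (μ : ℂ) : Prop :=
  ∀ i j, AnalyticAt ℂ (fun z => M z i j) μ

namespace MatAn

variable {M N : ℂ → Matrix (Fin 2) (Fin 2) ℂ} {μ : ℂ}

lemma mulVec (hM : MatAn M μ) {f : ℂ → Fin 2 → ℂ} (hf : AnalyticAt ℂ f μ) :
    AnalyticAt ℂ (fun z => (M z).mulVec (f z)) μ := by
  rw [analyticAt_pi_iff] at *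
  intro k
  simp only [Matrix.mulVec, dotProduct, Fin.sum_univ_two]
  exact ((hM k 0).mul (hf 0)).add ((hM k 1).mul (hf 1))

lemma mul (hM : MatAn M μ) (hN : MatAn N μ) : MatAn (fun z => M z * N z) μ := by
  intro i j
  simp only [Matrix.mul_apply, Fin.sum_univ_two]
  exact ((hM i 0).mul (hN 0 j)).add ((hM i 1).mul (hN 1 j))

lemma const (C : Matrix (Fin 2) (Fin 2) ℂ) (μ : ℂ) : MatAn (fun _ => C) μ :=
  fun _ _ => analyticAt_const

lemma det (hM : MatAn M μ) : AnalyticAt ℂ (fun z => (M z).det) μ := by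
  simp only [Matrix.det_fin_two]
  exact ((hM 0 0).mul (hM 1 1)).sub ((hM 0 1).mul (hM 1 0))

lemma eventually_det_ne (hM : MatAn M μ) (h : (M μ).det ≠ 0) : ∀ᶠ z in 𝓝 μ, (M z).det ≠ 0 :=
  hM.det.continuousAt.eventually_ne h

lemma inv (hM : MatAn M μ) (h : (M μ).det ≠ 0) : MatAn (fun z => (M z)⁻¹) μ := by
  have hd : AnalyticAt ℂ (fun z => ((M z).det)⁻¹) μ := hM.det.inv h
  have e : ∀ z, (M z)⁻¹ = ((M z).det)⁻¹ • !![M z 1 1, -M z 0 1; -M z 1 0, M z 0 0] := by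
    intro z
    rw [Matrix.inv_def, Matrix.adjugate_fin_two, Ring.inverse_eq_inv']
  intro i j
  simp only [e]
  fin_cases i <;> fin_cases j <;> simp [Matrix.smul_apply]
  · exact hd.mul (hM 1 1)
  · exact (hd.mul (hM 0 1)).neg
  · exact (hd.mul (hM 1 0)).neg
  · exact hd.mul (hM 0 0)

end MatAn

/-! ### Holomorphic sections and local trivializations -/

namespace HolBundle

variable {E F : HolBundle} {N : Set CP1} {x : CP1}

/-- The section `s` is holomorphic at the point `x`. -/
def HolAt (E : HolBundle) (s : ∀ x, E.Fib x) (x : CP1) : Prop :=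
  ContMDiffAt 𝓘(ℂ) (𝓘(ℂ).prod 𝓘(ℂ, Fin 2 → ℂ)) ω (fun q => (⟨q, s q⟩ : E.Tot)) x

lemma holOn_iff {s : ∀ x, E.Fib x} (hN : IsOpen N) : E.HolOn s N ↔ ∀ x ∈ N, E.HolAt s x :=
  ⟨fun h _ hx => ContMDiffOn.contMDiffAt h (hN.mem_nhds hx),
    fun h x hx => ContMDiffAt.contMDiffWithinAt (h x hx)⟩

lemma HolAt.congr {s t : ∀ x, E.Fib x} (hs : E.HolAt s x) (h : ∀ᶠ q in 𝓝 x, t q = s q) :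
    E.HolAt t x :=
  ContMDiffAt.congr_of_eventuallyEq hs (by filter_upwards [h] with q hq; rw [hq])

lemma HolAt.add {s t : ∀ x, E.Fib x} (hs : E.HolAt s x) (ht : E.HolAt t x) :
    E.HolAt (fun q => s q + t q) x :=
  ContMDiffAt.add_section hs ht

lemma HolAt.smul {c : CP1 → ℂ} {s : ∀ x, E.Fib x} (hc : AnAt c x) (hs : E.HolAt s x) :
    E.HolAt (fun q => c q • s q) x :=
  ContMDiffAt.smul_section hc hs

lemma holAt_iff (e : Trivialization (Fin 2 → ℂ) (π (Fin 2 → ℂ) E.Fib)) [MemTrivializationAtlas e]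
    (hx : x ∈ e.baseSet) {s : ∀ x, E.Fib x} :
    E.HolAt s x ↔ AnAt (fun q => (e ⟨q, s q⟩).2) x :=
  e.contMDiffAt_section_iff hx

lemma holAt_triv {s : CP1 → Fin 2 → ℂ} : triv.HolAt s x ↔ AnAt s x :=
  contMDiffAt_section x

lemma exists_fibEquiv (E : HolBundle) (x : CP1) : Nonempty (E.Fib x ≃ₗ[ℂ] (Fin 2 → ℂ)) :=
  ⟨((trivializationAt (Fin 2 → ℂ) E.Fib x).continuousLinearEquivAt ℂ x
    (mem_baseSet_trivializationAt _ _ x)).toLinearEquiv⟩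

end HolBundle

lemma HolHom.holAt {F E : HolBundle} (α : HolHom F E) {s : ∀ x, F.Fib x} {x : CP1}
    (hs : F.HolAt s x) : E.HolAt (fun q => α.map q (s q)) x :=
  ContMDiffAt.comp x (α.hol _) hs

namespace HolTriv

variable {E F : HolBundle} {N N' : Set CP1} {x : CP1}

/-- The restriction of a trivialization to a smaller set. -/
def mono (ψ : HolTriv E N) (h : N' ⊆ N) : HolTriv E N' :=
  ⟨ψ.map, ψ.hol.mono fun _ hv => h hv⟩

open Classical in
/-- The trivialization given by linear maps that are bijective over `N`. -/
def ofBijective (f : ∀ x, E.Fib x →ₗ[ℂ] (Fin 2 → ℂ)) (hb : ∀ x ∈ N, Function.Bijective (f x))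
    (hol : ContMDiffOn (𝓘(ℂ).prod 𝓘(ℂ, Fin 2 → ℂ)) 𝓘(ℂ, Fin 2 → ℂ) ω
      (fun v : E.Tot => f v.1 v.2) {v | v.1 ∈ N}) : HolTriv E N where
  -- Outside `N` any linear equivalence of the fibre with ℂ² will do.
  map x := if h : x ∈ N then LinearEquiv.ofBijective (f x) (hb x h)
    else Classical.choice (E.exists_fibEquiv x)
  hol := hol.congr fun v (hv : v.1 ∈ N) => by simp [hv]

lemma ofBijective_map {f : ∀ x, E.Fib x →ₗ[ℂ] (Fin 2 → ℂ)}
    (hb : ∀ x ∈ N, Function.Bijective (f x))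
    (hol : ContMDiffOn (𝓘(ℂ).prod 𝓘(ℂ, Fin 2 → ℂ)) 𝓘(ℂ, Fin 2 → ℂ) ω
      (fun v : E.Tot => f v.1 v.2) {v | v.1 ∈ N}) (hx : x ∈ N) (v : E.Fib x) :
    (ofBijective f hb hol).map x v = f x v := by
  simp [ofBijective, hx]

/-- The trivialization over the base set of a trivialization in the atlas. -/
def ofTrivialization (e : Trivialization (Fin 2 → ℂ) (π (Fin 2 → ℂ) E.Fib))
    [MemTrivializationAtlas e] : HolTriv E e.baseSet :=
  ofBijective (fun x => e.linearMapAt ℂ x)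
    (fun x hx => by
      rw [e.coe_linearMapAt_of_mem hx]
      exact (e.linearEquivAt ℂ x hx).bijective)
    (by
      have h1 : ContMDiffOn (𝓘(ℂ).prod 𝓘(ℂ, Fin 2 → ℂ)) 𝓘(ℂ, Fin 2 → ℂ) ω
          (fun v : E.Tot => (e v).2) e.source := contMDiff_snd.comp_contMDiffOn e.contMDiffOn
      rw [e.source_eq] at h1
      refine h1.congr fun v hv => ?_
      rw [e.coe_linearMapAt_of_mem hv])

lemma ofTrivialization_map (e : Trivialization (Fin 2 → ℂ) (π (Fin 2 → ℂ) E.Fib))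
    [MemTrivializationAtlas e] (hx : x ∈ e.baseSet) (v : E.Fib x) :
    (ofTrivialization e).map x v = (e ⟨x, v⟩).2 := by
  rw [ofTrivialization, ofBijective_map _ _ hx, e.coe_linearMapAt_of_mem hx]

lemma exists_at (E : HolBundle) {N : Set CP1} (hN : N ∈ 𝓝 x) :
    ∃ N' ⊆ N, IsOpen N' ∧ x ∈ N' ∧ Nonempty (HolTriv E N') := by
  obtain ⟨N', h1, h2, h3⟩ := mem_nhds_iff.1 hN
  let e := trivializationAt (Fin 2 → ℂ) E.Fib x
  exact ⟨N' ∩ e.baseSet, inter_subset_left.trans h1, h2.inter e.open_baseSet,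
    ⟨h3, mem_baseSet_trivializationAt _ _ x⟩, ⟨(ofTrivialization e).mono inter_subset_right⟩⟩

lemma anAt (ψ : HolTriv E N) (hN : N ∈ 𝓝 x) {s : ∀ x, E.Fib x} (hs : E.HolAt s x) :
    AnAt (fun q => ψ.map q (s q)) x := by
  obtain ⟨N', h1, h2, h3⟩ := mem_nhds_iff.1 hN
  have h4 : ContMDiffAt (𝓘(ℂ).prod 𝓘(ℂ, Fin 2 → ℂ)) 𝓘(ℂ, Fin 2 → ℂ) ω
      (fun v : E.Tot => ψ.map v.1 v.2) ⟨x, s x⟩ := by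
    refine ψ.hol.contMDiffAt (Filter.mem_of_superset ?_ fun v (hv : v.1 ∈ N') => h1 hv)
    exact (h2.preimage (FiberBundle.continuous_proj (Fin 2 → ℂ) E.Fib)).mem_nhds h3
  exact ContMDiffAt.comp x h4 hs

/-- The section with constant coordinates in a trivialization. -/
def frame (ψ : HolTriv E N) (v : Fin 2 → ℂ) (q : CP1) : E.Fib q := (ψ.map q).symm v

lemma eq_frame (ψ : HolTriv E N) (q : CP1) (v : E.Fib q) :
    v = ψ.map q v 0 • ψ.frame (Pi.single 0 1) q + ψ.map q v 1 • ψ.frame (Pi.single 1 1) q := by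
  apply (ψ.map q).injective
  rw [map_add, map_smul, map_smul, frame, frame, LinearEquiv.apply_symm_apply,
    LinearEquiv.apply_symm_apply]
  ext k
  fin_cases k <;> simp

end HolTriv

/-- The matrix function with columns `f` and `g`, in the affine coordinate. -/
def colMat (i : Fin 2) (f g : CP1 → Fin 2 → ℂ) (z : ℂ) : Matrix (Fin 2) (Fin 2) ℂ :=
  !![f (pt i z) 0, g (pt i z) 0; f (pt i z) 1, g (pt i z) 1]

lemma matAn_colMat {i : Fin 2} {f g : CP1 → Fin 2 → ℂ} {x : CP1} (hx : x ∈ U i) (hf : AnAt f x)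
    (hg : AnAt g x) : MatAn (colMat i f g) (ξ i x) := by
  rw [anAt_pi] at hf hg
  simp only [anAt_iff hx] at hf hg
  intro a b
  fin_cases a <;> fin_cases b <;> simp [colMat, hf, hg]

lemma colMat_mulVec (i : Fin 2) (f g : CP1 → Fin 2 → ℂ) {x : CP1} (hx : x ∈ U i)
    (v : Fin 2 → ℂ) : (colMat i f g (ξ i x)).mulVec v = v 0 • f x + v 1 • g x := by
  ext k
  fin_cases k <;> simp [colMat, pt_ξ i x hx, Matrix.mulVec, dotProduct] <;> ring

namespace HolTriv

variable {E F : HolBundle} {N N' : Set CP1} {x : CP1}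

lemma det_ne_zero_of_bijective {A : Matrix (Fin 2) (Fin 2) ℂ}
    (h : Function.Injective A.mulVec) : A.det ≠ 0 := by
  rw [Matrix.mulVec_injective_iff_isUnit, Matrix.isUnit_iff_isUnit_det] at h
  exact h.ne_zero

/-- A `HolTriv` is only required to be holomorphic as a map out of the bundle. Its inverse is
holomorphic because the matrix `M` comparing it with a trivialization `φ` of the atlas is analytic
and invertible: in `φ` the frame has the coordinates `M⁻¹ v`. -/
lemma holAt_frame (ψ : HolTriv E N) (hN : N ∈ 𝓝 x) (v : Fin 2 → ℂ) : E.HolAt (ψ.frame v) x := by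
  obtain ⟨i, hi⟩ := exists_mem_U x
  let e := trivializationAt (Fin 2 → ℂ) E.Fib x
  have hx : x ∈ e.baseSet := mem_baseSet_trivializationAt _ _ x
  let φ := ofTrivialization e
  have he : ∀ᶠ q in 𝓝 x, q ∈ e.baseSet := e.open_baseSet.mem_nhds hx
  have hφ : ∀ w, E.HolAt (φ.frame w) x := fun w => by
    rw [holAt_iff e hx]
    refine (anAt_const w x).congr ?_
    filter_upwards [he] with q hq
    rw [← ofTrivialization_map e hq]
    exact (φ.map q).apply_symm_apply w
  let M := colMat i (fun q => ψ.map q (φ.frame (Pi.single 0 1) q))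
    (fun q => ψ.map q (φ.frame (Pi.single 1 1) q))
  have hM : MatAn M (ξ i x) := matAn_colMat hi (ψ.anAt hN (hφ _)) (ψ.anAt hN (hφ _))
  have key : ∀ q ∈ U i, ∀ w : E.Fib q, (M (ξ i q)).mulVec (φ.map q w) = ψ.map q w := by
    intro q hq w
    rw [colMat_mulVec i _ _ hq]
    conv_rhs => rw [φ.eq_frame q w]
    simp
  have hdet : ∀ q ∈ U i, (M (ξ i q)).det ≠ 0 := fun q hq => by
    apply det_ne_zero_of_bijective
    intro a b hab
    obtain ⟨a, rfl⟩ := (φ.map q).surjective a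
    obtain ⟨b, rfl⟩ := (φ.map q).surjective b
    simp only [key q hq] at hab
    rw [(ψ.map q).injective hab]
  rw [holAt_iff e hx]
  have h1 : AnAt (fun q => (M (ξ i q))⁻¹.mulVec v) x := by
    rw [anAt_iff hi]
    simp only [ξ_pt]
    exact (hM.inv (hdet x hi)).mulVec analyticAt_const
  refine h1.congr ?_
  filter_upwards [he, U_mem_nhds hi] with q hq hqU
  rw [← ofTrivialization_map e hq]
  have h2 := key q hqU (ψ.frame v q)
  have h3 : ψ.map q (ψ.frame v q) = v := (ψ.map q).apply_symm_apply v
  rw [h3] at h2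
  conv_rhs => rw [← h2]
  rw [Matrix.mulVec_mulVec, Matrix.nonsing_inv_mul _ (hdet q hqU).isUnit, Matrix.one_mulVec]

lemma holAt_iff (ψ : HolTriv E N) (hN : N ∈ 𝓝 x) {s : ∀ x, E.Fib x} :
    E.HolAt s x ↔ AnAt (fun q => ψ.map q (s q)) x := by
  refine ⟨ψ.anAt hN, fun h => ?_⟩
  rw [anAt_pi] at h
  refine (((ψ.holAt_frame hN (Pi.single 0 1)).smul (h 0)).add
    ((ψ.holAt_frame hN (Pi.single 1 1)).smul (h 1))).congr ?_
  exact Filter.Eventually.of_forall fun q => ψ.eq_frame q (s q)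

end HolTriv

/-! ### Morphisms determined by their action on sections -/

namespace HolHom

variable {E F G : HolBundle} {x : CP1}

lemma ext' {α β : HolHom F E} (h : ∀ x v, α.map x v = β.map x v) : α = β := by
  obtain ⟨a, ha⟩ := α
  obtain ⟨b, hb⟩ := β
  obtain rfl : a = b := funext fun x => LinearMap.ext (h x)
  rfl

lemma contMDiffAt_of_frame {γ : ∀ x, F.Fib x →ₗ[ℂ] E.Fib x} {N : Set CP1} (ψ : HolTriv F N)
    (hN : N ∈ 𝓝 x) (h : ∀ v, E.HolAt (fun q => γ q (ψ.frame v q)) x) (w : F.Fib x) :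
    ContMDiffAt (𝓘(ℂ).prod 𝓘(ℂ, Fin 2 → ℂ)) (𝓘(ℂ).prod 𝓘(ℂ, Fin 2 → ℂ)) ω
      (fun v : F.Tot => (⟨v.1, γ v.1 v.2⟩ : E.Tot)) ⟨x, w⟩ := by
  let e := trivializationAt (Fin 2 → ℂ) E.Fib x
  have hx : x ∈ e.baseSet := mem_baseSet_trivializationAt _ _ x
  obtain ⟨N', h1, h2, h3⟩ := mem_nhds_iff.1 hN
  have hproj : ContMDiffAt (𝓘(ℂ).prod 𝓘(ℂ, Fin 2 → ℂ)) 𝓘(ℂ) ω (fun v : F.Tot => v.1) ⟨x, w⟩ :=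
    contMDiffAt_proj F.Fib
  rw [contMDiffAt_totalSpace]
  refine ⟨hproj, ?_⟩
  have hψ : ContMDiffAt (𝓘(ℂ).prod 𝓘(ℂ, Fin 2 → ℂ)) 𝓘(ℂ, Fin 2 → ℂ) ω
      (fun v : F.Tot => ψ.map v.1 v.2) ⟨x, w⟩ := by
    refine ψ.hol.contMDiffAt (Filter.mem_of_superset ?_ fun v (hv : v.1 ∈ N') => h1 hv)
    exact (h2.preimage (FiberBundle.continuous_proj (Fin 2 → ℂ) F.Fib)).mem_nhds h3
  have hc : ∀ k, ContMDiffAt (𝓘(ℂ).prod 𝓘(ℂ, Fin 2 → ℂ)) 𝓘(ℂ) ω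
      (fun v : F.Tot => ψ.map v.1 v.2 k) ⟨x, w⟩ := contMDiffAt_pi_space.1 hψ
  have hg : ∀ v, ContMDiffAt (𝓘(ℂ).prod 𝓘(ℂ, Fin 2 → ℂ)) 𝓘(ℂ, Fin 2 → ℂ) ω
      (fun u : F.Tot => (e ⟨u.1, γ u.1 (ψ.frame v u.1)⟩).2) ⟨x, w⟩ := fun v =>
    ContMDiffAt.comp (I' := 𝓘(ℂ)) (x := (⟨x, w⟩ : F.Tot))
      (g := fun q => (e ⟨q, γ q (ψ.frame v q)⟩).2) ((HolBundle.holAt_iff e hx).1 (h v)) hproj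
  refine (((hc 0).smul (hg (Pi.single 0 1))).add
    ((hc 1).smul (hg (Pi.single 1 1)))).congr_of_eventuallyEq ?_
  have hb : ∀ᶠ v : F.Tot in 𝓝 ⟨x, w⟩, v.1 ∈ e.baseSet :=
    (e.open_baseSet.preimage (FiberBundle.continuous_proj (Fin 2 → ℂ) F.Fib)).mem_nhds hx
  filter_upwards [hb] with v hv
  have hl : ∀ u, (e ⟨v.1, u⟩).2 = (HolTriv.ofTrivialization e).map v.1 u := fun u =>
    (HolTriv.ofTrivialization_map e hv u).symm
  change (e ⟨v.1, γ v.1 v.2⟩).2 = _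
  simp only [Pi.add_apply, Pi.smul_apply', hl]
  conv_lhs => rw [ψ.eq_frame v.1 v.2]
  simp only [map_add, map_smul]

/-- A family of linear maps that sends holomorphic sections to holomorphic sections is a
morphism. -/
def ofSections (γ : ∀ x, F.Fib x →ₗ[ℂ] E.Fib x)
    (h : ∀ x (s : ∀ x, F.Fib x), F.HolAt s x → E.HolAt (fun q => γ q (s q)) x) : HolHom F E where
  map := γ
  hol := fun v => by
    obtain ⟨x, w⟩ := v
    obtain ⟨N, -, h2, h3, ⟨ψ⟩⟩ := HolTriv.exists_at (x := x) F Filter.univ_mem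
    exact contMDiffAt_of_frame ψ (h2.mem_nhds h3)
      (fun v => h x _ (ψ.holAt_frame (h2.mem_nhds h3) v)) w

/-- Continuity suffices, since no point of the projective line is isolated. -/
lemma section_eq_of_eventually {s t : ∀ x, E.Fib x} (hs : E.HolAt s x) (ht : E.HolAt t x)
    (h : ∀ᶠ q in 𝓝 x, q ≠ x → s q = t q) : s x = t x := by
  obtain ⟨N, -, h2, h3, ⟨ψ⟩⟩ := HolTriv.exists_at (x := x) E Filter.univ_mem
  have h1 := (ψ.anAt (h2.mem_nhds h3) hs).continuousAt.tendsto.mono_left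
    (nhdsWithin_le_nhds (s := {x}ᶜ))
  have h4 := (ψ.anAt (h2.mem_nhds h3) ht).continuousAt.tendsto.mono_left
    (nhdsWithin_le_nhds (s := {x}ᶜ))
  apply (ψ.map x).injective
  refine tendsto_nhds_unique h1 (h4.congr' ?_)
  rw [Filter.EventuallyEq, eventually_nhdsWithin_iff]
  filter_upwards [h] with q hq hqx
  rw [hq hqx]

/-- A morphism that degenerates only at finitely many points is a monomorphism: two lifts agree off
`P`, hence everywhere by continuity along a holomorphic section through the given vector. -/
lemma comp_left_cancel (β : HolHom G E) {P : Set CP1} (hP : P.Finite)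
    (hβ : ∀ q ∉ P, Function.Injective (β.map q)) {γ γ' : HolHom F G}
    (h : ∀ x v, β.map x (γ.map x v) = β.map x (γ'.map x v)) : γ = γ' := by
  refine ext' fun x v => ?_
  obtain ⟨N, -, h2, h3, ⟨ψ⟩⟩ := HolTriv.exists_at (x := x) F Filter.univ_mem
  have hs := ψ.holAt_frame (h2.mem_nhds h3) (ψ.map x v)
  have hv : ψ.frame (ψ.map x v) x = v := (ψ.map x).symm_apply_apply v
  rw [← hv]
  refine section_eq_of_eventually (γ.holAt hs) (γ'.holAt hs) ?_
  filter_upwards [eventually_notMem_of_finite hP x] with q hq hqx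
  exact hβ q (hq hqx) (h _ _)

end HolHom

/-! ### The normal form of a modification at one point and its direction -/

lemma AnalyticAt.dslope_same {f : ℂ → ℂ} {μ : ℂ} (hf : AnalyticAt ℂ f μ) :
    AnalyticAt ℂ (dslope f μ) μ := by
  obtain ⟨p, hp⟩ := hf
  exact ⟨_, hp.has_fpower_series_dslope_fslope⟩

/-- A linear form whose kernel is the line `c`. -/
def lineForm (c : CP1) : (Fin 2 → ℂ) →ₗ[ℂ] ℂ where
  toFun v := rotLin c.rep 0 * v 0 + rotLin c.rep 1 * v 1
  map_add' v w := by simp only [Pi.add_apply]; ring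
  map_smul' a v := by simp only [Pi.smul_apply, smul_eq_mul, RingHom.id_apply]; ring

lemma lineForm_apply (c : CP1) (v : Fin 2 → ℂ) :
    lineForm c v = rotLin c.rep 0 * v 0 + rotLin c.rep 1 * v 1 := rfl

lemma lineForm_mk (w : Fin 2 → ℂ) (hw : w ≠ 0) (v : Fin 2 → ℂ) :
    lineForm (Projectivization.mk ℂ w hw) v = 0 ↔ ∃ a : ℂ, v = a • w := by
  obtain ⟨a, ha⟩ := Projectivization.exists_smul_eq_mk_rep ℂ w hw
  have h0 : lineForm (Projectivization.mk ℂ w hw) v = a * (w 0 * v 1 - w 1 * v 0) := by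
    rw [lineForm_apply, ← ha, rotLin_apply]
    simp [Units.smul_def]
    ring
  rw [h0, mul_eq_zero, or_iff_right a.ne_zero]
  constructor
  · intro h
    by_cases h1 : w 0 = 0
    · have h2 : w 1 ≠ 0 := fun h2 => hw (by ext k; fin_cases k <;> simp [h1, h2])
      refine ⟨v 1 / w 1, ?_⟩
      have h3 : v 0 = 0 := by simpa [h1, h2] using h
      ext k; fin_cases k <;> simp [h1, h2, h3]
    · refine ⟨v 0 / w 0, ?_⟩
      ext k; fin_cases k <;> simp [h1]
      field_simp
      linear_combination h
  · rintro ⟨b, rfl⟩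
    simp
    ring

lemma eq_of_lineForm {c c' : CP1} (h : ∀ v, lineForm c v = 0 → lineForm c' v = 0) : c = c' := by
  induction c using Projectivization.ind with
  | h w hw =>
    induction c' using Projectivization.ind with
    | h w' hw' =>
      obtain ⟨a, ha⟩ := (lineForm_mk w' hw' w).1
        (h w ((lineForm_mk w hw w).2 ⟨1, (one_smul _ _).symm⟩))
      rw [Projectivization.mk_eq_mk_iff']
      exact ⟨a, ha.symm⟩

lemma lineForm_mulVec {A : Matrix (Fin 2) (Fin 2) ℂ} (h : ![A 0 0, A 1 0] ≠ 0) (v : Fin 2 → ℂ)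
    (hv : v 1 = 0) : lineForm (Projectivization.mk ℂ ![A 0 0, A 1 0] h) (A.mulVec v) = 0 := by
  rw [lineForm_mk]
  refine ⟨v 0, ?_⟩
  ext k; fin_cases k <;> simp [Matrix.mulVec, dotProduct, hv, mul_comm]

namespace IsEta

variable {M : ℂ → Matrix (Fin 2) (Fin 2) ℂ} {μ : ℂ} {c : CP1}

lemma lineForm_eq_zero (h : IsEta M μ c) (v : Fin 2 → ℂ) : lineForm c ((M μ).mulVec v) = 0 := by
  obtain ⟨A, B, hA, hB, hAd, hBd, hM, h0, rfl⟩ := h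
  rw [hM.self_of_nhds, Matrix.mul_assoc, ← Matrix.mulVec_mulVec]
  apply lineForm_mulVec
  rw [← Matrix.mulVec_mulVec]
  simp [Matrix.mulVec, dotProduct]

/-- With `M = A diag(1, z - μ) B`, the condition on `f μ` says that the second coordinate of `A⁻¹ f`
vanishes at `μ`, so it can be divided by `z - μ` before applying `B⁻¹`. -/
lemma exists_lift (h : IsEta M μ c) {f : ℂ → Fin 2 → ℂ} (hf : AnalyticAt ℂ f μ)
    (hfc : lineForm c (f μ) = 0) :
    ∃ g : ℂ → Fin 2 → ℂ, AnalyticAt ℂ g μ ∧ ∀ᶠ z in 𝓝 μ, (M z).mulVec (g z) = f z := by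
  obtain ⟨A, B, hA, hB, hAd, hBd, hM, h0, rfl⟩ := h
  let u : ℂ → Fin 2 → ℂ := fun z => (A z)⁻¹.mulVec (f z)
  have hu : AnalyticAt ℂ u μ := (MatAn.inv hA hAd).mulVec hf
  have hu' := analyticAt_pi_iff.1 hu
  have hu1 : u μ 1 = 0 := by
    obtain ⟨a, ha⟩ := (lineForm_mk _ _ _).1 hfc
    have : u μ = a • Pi.single 0 1 := by
      have h1 : f μ = (A μ).mulVec (a • Pi.single 0 1) := by
        rw [ha]
        ext k; fin_cases k <;> simp [Matrix.mulVec, dotProduct, mul_comm]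
      change (A μ)⁻¹.mulVec (f μ) = _
      rw [h1, Matrix.mulVec_mulVec, Matrix.nonsing_inv_mul _ hAd.isUnit, Matrix.one_mulVec]
    simp [this]
  let w : ℂ → Fin 2 → ℂ := fun z => ![u z 0, dslope (fun z => u z 1) μ z]
  have hw : AnalyticAt ℂ w μ := by
    rw [analyticAt_pi_iff]
    intro k
    fin_cases k
    · exact hu' 0
    · exact (hu' 1).dslope_same
  refine ⟨fun z => (B z)⁻¹.mulVec (w z), (MatAn.inv hB hBd).mulVec hw, ?_⟩
  filter_upwards [hM, MatAn.eventually_det_ne hA hAd, MatAn.eventually_det_ne hB hBd]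
    with z hz hzA hzB
  have h2 : (!![1, 0; 0, z - μ] : Matrix (Fin 2) (Fin 2) ℂ).mulVec (w z) = u z := by
    have := sub_smul_dslope (fun z => u z 1) μ z
    simp only [hu1, sub_zero, smul_eq_mul] at this
    ext k; fin_cases k <;> simp [Matrix.mulVec, dotProduct, w, this]
  rw [hz, Matrix.mulVec_mulVec, Matrix.mul_assoc, Matrix.mul_nonsing_inv _ hzB.isUnit,
    Matrix.mul_one, ← Matrix.mulVec_mulVec, h2, Matrix.mulVec_mulVec,
    Matrix.mul_nonsing_inv _ hzA.isUnit, Matrix.one_mulVec]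

end IsEta

variable {F G : HolBundle} {p c : CP1}

/-- Near the point `p` of `U 0`, the morphism `α : F → 𝒪 ⊕ 𝒪` has the normal form of a Hecke
modification, and `c` is the image of its fibre map at `p`. -/
def IsModAt (α : HolHom F triv) (p c : CP1) : Prop :=
  ∃ N : Set CP1, IsOpen N ∧ p ∈ N ∧ N ⊆ CP1.U 0 ∧
    ∃ (ψ : HolTriv F N) (M : ℂ → Matrix (Fin 2) (Fin 2) ℂ),
      (∀ q ∈ N, ∀ v : F.Fib q,
        (α.map q v : Fin 2 → ℂ) = Matrix.mulVec (M (CP1.ξ 0 q)) (ψ.map q v)) ∧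
      IsEta M (CP1.ξ 0 p) c

namespace IsModAt

lemma exists_lift {α : HolHom F triv} (h : IsModAt α p c) {t : CP1 → Fin 2 → ℂ} (ht : AnAt t p)
    (htc : lineForm c (t p) = 0) :
    ∃ g : ∀ x, F.Fib x, F.HolAt g p ∧ ∀ᶠ q in 𝓝 p, (α.map q (g q) : Fin 2 → ℂ) = t q := by
  obtain ⟨N, hN, hpN, hNU, ψ, M, hM, hE⟩ := h
  have hp := hNU hpN
  have hf := (anAt_iff hp).1 ht
  obtain ⟨g, hg, hgf⟩ := hE.exists_lift hf (by rwa [pt_ξ 0 p hp])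
  refine ⟨fun q => (ψ.map q).symm (g (ξ 0 q)), ?_, ?_⟩
  · rw [ψ.holAt_iff (hN.mem_nhds hpN), anAt_iff hp]
    simpa only [LinearEquiv.apply_symm_apply, ξ_pt] using hg
  · filter_upwards [hN.mem_nhds hpN, (tendsto_ξ 0 hp).eventually hgf] with q hq hq2
    rw [hM q hq, LinearEquiv.apply_symm_apply, hq2, pt_ξ 0 q (hNU hq)]

/-- This makes the direction intrinsic: it is the image of the fibre map, whatever factorization is
chosen. For a vector on the line, a preimage is the value at `p` of a lift of the constant section.
-/
lemma lineForm_eq_zero_iff {α : HolHom F triv} (h : IsModAt α p c) (w : Fin 2 → ℂ) :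
    lineForm c w = 0 ↔ ∃ v, (α.map p v : Fin 2 → ℂ) = w := by
  constructor
  · intro hw
    obtain ⟨g, -, hg⟩ := h.exists_lift (anAt_const w p) hw
    exact ⟨g p, hg.self_of_nhds⟩
  · rintro ⟨v, rfl⟩
    obtain ⟨N, hN, hpN, hNU, ψ, M, hM, hE⟩ := h
    rw [hM p hpN]
    exact hE.lineForm_eq_zero _

lemma unique {c' : CP1} {β : HolHom G triv} {α : HolHom F triv} (h : IsModAt α p c)
    (h' : IsModAt β p c') (hr : ∀ v, ∃ w, β.map p w = α.map p v) : c = c' := by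
  refine eq_of_lineForm fun v hv => ?_
  obtain ⟨u, rfl⟩ := (h.lineForm_eq_zero_iff v).1 hv
  exact (h'.lineForm_eq_zero_iff _).2 (hr u)

/-- The isomorphism `α` is absorbed in the trivialization of the source, so the matrix `M` is
unchanged. -/
lemma comp_of_bijective {β : HolHom G triv} (h : IsModAt β p c) (α : HolHom F G)
    (hα : ∀ᶠ q in 𝓝 p, Function.Bijective (α.map q)) : IsModAt (β.comp α) p c := by
  obtain ⟨N, hN, hpN, hNU, ψ, M, hM, hE⟩ := h
  obtain ⟨N', hN'1, hN'2, hpN'⟩ := mem_nhds_iff.1 hα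
  let ψ' : HolTriv F (N ∩ N') := HolTriv.ofBijective
    (fun x => (ψ.map x).toLinearMap ∘ₗ α.map x)
    (fun x hx => (ψ.map x).bijective.comp (hN'1 hx.2))
    (ψ.hol.comp α.hol.contMDiffOn fun v hv => hv.1)
  refine ⟨N ∩ N', hN.inter hN'2, ⟨hpN, hpN'⟩, inter_subset_left.trans hNU, ψ', M, ?_, hE⟩
  intro q hq v
  rw [HolTriv.ofBijective_map _ _ hq]
  exact hM q hq.1 _

end IsModAt

lemma exists_lift_of_injective {α : HolHom F triv} {x : CP1}
    (h : Function.Injective (α.map x)) {t : CP1 → Fin 2 → ℂ} (ht : AnAt t x) :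
    ∃ g : ∀ x, F.Fib x, F.HolAt g x ∧ ∀ᶠ q in 𝓝 x, (α.map q (g q) : Fin 2 → ℂ) = t q := by
  obtain ⟨i, hi⟩ := exists_mem_U x
  obtain ⟨N, -, hN, hxN, ⟨ψ⟩⟩ := HolTriv.exists_at (x := x) F Filter.univ_mem
  have hNx := hN.mem_nhds hxN
  let M := colMat i (fun q => α.map q (ψ.frame (Pi.single 0 1) q))
    (fun q => α.map q (ψ.frame (Pi.single 1 1) q))
  have ha : ∀ v, AnAt (fun q => (α.map q (ψ.frame v q) : Fin 2 → ℂ)) x := fun v =>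
    holAt_triv.1 (α.holAt (ψ.holAt_frame hNx v))
  have hM : MatAn M (ξ i x) := matAn_colMat hi (ha _) (ha _)
  have key : ∀ q ∈ U i, ∀ w : F.Fib q, (M (ξ i q)).mulVec (ψ.map q w) = α.map q w := by
    intro q hq w
    rw [colMat_mulVec i _ _ hq]
    conv_rhs => rw [ψ.eq_frame q w]
    simp
  have hdet : (M (ξ i x)).det ≠ 0 := by
    apply HolTriv.det_ne_zero_of_bijective
    intro a b hab
    obtain ⟨a, rfl⟩ := (ψ.map x).surjective a
    obtain ⟨b, rfl⟩ := (ψ.map x).surjective b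
    simp only [key x hi] at hab
    rw [h hab]
  refine ⟨fun q => (ψ.map q).symm ((M (ξ i q))⁻¹.mulVec (t q)), ?_, ?_⟩
  · rw [ψ.holAt_iff hNx, anAt_iff hi]
    simp only [LinearEquiv.apply_symm_apply, ξ_pt]
    exact (hM.inv hdet).mulVec ((anAt_iff hi).1 ht)
  · filter_upwards [U_mem_nhds hi, (tendsto_ξ i hi).eventually (hM.eventually_det_ne hdet)]
      with q hq hd
    rw [← key q hq, LinearEquiv.apply_symm_apply, Matrix.mulVec_mulVec,
      Matrix.mul_nonsing_inv _ hd.isUnit, Matrix.one_mulVec]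

/-- Hecke modifications allow any holomorphic coordinate, directions use `ξ 0`. The two differ by a
factor `u` that does not vanish at the point, by the chain rule applied to the inverse coordinate
change. -/
lemma exists_factor_sub {ζ : OpenPartialHomeomorph CP1 ℂ}
    (hζ : ζ ∈ IsManifold.maximalAtlas 𝓘(ℂ) ω CP1) (hp : p ∈ ζ.source) (hpU : p ∈ U 0) :
    ∃ u : ℂ → ℂ, AnalyticAt ℂ u (ξ 0 p) ∧ u (ξ 0 p) ≠ 0 ∧
      ∀ z, ζ (pt 0 z) - ζ p = (z - ξ 0 p) * u z := by
  have h1 : AnAt ζ p :=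
    (contMDiffOn_of_mem_maximalAtlas hζ).contMDiffAt (ζ.open_source.mem_nhds hp)
  have h2 : AnalyticAt ℂ (fun z => ζ (pt 0 z)) (ξ 0 p) := (anAt_iff hpU).1 h1
  have h3 : ContMDiffAt 𝓘(ℂ) 𝓘(ℂ) ω ζ.symm (ζ p) :=
    (contMDiffOn_symm_of_mem_maximalAtlas hζ).contMDiffAt
      (ζ.open_target.mem_nhds (ζ.map_source hp))
  have h4 : ContMDiffAt 𝓘(ℂ) 𝓘(ℂ) ω (fun w => ξ 0 (ζ.symm w)) (ζ p) :=
    ContMDiffAt.comp (ζ p) (by rw [ζ.left_inv hp]; exact anAt_ξ hpU) h3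
  have h5 : DifferentiableAt ℂ (fun w => ξ 0 (ζ.symm w)) (ζ (pt 0 (ξ 0 p))) := by
    rw [pt_ξ 0 p hpU]
    exact (contMDiffAt_iff_contDiffAt.1 h4).analyticAt.differentiableAt
  have h6 : (fun z => ξ 0 (ζ.symm (ζ (pt 0 z)))) =ᶠ[𝓝 (ξ 0 p)] fun z => z := by
    filter_upwards [(tendsto_pt 0 hpU).eventually (ζ.open_source.mem_nhds hp)] with z hz
    rw [ζ.left_inv hz, ξ_pt]
  have h7 := (h5.hasDerivAt.comp (ξ 0 p) h2.differentiableAt.hasDerivAt).congr_of_eventuallyEq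
    h6.symm
  have h8 := h7.unique (hasDerivAt_id (ξ 0 p))
  refine ⟨dslope (fun z => ζ (pt 0 z)) (ξ 0 p), h2.dslope_same, ?_, fun z => ?_⟩
  · rw [dslope_same]
    intro h0
    rw [h0, mul_zero] at h8
    exact zero_ne_one h8
  · have := sub_smul_dslope (fun z => ζ (pt 0 z)) (ξ 0 p) z
    rw [smul_eq_mul, pt_ξ 0 p hpU] at this
    exact this.symm

/-- The left factor of the normal form is the matrix of `β`, invertible at `p`, and the right factor
is `diag(1, u)`, with `u` from the change of coordinate. -/
lemma IsHecke.exists_isModAt {α : HolHom F G} (hα : IsHecke p α) (hpU : p ∈ U 0)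
    {β : HolHom G triv} (hβ : Function.Injective (β.map p)) :
    ∃ c, IsModAt (β.comp α) p c := by
  obtain ⟨ζ, hζ, hp, ψG, ψF, h⟩ := hα.local_form
  have hN := ζ.open_source.mem_nhds hp
  let A := colMat 0 (fun q => β.map q (ψG.frame (Pi.single 0 1) q))
    (fun q => β.map q (ψG.frame (Pi.single 1 1) q))
  have ha : ∀ v, AnAt (fun q => (β.map q (ψG.frame v q) : Fin 2 → ℂ)) p := fun v =>
    holAt_triv.1 (β.holAt (ψG.holAt_frame hN v))
  have hA : MatAn A (ξ 0 p) := matAn_colMat hpU (ha _) (ha _)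
  have key : ∀ q ∈ U 0, ∀ w : G.Fib q, (A (ξ 0 q)).mulVec (ψG.map q w) = β.map q w := by
    intro q hq w
    rw [colMat_mulVec 0 _ _ hq]
    conv_rhs => rw [ψG.eq_frame q w]
    simp
  have hdet : (A (ξ 0 p)).det ≠ 0 := by
    apply HolTriv.det_ne_zero_of_bijective
    intro a b hab
    obtain ⟨a, rfl⟩ := (ψG.map p).surjective a
    obtain ⟨b, rfl⟩ := (ψG.map p).surjective b
    simp only [key p hpU] at hab
    rw [hβ hab]
  obtain ⟨u, hu, hu0, hζu⟩ := exists_factor_sub hζ hp hpU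
  have h0 : ![A (ξ 0 p) 0 0, A (ξ 0 p) 1 0] ≠ 0 := fun h0 => hdet (by
    have e0 := congrFun h0 0
    have e1 := congrFun h0 1
    simp at e0 e1
    simp [Matrix.det_fin_two, e0, e1])
  refine ⟨_, ζ.source ∩ U 0, ζ.open_source.inter (isOpen_U 0), ⟨hp, hpU⟩, inter_subset_right,
    ψF.mono inter_subset_left, fun z => A z * !![1, 0; 0, ζ (pt 0 z) - ζ p], ?_,
    A, fun z => !![1, 0; 0, u z], hA, ?_, hdet, ?_, ?_, h0, rfl⟩
  · intro q hq v
    change (β.map q (α.map q v) : Fin 2 → ℂ) = _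
    rw [← key q hq.2, h q hq.1, Matrix.mulVec_mulVec]
    simp only [pt_ξ 0 q hq.2]
    rfl
  · intro i j
    fin_cases i <;> fin_cases j <;> simp [analyticAt_const, hu]
  · simpa [Matrix.det_fin_two] using hu0
  · refine Filter.Eventually.of_forall fun z => ?_
    simp only [hζu, Matrix.mul_assoc]
    simp

/-! ### Modifications with several prescribed directions -/

/-- The morphism `α : F → 𝒪 ⊕ 𝒪` is bijective away from the points `p j` for `j ∈ J`, and at these
points it has the normal form of a Hecke modification with the directions `h j`. -/
structure IsMod {ι : Type*} (α : HolHom F triv) (J : Set ι) (p h : ι → CP1) : Prop where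
  bijective : ∀ q, (∀ j ∈ J, q ≠ p j) → Function.Bijective (α.map q)
  isModAt : ∀ j ∈ J, IsModAt α (p j) (h j)

namespace IsMod

variable {ι : Type*} {J : Set ι} {p h : ι → CP1} {β : HolHom G triv}

lemma bijective_of_notMem (hβ : IsMod β J p h) {q : CP1} (hq : q ∉ p '' J) :
    Function.Bijective (β.map q) :=
  hβ.bijective q fun j hj e => hq ⟨j, hj, e.symm⟩

lemma lineForm_eq_zero (hβ : IsMod β J p h) {j : ι} (hj : j ∈ J) (v : G.Fib (p j)) :
    lineForm (h j) (β.map (p j) v) = 0 :=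
  ((hβ.isModAt j hj).lineForm_eq_zero_iff _).2 ⟨v, rfl⟩

lemma exists_lift_at (hβ : IsMod β J p h) {x : CP1} {t : CP1 → Fin 2 → ℂ} (ht : AnAt t x)
    (htc : ∀ j ∈ J, p j = x → lineForm (h j) (t x) = 0) :
    ∃ g : ∀ x, G.Fib x, G.HolAt g x ∧ ∀ᶠ q in 𝓝 x, (β.map q (g q) : Fin 2 → ℂ) = t q := by
  by_cases hx : x ∈ p '' J
  · obtain ⟨j, hj, rfl⟩ := hx
    exact (hβ.isModAt j hj).exists_lift ht (htc j hj rfl)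
  · exact exists_lift_of_injective (hβ.bijective_of_notMem hx).1 ht

variable [Finite ι]

lemma eventually_injective (hβ : IsMod β J p h) (x : CP1) :
    ∀ᶠ q in 𝓝 x, q ≠ x → Function.Injective (β.map q) := by
  filter_upwards [eventually_notMem_of_finite (J.toFinite.image p) x] with q hq hqx
  exact (hβ.bijective_of_notMem (hq hqx)).1

lemma exists_lift (hβ : IsMod β J p h) {N : Set CP1} (hN : IsOpen N) {t : CP1 → Fin 2 → ℂ}
    (ht : ∀ x ∈ N, AnAt t x) (htc : ∀ j ∈ J, p j ∈ N → lineForm (h j) (t (p j)) = 0) :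
    ∃ g : ∀ x, G.Fib x, (∀ x ∈ N, G.HolAt g x) ∧ ∀ x ∈ N, (β.map x (g x) : Fin 2 → ℂ) = t x := by
  have h1 : ∀ x, ∃ g : ∀ x, G.Fib x, x ∈ N → G.HolAt g x ∧
      ∀ᶠ q in 𝓝 x, (β.map q (g q) : Fin 2 → ℂ) = t q := by
    intro x
    by_cases hx : x ∈ N
    · obtain ⟨g, hg⟩ := hβ.exists_lift_at (ht x hx) fun j hj e => e ▸ htc j hj (e ▸ hx)
      exact ⟨g, fun _ => hg⟩
    · exact ⟨0, fun h => absurd h hx⟩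
  choose g hg using h1
  have h2 : ∀ x ∈ N, (β.map x (g x x) : Fin 2 → ℂ) = t x :=
    fun x hx => (hg x hx).2.self_of_nhds
  -- The pointwise values of the local lifts glue: near `x`, away from `x` itself, `β` is injective,
  -- so the diagonal choice coincides with the single lift `g x`.
  refine ⟨fun x => g x x, fun x hx => (hg x hx).1.congr ?_, h2⟩
  filter_upwards [hN.mem_nhds hx, (hg x hx).2, hβ.eventually_injective x] with q hq h3 h4
  by_cases hqx : q = x
  · rw [hqx]
  · exact h4 hqx ((h2 q hq).trans h3.symm)

/-- The image of a local frame of `F` satisfies the line conditions, hence lifts locally through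
`β`; the lifts of a frame define `γ` linearly on each fibre, and injectivity of `β` off the finite
set makes the local choices agree. -/
lemma exists_factor (hβ : IsMod β J p h) (α : HolHom F triv)
    (hα : ∀ j ∈ J, ∀ v, lineForm (h j) (α.map (p j) v) = 0) :
    ∃ γ : HolHom F G, ∀ x v, β.map x (γ.map x v) = α.map x v := by
  have h1 : ∀ x, ∃ (N : Set CP1) (ψ : HolTriv F N), N ∈ 𝓝 x ∧ ∀ k : Fin 2,
      ∃ g : ∀ x, G.Fib x, G.HolAt g x ∧
        ∀ᶠ q in 𝓝 x, β.map q (g q) = α.map q (ψ.frame (Pi.single k 1) q) := by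
    intro x
    obtain ⟨N, -, hN, hxN, ⟨ψ⟩⟩ := HolTriv.exists_at (x := x) F Filter.univ_mem
    refine ⟨N, ψ, hN.mem_nhds hxN, fun k => hβ.exists_lift_at
      (holAt_triv.1 (α.holAt (ψ.holAt_frame (hN.mem_nhds hxN) _))) ?_⟩
    rintro j hj rfl
    exact hα j hj _
  choose N ψ hN g hg hgα using h1
  let γ : ∀ x, F.Fib x →ₗ[ℂ] G.Fib x := fun x =>
    { toFun := fun v => (ψ x).map x v 0 • g x 0 x + (ψ x).map x v 1 • g x 1 x
      map_add' := fun v w => by simp only [map_add, Pi.add_apply, add_smul]; abel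
      map_smul' := fun a v => by
        simp only [map_smul, Pi.smul_apply, smul_eq_mul, mul_smul, smul_add, RingHom.id_apply] }
  have hγ : ∀ x v, β.map x (γ x v) = α.map x v := by
    intro x v
    conv_rhs => rw [(ψ x).eq_frame x v]
    simp only [γ, LinearMap.coe_mk, AddHom.coe_mk, map_add, map_smul]
    rw [(hgα x 0).self_of_nhds, (hgα x 1).self_of_nhds]
  refine ⟨HolHom.ofSections γ fun x s hs => ?_, hγ⟩
  have hc := anAt_pi.1 ((ψ x).anAt (hN x) hs)
  refine (((hg x 0).smul (hc 0)).add ((hg x 1).smul (hc 1))).congr ?_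
  filter_upwards [hgα x 0, hgα x 1, hβ.eventually_injective x] with q h0 h1 h2
  by_cases hqx : q = x
  · subst hqx; rfl
  · apply h2 hqx
    rw [hγ, map_add, map_smul, map_smul, h0, h1]
    conv_lhs => rw [(ψ x).eq_frame q (s q)]
    rw [map_add, map_smul, map_smul]

/-- Each morphism factors through the other, and both composites are identities because `α` and `β`
can be cancelled. -/
lemma exists_iso (hβ : IsMod β J p h) {α : HolHom F triv} (hα : IsMod α J p h) :
    ∃ φ : HolIso F G, ∀ x v, β.map x (φ.hom.map x v) = α.map x v := by
  obtain ⟨γ, hγ⟩ := hβ.exists_factor α fun j hj => hα.lineForm_eq_zero hj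
  obtain ⟨δ, hδ⟩ := hα.exists_factor β fun j hj => hβ.lineForm_eq_zero hj
  have h1 : γ.comp δ = HolHom.id G := β.comp_left_cancel (J.toFinite.image p)
    (fun q hq => (hβ.bijective_of_notMem hq).1) fun x v => by
      change β.map x (γ.map x (δ.map x v)) = β.map x v
      rw [hγ, hδ]
  have h2 : δ.comp γ = HolHom.id F := α.comp_left_cancel (J.toFinite.image p)
    (fun q hq => (hα.bijective_of_notMem hq).1) fun x v => by
      change α.map x (δ.map x (γ.map x v)) = α.map x v
      rw [hδ, hγ]
  exact ⟨⟨γ, δ, fun x v => congrArg (fun f : HolHom G G => f.map x v) h1,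
    fun x v => congrArg (fun f : HolHom F F => f.map x v) h2⟩, hγ⟩

end IsMod

lemma HolIso.ext' {F E : HolBundle} {φ ψ : HolIso F E}
    (h : ∀ x v, φ.hom.map x v = ψ.hom.map x v) : φ = ψ := by
  obtain ⟨a, b, h1, h2⟩ := φ
  obtain ⟨a', b', h1', h2'⟩ := ψ
  obtain rfl : a = a' := HolHom.ext' h
  obtain rfl : b = b' := HolHom.ext' fun x v => by
    have := h2 x (HolHom.map b' x v)
    rwa [h1'] at this
  rfl

lemma HolIso.bijective {F E : HolBundle} (φ : HolIso F E) (x : CP1) :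
    Function.Bijective (φ.hom.map x) :=
  Function.bijective_iff_has_inverse.2 ⟨φ.inv.map x, φ.inv_hom x, φ.hom_inv x⟩

/-! ### Directions classify sequences of Hecke modifications -/

namespace HeckeSeq

variable {n : ℕ} {p : Fin n → CP1}

lemma toBase_succ (S : HeckeSeq triv p) (i : Fin n) :
    S.toBase i.succ = (S.toBase i.castSucc).comp (S.map i) :=
  Fin.induction_succ ..

lemma toBase_bijective (S : HeckeSeq triv p) (i : Fin (n + 1)) {q : CP1}
    (hq : ∀ j : Fin n, j.castSucc < i → q ≠ p j) : Function.Bijective ((S.toBase i).map q) := by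
  induction i using Fin.induction with
  | zero => exact Function.bijective_id
  | succ i ih =>
    rw [toBase_succ]
    exact (ih fun j hj => hq j (hj.trans i.castSucc_lt_succ)).comp
      ((S.isHecke i).bijective_away q (hq i i.castSucc_lt_succ))

lemma exists_isDirection (S : HeckeSeq triv p) (hp : Function.Injective p)
    (hU : ∀ i, p i ∈ CP1.U 0) (i : Fin n) : ∃ c, IsDirection S i c := by
  have h := (S.isHecke i).exists_isModAt (hU i) (β := S.toBase i.castSucc)
    (S.toBase_bijective _ fun j hj e => (hp e ▸ hj).false).1
  rw [← toBase_succ] at h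
  -- `IsDirection` is by definition `IsModAt` for the composite morphism.
  exact h

/-- A direction, once created, persists: the later modifications are supported at other points, so
they are bijective near `p j`. -/
lemma isMod_toBase (S : HeckeSeq triv p) (hp : Function.Injective p) {h : Fin n → CP1}
    (hh : ∀ i, IsDirection S i (h i)) (i : Fin (n + 1)) :
    IsMod (S.toBase i) {j | j.castSucc < i} p h := by
  refine ⟨fun q hq => S.toBase_bijective i hq, fun j hj => ?_⟩
  induction i using Fin.induction with
  | zero => exact absurd hj (by simp)
  | succ i ih =>
    by_cases hji : j = i
    · subst hji
      exact hh j
    · rw [toBase_succ]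
      refine (ih ?_).comp_of_bijective _ ?_
      · have h1 : j.castSucc < i.succ := hj
        rw [Fin.castSucc_lt_succ_iff] at h1
        exact Fin.castSucc_lt_castSucc_iff.2 (lt_of_le_of_ne h1 hji)
      · filter_upwards [isOpen_compl_singleton.mem_nhds
          (show p j ∈ ({p i}ᶜ : Set CP1) from fun e => hji (hp e))] with q hq
        exact (S.isHecke i).bijective_away q hq

lemma equivalent_toBase {S T : HeckeSeq triv p} {φ : ∀ i, HolIso (S.bun i) (T.bun i)}
    (h0 : φ 0 = HolIso.refl triv)
    (h : ∀ (i : Fin n) (x : CP1) (v : (S.bun i.succ).Fib x),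
      (φ i.castSucc).hom.map x ((S.map i).map x v) = (T.map i).map x ((φ i.succ).hom.map x v))
    (i : Fin (n + 1)) (x : CP1) (v : (S.bun i).Fib x) :
    (T.toBase i).map x ((φ i).hom.map x v) = (S.toBase i).map x v := by
  induction i using Fin.induction with
  | zero => rw [h0]; rfl
  | succ i ih =>
    rw [toBase_succ, toBase_succ]
    change (T.toBase i.castSucc).map x ((T.map i).map x _) = (S.toBase i.castSucc).map x _
    rw [← h, ih]

lemma Equivalent.isDirection_unique {S T : HeckeSeq triv p} (h : Equivalent S T) {i : Fin n}
    {c c' : CP1} (hc : IsDirection S i c) (hc' : IsDirection T i c') : c = c' := by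
  obtain ⟨φ, h0, h⟩ := h
  exact IsModAt.unique (α := S.toBase i.succ) (β := T.toBase i.succ) hc hc' fun v =>
    ⟨_, equivalent_toBase h0 h i.succ (p i) v⟩

/-- At each level the isomorphism over 𝒪 ⊕ 𝒪 comes from equal directions. It commutes with the
individual modifications since this holds after composition to 𝒪 ⊕ 𝒪, which can be cancelled. -/
lemma equivalent_of_isDirection {S T : HeckeSeq triv p} (hp : Function.Injective p)
    {h : Fin n → CP1} (hS : ∀ i, IsDirection S i (h i)) (hT : ∀ i, IsDirection T i (h i)) :
    Equivalent S T := by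
  have hmS := S.isMod_toBase hp hS
  have hmT := T.isMod_toBase hp hT
  choose φ hφ using fun i => (hmT i).exists_iso (hmS i)
  refine ⟨φ, HolIso.ext' fun x v => hφ 0 x v, fun i x v => ?_⟩
  have key : (φ i.castSucc).hom.comp (S.map i) = (T.map i).comp (φ i.succ).hom := by
    refine (T.toBase i.castSucc).comp_left_cancel (toFinite _)
      (fun q hq => ((hmT i.castSucc).bijective_of_notMem hq).1) fun x v => ?_
    have h1 := hφ i.succ x v
    rw [toBase_succ, toBase_succ] at h1
    exact (hφ i.castSucc x _).trans h1.symm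
  exact congrArg (fun f : HolHom _ _ => f.map x v) key

end HeckeSeq

namespace HTot

variable {n : ℕ} {p : Fin n → CP1}

/-- The directions of a class of sequences of Hecke modifications. -/
def dirs (x : HTot triv p) (i : Fin n) : CP1 :=
  Classical.epsilon fun c => IsDirection (Quotient.out x) i c

lemma isDirection_iff (hp : Function.Injective p) (hU : ∀ i, p i ∈ CP1.U 0) {x : HTot triv p}
    {S : HeckeSeq triv p} (hS : S.cls = x) (i : Fin n) (c : CP1) :
    IsDirection S i c ↔ c = dirs x i := by
  have h1 : IsDirection (Quotient.out x) i (dirs x i) :=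
    Classical.epsilon_spec ((Quotient.out x).exists_isDirection hp hU i)
  have h2 : HeckeSeq.Equivalent S (Quotient.out x) :=
    Quotient.exact (hS.trans (Quotient.out_eq x).symm)
  refine ⟨fun h => h2.isDirection_unique h h1, ?_⟩
  rintro rfl
  obtain ⟨c, hc⟩ := S.exists_isDirection hp hU i
  rwa [← h2.isDirection_unique hc h1]

lemma dirs_injective (hp : Function.Injective p) (hU : ∀ i, p i ∈ CP1.U 0) :
    Function.Injective (dirs (p := p)) := by
  intro x y hxy
  induction x using Quotient.ind with
  | _ S =>
    induction y using Quotient.ind with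
    | _ T =>
      exact Quotient.sound (HeckeSeq.equivalent_of_isDirection hp
        (fun i => (isDirection_iff hp hU rfl i _).2 rfl)
        fun i => (isDirection_iff hp hU rfl i _).2 (congrFun hxy i))

end HTot

/-! ### Linear algebra of the Slodowy slice and its left eigenvectors -/

lemma Matrix.exists_inverse_of_mulVec_injective {ι κ : Type*} [Fintype ι] [Fintype κ]
    [DecidableEq ι] [DecidableEq κ] (hc : Fintype.card ι = Fintype.card κ) {P : Matrix ι κ ℂ}
    (hP : Function.Injective P.mulVec) : ∃ Q : Matrix κ ι ℂ, P * Q = 1 ∧ Q * P = 1 := by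
  obtain ⟨g, hg⟩ := (Matrix.toLin' P).exists_leftInverse_of_injective (LinearMap.ker_eq_bot.2 hP)
  have h : LinearMap.toMatrix' g * P = 1 := by
    rw [← LinearMap.toMatrix'_toLin' P, ← LinearMap.toMatrix'_comp, hg, LinearMap.toMatrix'_id]
  exact ⟨LinearMap.toMatrix' g, (Matrix.mul_eq_one_comm_of_card_eq _ _ _ hc).2 h, h⟩

/-- The matrix whose rows are `(μᵢ ^ (m - 1) lᵢ, …, μᵢ lᵢ, lᵢ)`. -/
def eigenRows (m : ℕ) (μ : Fin (2 * m) → ℂ) (l : Fin (2 * m) → Fin 2 → ℂ) :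
    Matrix (Fin (2 * m)) (Fin m × Fin 2) ℂ :=
  Matrix.of fun i x => μ i ^ (m - 1 - x.1.val) * l i x.2

section

variable {m : ℕ} {μ : Fin (2 * m) → ℂ} {l : Fin (2 * m) → Fin 2 → ℂ}
  {A : Matrix (Fin m × Fin 2) (Fin m × Fin 2) ℂ}

lemma eigenRows_apply (i : Fin (2 * m)) (x : Fin m × Fin 2) :
    eigenRows m μ l i x = μ i ^ (m - 1 - x.1.val) * l i x.2 := rfl

lemma exists_inverse_eigenRows (h : Function.Injective (eigenRows m μ l).mulVec) :
    ∃ Q : Matrix (Fin m × Fin 2) (Fin (2 * m)) ℂ,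
      eigenRows m μ l * Q = 1 ∧ Q * eigenRows m μ l = 1 :=
  Matrix.exists_inverse_of_mulVec_injective (by simp [mul_comm]) h

/-- Multiplying column `(j, b)` of P by the `μ k` gives column `(j - 1, b)`. As PA = DP and P is
injective, A sends the corresponding basis vector to its predecessor, which is the Slodowy shape.
The spectrum is that of D, as A is conjugate to D through P. -/
lemma mem_seidelSmith_of_eigenRows (h : Function.Injective (eigenRows m μ l).mulVec)
    (hA : eigenRows m μ l * A = Matrix.diagonal μ * eigenRows m μ l) : A ∈ SeidelSmith m μ := by
  obtain ⟨Q, h1, h2⟩ := exists_inverse_eigenRows h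
  constructor
  · intro i j a b hj
    have hj' : j.val - 1 < m := by omega
    have h3 : A.mulVec (Pi.single (j, b) 1) = Pi.single (⟨j.val - 1, hj'⟩, b) 1 := by
      apply h
      rw [Matrix.mulVec_mulVec, hA]
      ext k
      simp only [Matrix.mulVec_single_one, Matrix.col_apply, Matrix.diagonal_mul, eigenRows_apply]
      rw [← mul_assoc, ← pow_succ']
      congr 3
      have := j.2
      omega
    have h4 := congrFun h3 (i, a)
    rw [Matrix.mulVec_single_one, Matrix.col_apply] at h4
    rw [h4, Pi.single_apply]
    refine if_congr ?_ rfl rfl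
    rw [Prod.mk.injEq, Fin.ext_iff]
    exact and_congr_left fun _ => by change i.val = j.val - 1 ↔ _; omega
  · have h3 : A = Q * (Matrix.diagonal μ * eigenRows m μ l) := by
      rw [← hA, ← Matrix.mul_assoc, h2, Matrix.one_mul]
    have h4 : A.charpoly = (Matrix.diagonal μ).charpoly := by
      rw [h3, Matrix.charpoly_mul_comm_of_le _ _ (by simp [mul_comm]), Matrix.mul_assoc, h1,
        Matrix.mul_one]
      simp [mul_comm]
    rw [h4, Matrix.charpoly_diagonal]
    have h5 := Polynomial.roots_multiset_prod_X_sub_C (Finset.univ.val.map μ)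
    rwa [Multiset.map_map] at h5

lemma Slodowy.vecMul_apply (hA : A ∈ Slodowy m) (v : Fin m × Fin 2 → ℂ) {j j' : Fin m}
    (hj : j'.val + 1 = j.val) (b : Fin 2) : Matrix.vecMul v A (j, b) = v (j', b) := by
  rw [Matrix.vecMul, dotProduct, Finset.sum_eq_single (j', b)]
  · rw [hA _ _ _ _ (by omega), if_pos ⟨hj, rfl⟩, mul_one]
  · rintro ⟨i, a⟩ - hne
    rw [hA _ _ _ _ (by omega), if_neg, mul_zero]
    rintro ⟨e1, rfl⟩
    exact hne (by rw [Prod.mk.injEq, Fin.ext_iff]; exact ⟨by omega, rfl⟩)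
  · simp

/-- The identity blocks on the superdiagonal make each block of a left eigenvector `z` times the
next one, so the last block determines all. -/
lemma Slodowy.eigenvector_apply (hA : A ∈ Slodowy m) {v : Fin m × Fin 2 → ℂ} {z : ℂ}
    (hv : Matrix.vecMul v A = z • v) {i : Fin m} (hi : i.val + 1 = m) (x : Fin m × Fin 2) :
    v x = z ^ (m - 1 - x.1.val) * v (i, x.2) := by
  obtain ⟨j, b⟩ := x
  obtain ⟨d, hd⟩ : ∃ d, m - 1 - j.val = d := ⟨_, rfl⟩
  induction d generalizing j with
  | zero =>
    have : j = i := Fin.ext (by omega)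
    simp [this, ← hi]
  | succ d ih =>
    have h1 : j.val + 1 < m := by omega
    have h2 := Slodowy.vecMul_apply hA v (j := ⟨j.val + 1, h1⟩) (j' := j) rfl b
    rw [← h2, hv, Pi.smul_apply, smul_eq_mul, ih ⟨j.val + 1, h1⟩ (by simp only; omega), ← mul_assoc,
      ← pow_succ']
    simp only
    congr 2
    omega

lemma SeidelSmith.exists_eigenRows (hμ : Function.Injective μ) (hm : m ≠ 0)
    (hA : A ∈ SeidelSmith m μ) : ∃ l : Fin (2 * m) → Fin 2 → ℂ, (∀ i, l i ≠ 0) ∧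
      Function.Injective (eigenRows m μ l).mulVec ∧
      eigenRows m μ l * A = Matrix.diagonal μ * eigenRows m μ l := by
  have h1 : ∀ k, ∃ v, v ≠ 0 ∧ Matrix.vecMul v A = μ k • v := by
    intro k
    have h2 : μ k ∈ A.charpoly.roots := by
      rw [hA.2]
      exact Multiset.mem_map_of_mem _ (Finset.mem_univ k)
    have h3 := (Polynomial.mem_roots'.1 h2).2
    rw [Polynomial.IsRoot, Matrix.eval_charpoly, ← Matrix.exists_vecMul_eq_zero_iff] at h3
    obtain ⟨v, hv0, hv⟩ := h3
    refine ⟨v, hv0, ?_⟩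
    rw [Matrix.vecMul_sub, sub_eq_zero] at hv
    rw [← hv]
    ext x
    simp [Matrix.vecMul_diagonal, mul_comm]
  choose v hv0 hv using h1
  let i : Fin m := ⟨m - 1, by omega⟩
  have hi : i.val + 1 = m := by change m - 1 + 1 = m; omega
  let l : Fin (2 * m) → Fin 2 → ℂ := fun k b => v k (i, b)
  have hl : ∀ k x, eigenRows m μ l k x = v k x := fun k x =>
    (Slodowy.eigenvector_apply hA.1 (hv k) hi x).symm
  refine ⟨l, fun k h => hv0 k ?_, ?_, ?_⟩
  · ext x
    rw [← hl, eigenRows_apply, h]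
    simp
  · have h4 : LinearIndependent ℂ v := by
      refine Module.End.eigenvectors_linearIndependent' (Matrix.vecMulLinear A) μ hμ v fun k => ?_
      exact ⟨Module.End.mem_eigenspace_iff.2 (hv k), hv0 k⟩
    -- Eigenvectors for distinct eigenvalues are independent, so the rows of the square matrix are.
    -- An inverse of its transpose yields the left inverse needed for injectivity.
    have h5 : Function.Injective (eigenRows m μ l).transpose.mulVec := by
      have h6 : (eigenRows m μ l).row = v := by ext k x; exact hl k x
      rw [← h6, ← Matrix.vecMul_injective_iff] at h4
      intro a b hab
      simp only [Matrix.mulVec_transpose] at hab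
      exact h4 hab
    obtain ⟨Q, hQ, -⟩ := Matrix.exists_inverse_of_mulVec_injective (by simp [mul_comm]) h5
    have h8 : Q.transpose * eigenRows m μ l = 1 := by
      have := congrArg Matrix.transpose hQ
      rwa [Matrix.transpose_mul, Matrix.transpose_transpose, Matrix.transpose_one] at this
    intro a b hab
    have := congrArg Q.transpose.mulVec hab
    simpa [Matrix.mulVec_mulVec, h8] using this
  · ext k x
    rw [Matrix.diagonal_mul, hl]
    have := congrFun (hv k) x
    rw [Pi.smul_apply, smul_eq_mul] at this
    rw [← this, Matrix.mul_apply, Matrix.vecMul, dotProduct]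
    simp only [hl]

lemma eigenRows_ne_zero (h : Function.Injective (eigenRows m μ l).mulVec) (k : Fin (2 * m)) :
    l k ≠ 0 := by
  intro h0
  obtain ⟨Q, h1, -⟩ := exists_inverse_eigenRows h
  have := congrFun (congrFun h1 k) k
  rw [Matrix.mul_apply] at this
  simp [eigenRows_apply, h0] at this

/-- Write a left eigenvector as `v = uP`. Then `u` is a left eigenvector of D, whose entries are
distinct, so only `u k` survives and `v` is a multiple of row `k`, whose last block is `l k`. -/
lemma isWoodwardPoint_iff (hμ : Function.Injective μ) (hm : m ≠ 0)
    (h : Function.Injective (eigenRows m μ l).mulVec)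
    (hA : eigenRows m μ l * A = Matrix.diagonal μ * eigenRows m μ l) (k : Fin (2 * m)) (c : CP1) :
    IsWoodwardPoint A (μ k) c ↔ c = Projectivization.mk ℂ (l k) (eigenRows_ne_zero h k) := by
  obtain ⟨Q, h1, h2⟩ := exists_inverse_eigenRows h
  have hlast : ∀ i : Fin m, i.val + 1 = m → ∀ b, eigenRows m μ l k (i, b) = l k b := by
    intro i hi b
    simp [eigenRows_apply, ← hi]
  constructor
  · rintro ⟨v, hv0, hv, i, hi, hne, rfl⟩
    let u := Matrix.vecMul v Q
    have hu : Matrix.vecMul u (eigenRows m μ l) = v := by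
      rw [Matrix.vecMul_vecMul, h2, Matrix.vecMul_one]
    have h3 : ∀ j, u j * μ j = μ k * u j := by
      have h4 : Matrix.vecMul u (Matrix.diagonal μ) = μ k • u := by
        have h5 : Matrix.diagonal μ = eigenRows m μ l * A * Q := by
          rw [hA, Matrix.mul_assoc, h1, Matrix.mul_one]
        rw [h5, ← Matrix.vecMul_vecMul, ← Matrix.vecMul_vecMul, hu, hv, Matrix.smul_vecMul]
      intro j
      have := congrFun h4 j
      rwa [Matrix.vecMul_diagonal, Pi.smul_apply, smul_eq_mul] at this
    have h6 : ∀ j, j ≠ k → u j = 0 := by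
      intro j hj
      have h7 : u j * (μ j - μ k) = 0 := by rw [mul_sub, h3]; ring
      exact (mul_eq_zero.1 h7).resolve_right (sub_ne_zero.2 fun e => hj (hμ e))
    have h8 : ∀ x, v x = u k * eigenRows m μ l k x := by
      intro x
      rw [← hu, Matrix.vecMul, dotProduct, Finset.sum_eq_single k]
      · intro j _ hj
        rw [h6 j hj, zero_mul]
      · simp
    rw [Projectivization.mk_eq_mk_iff']
    refine ⟨u k, ?_⟩
    ext b
    fin_cases b <;> simp [h8, hlast i hi]
  · rintro rfl
    let i : Fin m := ⟨m - 1, by omega⟩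
    have hi : i.val + 1 = m := by change m - 1 + 1 = m; omega
    have e : ![eigenRows m μ l k (i, 0), eigenRows m μ l k (i, 1)] = l k := by
      ext b; fin_cases b <;> simp [hlast i hi]
    refine ⟨eigenRows m μ l k, ?_, ?_, i, hi, ?_, ?_⟩
    · intro h0
      apply eigenRows_ne_zero h k
      rw [← e, h0]
      ext b; fin_cases b <;> simp
    · ext x
      have := congrFun (congrFun hA k) x
      rwa [Matrix.diagonal_mul] at this
    · rw [e]; exact eigenRows_ne_zero h k
    · congr 1; exact e.symm

/-- P evaluates polynomial vectors of degree < m at the `μ i` and applies the forms `l i`; here for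
the vectors `f • w`. -/
lemma eigenRows_mulVec (f : Polynomial ℂ) (hf : f.natDegree < m) (w : Fin 2 → ℂ)
    (i : Fin (2 * m)) :
    (eigenRows m μ l).mulVec (fun x => f.coeff (m - 1 - x.1.val) * w x.2) i =
      f.eval (μ i) * (l i 0 * w 0 + l i 1 * w 1) := by
  rw [Polynomial.eval_eq_sum_range' hf, ← Fin.sum_univ_eq_sum_range
    (fun d => f.coeff d * μ i ^ d) m, ← Equiv.sum_comp Fin.revPerm]
  simp only [Matrix.mulVec, dotProduct, Fintype.sum_prod_type, Fin.sum_univ_two, eigenRows_apply,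
    Finset.sum_mul, Fin.revPerm_apply, Fin.val_rev]
  refine Finset.sum_congr rfl fun j _ => ?_
  have : m - (j.val + 1) = m - 1 - j.val := by omega
  rw [this]
  ring

/-- If more than m of the lines equal `c`, the product `f` of `X - μ i` over the remaining indices
has degree < m, and `f` times a vector of `c` is a nonzero kernel vector of P. -/
lemma mem_mSpace_of_eigenRows {h : Fin (2 * m) → CP1}
    (hP : Function.Injective (eigenRows m μ fun i => rotLin (h i).rep).mulVec) :
    h ∈ MSpace (2 * m) := by
  classical
  intro c
  by_contra! hc
  let s : Finset (Fin (2 * m)) := Finset.univ.filter fun i => h i = c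
  let t : Finset (Fin (2 * m)) := Finset.univ.filter fun i => h i ≠ c
  have hs : {i | h i = c}.ncard = s.card := by
    rw [← Set.ncard_coe_finset]; congr 1; ext i; simp [s]
  have hst : s.card + t.card = 2 * m := by
    have := Finset.card_filter_add_card_filter_not (s := Finset.univ) fun i => h i = c
    simpa [s, t] using this
  let f : Polynomial ℂ := ∏ i ∈ t, (Polynomial.X - Polynomial.C (μ i))
  have hfm : f.Monic := Polynomial.monic_prod_of_monic _ _ fun i _ => Polynomial.monic_X_sub_C _
  have hfd : f.natDegree = t.card := by
    rw [Polynomial.natDegree_prod_of_monic _ _ fun i _ => Polynomial.monic_X_sub_C (μ i)]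
    simp
  have hlt : f.natDegree < m := by omega
  have h0 : (fun x : Fin m × Fin 2 => f.coeff (m - 1 - x.1.val) * c.rep x.2) = 0 := by
    apply hP
    rw [Matrix.mulVec_zero]
    ext i
    rw [eigenRows_mulVec f hlt, Pi.zero_apply]
    by_cases hi : h i = c
    · rw [hi, rotLin_apply]
      simp
      exact Or.inr (by ring)
    · have : f.eval (μ i) = 0 := by
        rw [Polynomial.eval_prod]
        exact Finset.prod_eq_zero (i := i) (by simp [t, hi]) (by simp)
      rw [this, zero_mul]
  apply c.rep_nonzero
  ext b
  -- This block holds the leading coefficient of `f`, which is 1.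
  have h1 := congrFun h0 (⟨m - 1 - f.natDegree, by omega⟩, b)
  simp only [Pi.zero_apply] at h1
  have h2 : m - 1 - (m - 1 - f.natDegree) = f.natDegree := by omega
  rw [h2, Polynomial.coeff_natDegree, hfm.leadingCoeff, one_mul] at h1
  exact h1

end

/-! ### The cokernel V and the Kamnitzer matrix -/

lemma CP1.anAt_ξ_pow {i : Fin 2} {x : CP1} (hx : x ∈ U i) (k : ℕ) :
    AnAt (fun q => ξ i q ^ k) x := by
  induction k with
  | zero => simpa using anAt_const (1 : ℂ) x
  | succ k ih => simpa only [pow_succ] using ih.mul (anAt_ξ hx)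

-- The pole at infinity has to be controlled: `s` is lifted over `U 0` and its holomorphic part `t`
-- over `U 1`. Injectivity of `β` near infinity shows that the lift of `t` is `ξ 1 ^ k` times that
-- of `s`, so the lift of `s` is again algebraic.
open Classical in
lemma IsMod.mem_range_onSections {G : HolBundle} {ι : Type*} [Finite ι] {J : Set ι}
    {p h : ι → CP1} {β : HolHom G triv} (hβ : IsMod β J p h) (s : triv.sections)
    (hs : ∀ j ∈ J, lineForm (h j) (s.1 (p j)) = 0) : s ∈ LinearMap.range β.onSections := by
  obtain ⟨s, h1, h2, k, t, h3, h4⟩ := s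
  rw [holOn_iff (isOpen_U 0)] at h2
  rw [holOn_iff (isOpen_U 1)] at h3
  have e1 : ∀ x ∈ U 0 ∩ U 1, ξ 0 x ^ k * ξ 1 x ^ k = 1 := fun x hx => by
    rw [← mul_pow, show ξ 0 x * ξ 1 x = 1 from ξ_mul_ξ 0 hx.1 hx.2, one_pow]
  have h5 : ∀ x ∈ U 0 ∩ U 1, t x = ξ 1 x ^ k • s x := fun x hx => by
    rw [h4 x hx, smul_smul, mul_comm, e1 x hx, one_smul]
  obtain ⟨g, hg, hgs⟩ := hβ.exists_lift (isOpen_U 0) (t := s)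
    (fun x hx => holAt_triv.1 (h2 x hx)) fun j hj _ => hs j hj
  obtain ⟨g', hg', hgt⟩ := hβ.exists_lift (isOpen_U 1) (t := t)
    (fun x hx => holAt_triv.1 (h3 x hx)) fun j hj hj1 => by
      by_cases hj0 : p j ∈ U 0
      · rw [h5 _ ⟨hj0, hj1⟩]
        exact (map_smul (lineForm (h j)) _ _).trans (by rw [hs j hj, smul_zero])
      -- This case does not occur: `IsModAt` places the point in `U 0`.
      · have h6 := hs j hj
        have h7 := (hβ.isModAt j hj)
        obtain ⟨N, -, hN, hNU, -⟩ := h7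
        exact absurd (hNU hN) hj0
  refine ⟨⟨fun x => if x ∈ U 0 then g x else 0, fun x hx => if_neg hx, ?_, k,
    fun x => if x ∈ U 0 then ξ 1 x ^ k • g x else g' x, ?_, ?_⟩, ?_⟩
  · rw [holOn_iff (isOpen_U 0)]
    refine fun x hx => (hg x hx).congr ?_
    filter_upwards [U_mem_nhds hx] with q hq
    rw [if_pos hq]
  · rw [holOn_iff (isOpen_U 1)]
    intro x hx1
    by_cases hx : x ∈ U 0
    · refine ((hg x hx).smul (anAt_ξ_pow hx1 k)).congr ?_
      filter_upwards [U_mem_nhds hx] with q hq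
      rw [if_pos hq]
    · refine (hg' x hx1).congr ?_
      filter_upwards [U_mem_nhds hx1, hβ.eventually_injective x] with q hq1 hq
      by_cases hq0 : q ∈ U 0
      · rw [if_pos hq0]
        apply hq (fun e => hx (e ▸ hq0))
        rw [map_smul]
        exact (congrArg (ξ 1 q ^ k • ·) (hgs q hq0)).trans
          ((h5 q ⟨hq0, hq1⟩).symm.trans (hgt q hq1).symm)
      · rw [if_neg hq0]
  · intro x hx
    simp only [if_pos hx.1]
    rw [smul_smul, e1 x hx, one_smul]
  · refine Subtype.ext (funext fun x => ?_)
    change β.map x (if x ∈ U 0 then g x else 0) = s x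
    by_cases hx : x ∈ U 0
    · rw [if_pos hx]
      exact hgs x hx
    · rw [if_neg hx, map_zero, h1 x hx]

namespace HolBundle

lemma mulZ_pow_apply {E : HolBundle} (k : ℕ) (s : E.sections) (x : CP1) :
    ((mulZ E ^ k) s).1 x = ξ 0 x ^ k • s.1 x := by
  induction k with
  | zero => simp
  | succ k ih =>
    rw [pow_succ', Module.End.mul_apply]
    change ξ 0 x • ((mulZ E ^ k) s).1 x = _
    rw [ih, smul_smul, ← pow_succ']

/-- The values of the linear forms of the lines `h i` on a section of `𝒪 ⊕ 𝒪` at the points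
`p i`. -/
def evalForms {ι : Type*} (p h : ι → CP1) : triv.sections →ₗ[ℂ] (ι → ℂ) where
  toFun s i := lineForm (h i) (s.1 (p i))
  map_add' _ _ := funext fun i => map_add (lineForm (h i)) _ _
  map_smul' _ _ := funext fun i => map_smul (lineForm (h i)) _ _

lemma evalForms_apply {ι : Type*} (p h : ι → CP1) (s : triv.sections) (i : ι) :
    evalForms p h s i = lineForm (h i) (s.1 (p i)) := rfl

lemma evalForms_mulZ {ι : Type*} (p h : ι → CP1) (s : triv.sections) (i : ι) :
    evalForms p h (mulZ triv s) i = ξ 0 (p i) * evalForms p h s i :=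
  map_smul (lineForm (h i)) _ _

open Classical in
lemma evalForms_monomial {m : ℕ} {p : Fin (2 * m) → CP1} (hU : ∀ i, p i ∈ U 0)
    (h : Fin (2 * m) → CP1) (x : Fin m × Fin 2) (k : Fin (2 * m)) :
    evalForms p h ((mulZ triv ^ (m - 1 - x.1.val)) (stdSection x.2)) k =
      eigenRows m (fun i => ξ 0 (p i)) (fun i => rotLin (h i).rep) k x := by
  rw [evalForms_apply, mulZ_pow_apply]
  refine (map_smul (lineForm (h k)) _ _).trans ?_
  rw [smul_eq_mul, eigenRows_apply]
  congr 1
  change lineForm (h k) (if p k ∈ U 0 then (Pi.single x.2 1 : Fin 2 → ℂ) else (0 : Fin 2 → ℂ)) = _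
  rw [if_pos (hU k), lineForm_apply]
  obtain ⟨j, b⟩ := x
  fin_cases b <;> simp

end HolBundle

namespace HeckeSeq

lemma ker_evalForms {n : ℕ} {p : Fin n → CP1} (S : HeckeSeq triv p) (hp : Function.Injective p)
    {h : Fin n → CP1} (hS : ∀ i, IsDirection S i (h i)) :
    LinearMap.ker (evalForms p h) = LinearMap.range (S.toBase (Fin.last n)).onSections := by
  have hmod := S.isMod_toBase hp hS (Fin.last n)
  ext s
  rw [LinearMap.mem_ker]
  constructor
  · intro hs
    exact hmod.mem_range_onSections s fun j _ => congrFun hs j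
  · rintro ⟨s, rfl⟩
    ext j
    exact hmod.lineForm_eq_zero (Fin.castSucc_lt_last j) (s.1 (p j))

variable {m : ℕ} {p : Fin (2 * m) → CP1}

/-- Evaluation embeds V in ℂ²ᵐ, turns z into D and the monomials into the columns of P.
Invertibility of P makes the embedding onto and the monomials a basis. -/
lemma isKamnitzerMatrix_iff (S : HeckeSeq triv p) (hp : Function.Injective p)
    (hU : ∀ i, p i ∈ U 0) {h : Fin (2 * m) → CP1} (hS : ∀ i, IsDirection S i (h i))
    (hP : Function.Injective
      (eigenRows m (fun i => ξ 0 (p i)) fun i => rotLin (h i).rep).mulVec)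
    (A : Matrix (Fin m × Fin 2) (Fin m × Fin 2) ℂ) :
    S.IsKamnitzerMatrix A ↔ (eigenRows m (fun i => ξ 0 (p i)) fun i => rotLin (h i).rep) * A =
      Matrix.diagonal (fun i => ξ 0 (p i)) *
        eigenRows m (fun i => ξ 0 (p i)) fun i => rotLin (h i).rep := by
  set P := eigenRows m (fun i => ξ 0 (p i)) fun i => rotLin (h i).rep
  have hker := S.ker_evalForms hp hS
  let e : S.Coker →ₗ[ℂ] (Fin (2 * m) → ℂ) := Submodule.liftQ _ (evalForms p h) hker.ge
  have he : ∀ s, e (Submodule.Quotient.mk s) = evalForms p h s := fun s => rfl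
  have hz : ∀ v i, e (S.zAct v) i = ξ 0 (p i) * e v i := by
    intro v i
    obtain ⟨s, rfl⟩ := Submodule.Quotient.mk_surjective _ v
    exact evalForms_mulZ p h s i
  have hmono : ∀ x : Fin m × Fin 2, e (Submodule.Quotient.mk
      ((mulZ triv ^ (m - 1 - x.1.val)) (stdSection x.2))) = fun k => P k x := fun x =>
    funext fun k => evalForms_monomial hU h x k
  have hforward : ∀ A : Matrix (Fin m × Fin 2) (Fin m × Fin 2) ℂ, S.IsKamnitzerMatrix A →
      P * A = Matrix.diagonal (fun i => ξ 0 (p i)) * P := by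
    rintro A ⟨b, hb, rfl⟩
    ext k x
    have hbx : ∀ x, e (b x) = fun k => P k x := fun x => by rw [← hmono x, ← hb x.1 x.2]
    have h1 := hz (b x) k
    rw [← b.sum_repr (S.zAct (b x)), map_sum, Finset.sum_apply] at h1
    rw [Matrix.diagonal_mul, Matrix.mul_apply]
    rw [hbx] at h1
    rw [← h1]
    refine Finset.sum_congr rfl fun y _ => ?_
    rw [map_smul, hbx, LinearMap.toMatrix_apply, Pi.smul_apply, smul_eq_mul, mul_comm]
  obtain ⟨Q, hPQ, hQP⟩ : ∃ Q : Matrix (Fin m × Fin 2) (Fin (2 * m)) ℂ, P * Q = 1 ∧ Q * P = 1 :=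
    exists_inverse_eigenRows hP
  have hinj : Function.Injective e := by
    rw [← LinearMap.ker_eq_bot, Submodule.ker_liftQ, hker, Submodule.mkQ_map_self]
  have hPe : ∀ w, ∃ v, e v = w := by
    intro w
    refine ⟨∑ x, Q.mulVec w x • Submodule.Quotient.mk
      ((mulZ triv ^ (m - 1 - x.1.val)) (stdSection x.2)), ?_⟩
    have h1 : P.mulVec (Q.mulVec w) = w := by
      rw [Matrix.mulVec_mulVec, hPQ, Matrix.one_mulVec]
    conv_rhs => rw [← h1]
    rw [map_sum]
    ext k
    rw [Finset.sum_apply, Matrix.mulVec, dotProduct]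
    refine Finset.sum_congr rfl fun x _ => ?_
    rw [map_smul, hmono, Pi.smul_apply, smul_eq_mul, mul_comm]
  let ε : S.Coker ≃ₗ[ℂ] (Fin (2 * m) → ℂ) := LinearEquiv.ofBijective e ⟨hinj, hPe⟩
  let τ : (Fin (2 * m) → ℂ) ≃ₗ[ℂ] (Fin m × Fin 2 → ℂ) :=
    Matrix.toLin'OfInv hPQ hQP
  let b : Module.Basis (Fin m × Fin 2) ℂ S.Coker := Module.Basis.ofEquivFun (ε.trans τ)
  have hex : S.IsKamnitzerMatrix (LinearMap.toMatrix b b S.zAct) := by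
    refine ⟨b, fun i j => ?_, rfl⟩
    apply (ε.trans τ).injective
    have h1 : (ε.trans τ) (b (i, j)) = Pi.single (i, j) 1 := by
      rw [Module.Basis.coe_ofEquivFun, LinearEquiv.apply_symm_apply]
    have h2 : ε (Submodule.Quotient.mk ((mulZ triv ^ (m - 1 - i.val)) (stdSection j))) =
        P.mulVec (Pi.single (i, j) 1) := by
      rw [Matrix.mulVec_single_one]
      exact hmono (i, j)
    rw [h1, LinearEquiv.trans_apply, h2]
    change _ = Q.mulVec _
    rw [Matrix.mulVec_mulVec, hQP, Matrix.one_mulVec]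
  refine ⟨hforward A, fun hA => ?_⟩
  have h1 := hforward _ hex
  rw [← hA] at h1
  have h2 := congrArg (Q * ·) h1
  -- Cancelling P identifies the given solution with the matrix of the constructed basis.
  simp only [← Matrix.mul_assoc, hQP, Matrix.one_mul] at h2
  rwa [h2] at hex

end HeckeSeq

/-! ### Entire functions: Liouville's theorem and division by zeros -/

lemma eq_of_tendsto_inv {V : Type*} [NormedAddCommGroup V] [NormedSpace ℂ V] {f : ℂ → V} {c : V}
    (hf : Differentiable ℂ f) (h : Filter.Tendsto (fun w => f w⁻¹) (𝓝[≠] 0) (𝓝 c)) (z : ℂ) :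
    f z = c := by
  refine hf.apply_eq_of_tendsto_cocompact z ?_
  have h1 := h.comp (Filter.tendsto_inv₀_cobounded' (α := ℂ))
  rw [Metric.cobounded_eq_cocompact] at h1
  simpa [Function.comp_def] using h1

lemma eq_zero_of_decay {V : Type*} [NormedAddCommGroup V] [NormedSpace ℂ V] {f F : ℂ → V}
    (hf : Differentiable ℂ f) (hF : ContinuousAt F 0) {K : ℤ} (hK : 0 < K)
    (h : ∀ᶠ w in 𝓝[≠] (0 : ℂ), f w⁻¹ = w ^ K • F w) (z : ℂ) : f z = 0 := by
  refine eq_of_tendsto_inv hf ?_ z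
  lift K to ℕ using hK.le
  have hK0 : K ≠ 0 := by omega
  have h1 : Filter.Tendsto (fun w : ℂ => w ^ K • F w) (𝓝[≠] 0) (𝓝 0) := by
    have h2 : ContinuousAt (fun w : ℂ => w ^ K • F w) 0 := (continuousAt_id.pow K).smul hF
    have h3 := h2.tendsto
    simp only [zero_pow hK0, zero_smul] at h3
    exact h3.mono_left nhdsWithin_le_nhds
  refine h1.congr' ?_
  filter_upwards [h] with w hw
  rw [hw, zpow_natCast]

lemma prod_inv_sub {n : ℕ} (μ : Fin n → ℂ) {w : ℂ} (hw : w ≠ 0) :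
    ∏ i, (w⁻¹ - μ i) = w⁻¹ ^ n * ∏ i, (1 - μ i * w) := by
  have h2 : ∀ i, w⁻¹ - μ i = w⁻¹ * (1 - μ i * w) := fun i => by field_simp
  simp only [h2, Finset.prod_mul_distrib, Finset.prod_const, Finset.card_univ, Fintype.card_fin]

lemma exists_eq_prod_mul {f : ℂ → ℂ} (hf : Differentiable ℂ f) {ι : Type*} [DecidableEq ι]
    {μ : ι → ℂ} (hμ : Function.Injective μ) (s : Finset ι) (hs : ∀ i ∈ s, f (μ i) = 0) :
    ∃ g : ℂ → ℂ, Differentiable ℂ g ∧ ∀ z, f z = (∏ i ∈ s, (z - μ i)) * g z := by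
  induction s using Finset.induction_on with
  | empty => exact ⟨f, hf, fun z => by simp⟩
  | insert a s ha ih =>
    obtain ⟨g, hg, hfg⟩ := ih fun i hi => hs i (Finset.mem_insert_of_mem hi)
    have h0 : g (μ a) = 0 := by
      have h1 := hs a (Finset.mem_insert_self a s)
      rw [hfg] at h1
      refine (mul_eq_zero.1 h1).resolve_left (Finset.prod_ne_zero_iff.2 fun i hi => ?_)
      exact sub_ne_zero.2 fun e => ha (hμ e ▸ hi)
    refine ⟨dslope g (μ a), ?_, fun z => ?_⟩
    · rw [← differentiableOn_univ, Complex.differentiableOn_dslope Filter.univ_mem,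
        differentiableOn_univ]
      exact hg
    · have h1 := sub_smul_dslope g (μ a) z
      rw [h0, sub_zero, smul_eq_mul] at h1
      rw [hfg, ← h1, Finset.prod_insert ha]
      ring

lemma CP1.pt_zero_inv {w : ℂ} (hw : w ≠ 0) : pt 0 w⁻¹ = pt 1 w := by
  rw [pt, pt, Projectivization.mk_eq_mk_iff']
  refine ⟨w⁻¹, ?_⟩
  ext k; fin_cases k <;> simp [vec, hw]

lemma CP1.pt_one_mem_U_zero {w : ℂ} (hw : w ≠ 0) : pt 1 w ∈ U 0 := by
  rw [← pt_zero_inv hw]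
  exact pt_mem 0 _

/-! ### Bundles from gluing data, and 𝒪(a) ⊕ 𝒪(a) -/

namespace HolBundle

/-- The bundle given by holomorphic gluing data. -/
abbrev ofCore {ι : Type} (Z : VectorBundleCore ℂ CP1 (Fin 2 → ℂ) ι) [Z.IsContMDiff 𝓘(ℂ) ω] :
    HolBundle where
  Fib := Z.Fiber

/-- The trivializations of a bundle given by gluing data. -/
def coreTriv {ι : Type} (Z : VectorBundleCore ℂ CP1 (Fin 2 → ℂ) ι) [Z.IsContMDiff 𝓘(ℂ) ω]
    (i : ι) : HolTriv (ofCore Z) (Z.baseSet i) :=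
  haveI : MemTrivializationAtlas (Z.localTriv i) := ⟨i, rfl⟩
  HolTriv.ofTrivialization (E := ofCore Z) (Z.localTriv i)

lemma coreTriv_map_eq {ι : Type} (Z : VectorBundleCore ℂ CP1 (Fin 2 → ℂ) ι)
    [Z.IsContMDiff 𝓘(ℂ) ω] (i j : ι) {x : CP1} (hi : x ∈ Z.baseSet i) (hj : x ∈ Z.baseSet j)
    (v : (ofCore Z).Fib x) :
    (coreTriv Z j).map x v = Z.coordChange i j x ((coreTriv Z i).map x v) := by
  have hmem : ∀ i, MemTrivializationAtlas (Z.localTriv i) := fun i => ⟨i, rfl⟩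
  have h1 : ∀ i, x ∈ Z.baseSet i →
      (coreTriv Z i).map x v = Z.coordChange (Z.indexAt x) i x v := fun i hi =>
    HolTriv.ofTrivialization_map (E := ofCore Z) (Z.localTriv i) hi v
  exact (h1 j hj).trans ((Z.coordChange_comp _ _ _ _ ⟨⟨Z.mem_baseSet_at x, hi⟩, hj⟩ _).symm.trans
    (congrArg (Z.coordChange i j x) (h1 i hi).symm))

/-- The trivialization of `𝒪(a) ⊕ 𝒪(b)` over `U i`. -/
def sumTriv (a b : ℤ) (i : Fin 2) : HolTriv (sumO a b) (U i) := coreTriv (core ![a, b]) i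

lemma sumTriv_map (a : ℤ) {x : CP1} (h0 : x ∈ U 0) (h1 : x ∈ U 1) (v : (sumO a a).Fib x) :
    (sumTriv a a 1).map x v = ξ 1 x ^ a • (sumTriv a a 0).map x v := by
  refine (coreTriv_map_eq (core ![a, a]) 0 1 h0 h1 v).trans ?_
  ext k
  change diagCLM (fun k => ξ 1 x ^ (![a, a] : Fin 2 → ℤ) k) ((sumTriv a a 0).map x v) k = _
  rw [diagCLM_apply]
  fin_cases k <;> rfl

lemma sumTriv_frame (a : ℤ) {x : CP1} (h0 : x ∈ U 0) (h1 : x ∈ U 1) (v : Fin 2 → ℂ) :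
    (sumTriv a a 0).frame v x = ξ 1 x ^ a • (sumTriv a a 1).frame v x := by
  apply ((sumTriv a a 1).map x).injective
  rw [sumTriv_map a h0 h1, map_smul, HolTriv.frame, HolTriv.frame, LinearEquiv.apply_symm_apply,
    LinearEquiv.apply_symm_apply]

lemma anAt_matrix_frame {F : HolBundle} {N : Set CP1} {x : CP1} (β : HolHom F triv)
    (ψ : HolTriv F N) (hN : N ∈ 𝓝 x) (v : Fin 2 → ℂ) :
    AnAt (fun q => (β.map q (ψ.frame v q) : Fin 2 → ℂ)) x :=
  holAt_triv.1 (β.holAt (ψ.holAt_frame hN v))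

end HolBundle

/-! ### A balanced last bundle forces P to be invertible -/

section

variable {m : ℕ} {p h : Fin (2 * m) → CP1} {a : ℤ} {β : HolHom (sumO a a) triv}

/-- Over `U 0` the determinant of `β` vanishes at the 2m points, so it is ∏ (z - μᵢ) times an entire
`g`. The gluing factor gives `g(1/w) = w ^ (2a + 2m)` times a function holomorphic at `w = 0`. If `a
> -m`, then `g = 0`, contradicting bijectivity of `β` at a general point. -/
lemma IsMod.degree_le (hβ : IsMod β univ p h) (hp : Function.Injective p) (hU : ∀ i, p i ∈ U 0) :
    a ≤ -m := by
  by_contra! ha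
  let M : Fin 2 → ℂ → Matrix (Fin 2) (Fin 2) ℂ := fun i =>
    colMat i (fun q => β.map q ((sumTriv a a i).frame (Pi.single 0 1) q))
      (fun q => β.map q ((sumTriv a a i).frame (Pi.single 1 1) q))
  have hM : ∀ i z, MatAn (M i) z := fun i z => by
    have := matAn_colMat (pt_mem i z)
      (anAt_matrix_frame β (sumTriv a a i) (U_mem_nhds (pt_mem i z)) (Pi.single 0 1))
      (anAt_matrix_frame β (sumTriv a a i) (U_mem_nhds (pt_mem i z)) (Pi.single 1 1))
    rwa [ξ_pt] at this
  have key : ∀ q ∈ U 0, ∀ w : (sumO a a).Fib q,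
      (M 0 (ξ 0 q)).mulVec ((sumTriv a a 0).map q w) = β.map q w := by
    intro q hq w
    rw [colMat_mulVec 0 _ _ hq]
    conv_rhs => rw [(sumTriv a a 0).eq_frame q w]
    simp
  have hdet : Differentiable ℂ fun z => (M 0 z).det := fun z => (hM 0 z).det.differentiableAt
  have hzero : ∀ i, (M 0 (ξ 0 (p i))).det = 0 := by
    intro i
    by_contra hd
    obtain ⟨v, hv⟩ : ∃ v : Fin 2 → ℂ, lineForm (h i) v ≠ 0 := by
      by_contra! hall
      have h1 := hall (rotLin (h i).rep)
      refine (h i).rep_nonzero (rotLin_injective ?_)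
      have h2 : ∀ k, rotLin (h i).rep k = lineForm (h i) (Pi.single k 1) := fun k => by
        fin_cases k <;> simp [lineForm_apply]
      ext k
      rw [h2, hall, map_zero]
      rfl
    apply hv
    rw [(hβ.isModAt i (mem_univ i)).lineForm_eq_zero_iff]
    refine ⟨((sumTriv a a 0).map (p i)).symm ((M 0 (ξ 0 (p i)))⁻¹.mulVec v), ?_⟩
    rw [← key _ (hU i), LinearEquiv.apply_symm_apply, Matrix.mulVec_mulVec,
      Matrix.mul_nonsing_inv _ (Ne.isUnit hd), Matrix.one_mulVec]
  obtain ⟨g, hg, hgM⟩ := exists_eq_prod_mul hdet (μ := fun i => ξ 0 (p i))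
    (fun i j hij => hp (by
      rw [← pt_ξ 0 _ (hU i), ← pt_ξ 0 _ (hU j)]; exact congrArg (pt 0) hij))
    Finset.univ fun i _ => hzero i
  have hrel : ∀ w : ℂ, w ≠ 0 → (M 0 w⁻¹).det = w ^ (2 * a) * (M 1 w).det := by
    intro w hw
    have h1 : ∀ v, (sumTriv a a 0).frame v (pt 1 w) =
        w ^ a • (sumTriv a a 1).frame v (pt 1 w) := fun v => by
      have := sumTriv_frame a (pt_one_mem_U_zero hw) (pt_mem 1 w) v
      rwa [ξ_pt] at this
    have h3 : ∀ v, β.map (pt 0 w⁻¹) ((sumTriv a a 0).frame v (pt 0 w⁻¹)) =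
        w ^ a • β.map (pt 1 w) ((sumTriv a a 1).frame v (pt 1 w)) := fun v => by
      rw [pt_zero_inv hw, h1, map_smul]
    have h2 : M 0 w⁻¹ = w ^ a • M 1 w := by
      ext i j
      fin_cases i <;> fin_cases j <;> exact congrFun (h3 _) _
    rw [h2, Matrix.det_smul, Fintype.card_fin, mul_comm 2 a, zpow_mul]
    rfl
  have hg0 : ∀ z, g z = 0 := by
    refine eq_zero_of_decay (K := 2 * a + 2 * m)
      (F := fun w => (M 1 w).det * (∏ i, (1 - ξ 0 (p i) * w))⁻¹) hg ?_ (by omega) ?_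
    · refine (hM 1 0).det.continuousAt.mul (ContinuousAt.inv₀ ?_ (by simp))
      fun_prop
    · have hne : ∀ᶠ w in 𝓝 (0 : ℂ), ∏ i, (1 - ξ 0 (p i) * w) ≠ 0 := by
        refine ContinuousAt.eventually_ne ?_ (by simp)
        fun_prop
      filter_upwards [nhdsWithin_le_nhds hne, self_mem_nhdsWithin] with w hw1 hw
      have hw0 : w ≠ 0 := hw
      have h1 := prod_inv_sub (fun i => ξ 0 (p i)) hw0
      have h3 := hgM w⁻¹
      rw [hrel w hw0, h1] at h3
      have h4 : w ^ (2 * a + 2 * (m : ℤ)) = w ^ (2 * a) * w ^ (2 * m) := by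
        rw [zpow_add₀ hw0]
        norm_cast
      have h5 : w ^ (2 * m) * w⁻¹ ^ (2 * m) = 1 := by rw [← mul_pow, mul_inv_cancel₀ hw0, one_pow]
      rw [smul_eq_mul, h4, ← mul_assoc, ← div_eq_mul_inv, eq_div_iff hw1]
      linear_combination -(w ^ (2 * m)) * h3 - (∏ i, (1 - ξ 0 (p i) * w)) * g w⁻¹ * h5
  obtain ⟨q, hq, hqU⟩ : ∃ q, Function.Bijective (β.map q) ∧ q ∈ U 0 := by
    have h1 : ∀ᶠ q in 𝓝[≠] (pt 0 0), Function.Bijective (β.map q) ∧ q ∈ U 0 := by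
      filter_upwards [nhdsWithin_le_nhds (eventually_notMem_of_finite (toFinite (p '' univ))
        (pt 0 0)), nhdsWithin_le_nhds (U_mem_nhds (pt_mem 0 0)), self_mem_nhdsWithin]
        with q h2 h3 h4
      exact ⟨hβ.bijective_of_notMem (h2 h4), h3⟩
    exact h1.exists
  refine HolTriv.det_ne_zero_of_bijective (A := M 0 (ξ 0 q)) ?_ (by rw [hgM, hg0, mul_zero])
  intro u v huv
  obtain ⟨u, rfl⟩ := ((sumTriv a a 0).map q).surjective u
  obtain ⟨v, rfl⟩ := ((sumTriv a a 0).map q).surjective v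
  rw [key q hqU, key q hqU] at huv
  rw [hq.1 huv]

/-- A kernel vector is a polynomial vector of degree < m whose value at each `p i` lies in `h i`,
hence it lifts to a section of 𝒪(a) ⊕ 𝒪(a). As `a ≤ -m`, the coordinates of the lift vanish at
infinity, so the lift is zero. -/
lemma IsMod.eigenRows_injective (hβ : IsMod β univ p h) (hp : Function.Injective p)
    (hU : ∀ i, p i ∈ U 0) :
    Function.Injective (eigenRows m (fun i => ξ 0 (p i)) fun i => rotLin (h i).rep).mulVec := by
  have ha := hβ.degree_le hp hU
  rcases Nat.eq_zero_or_pos m with rfl | hm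
  · exact fun u v _ => funext fun x => x.1.elim0
  rw [← Matrix.coe_mulVecLin, injective_iff_map_eq_zero]
  intro c hc
  rw [Matrix.mulVecLin_apply] at hc
  let f : Fin 2 → Polynomial ℂ := fun b =>
    ∑ j : Fin m, Polynomial.monomial (m - 1 - j.val) (c (j, b))
  let s : CP1 → Fin 2 → ℂ := fun q b => (f b).eval (ξ 0 q)
  let t : CP1 → Fin 2 → ℂ := fun q b => ∑ j : Fin m, c (j, b) * ξ 1 q ^ j.val
  have hs : ∀ x ∈ U 0, AnAt s x := by
    intro x hx
    rw [anAt_pi]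
    intro b
    rw [anAt_iff hx]
    simp only [s, ξ_pt]
    exact (f b).differentiable.analyticAt _
  have ht : AnAt t (pt 1 0) := by
    rw [anAt_pi]
    intro b
    rw [anAt_iff (pt_mem 1 0)]
    simp only [t, ξ_pt]
    exact Differentiable.analyticAt (f := fun z => ∑ j : Fin m, c (j, b) * z ^ j.val)
      (by fun_prop) _
  have hst : ∀ q ∈ U 0 ∩ U 1, t q = ξ 1 q ^ (m - 1) • s q := by
    intro q hq
    have hz : ξ 0 q * ξ 1 q = 1 := ξ_mul_ξ 0 hq.1 hq.2
    ext b
    simp only [t, s, f, Pi.smul_apply, smul_eq_mul, Polynomial.eval_finsetSum,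
      Polynomial.eval_monomial, Finset.mul_sum]
    refine Finset.sum_congr rfl fun j _ => ?_
    have hj : m - 1 = (m - 1 - j.val) + j.val := by omega
    have h1 : ξ 1 q ^ (m - 1) = ξ 1 q ^ (m - 1 - j.val) * ξ 1 q ^ j.val := by
      rw [← pow_add, ← hj]
    have h2 : ξ 0 q ^ (m - 1 - j.val) * ξ 1 q ^ (m - 1 - j.val) = 1 := by
      rw [← mul_pow, hz, one_pow]
    rw [h1]
    linear_combination -(c (j, b) * ξ 1 q ^ j.val) * h2
  obtain ⟨g, hg, hgs⟩ := hβ.exists_lift (isOpen_U 0) hs fun k _ _ => by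
    have h1 := congrFun hc k
    rw [Pi.zero_apply, Matrix.mulVec, dotProduct, Fintype.sum_prod_type] at h1
    rw [← h1, lineForm_apply]
    simp only [Fin.sum_univ_two, Finset.sum_add_distrib, s, f, Polynomial.eval_finsetSum,
      Polynomial.eval_monomial, eigenRows_apply, Finset.mul_sum]
    congr 1 <;> exact Finset.sum_congr rfl fun j _ => by ring
  have hinf : pt 1 0 ∉ U 0 := by
    simp [pt, mk_mem_U, vec]
  obtain ⟨g', hg', hgt⟩ := exists_lift_of_injective (α := β)
    (hβ.bijective (pt 1 0) fun j _ e => hinf (e ▸ hU j)).1 ht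
  have hzero : ∀ z, (sumTriv a a 0).map (pt 0 z) (g (pt 0 z)) = 0 := by
    have hd : Differentiable ℂ fun z => (sumTriv a a 0).map (pt 0 z) (g (pt 0 z)) := by
      intro z
      have h1 := (anAt_iff (pt_mem 0 z)).1
        ((sumTriv a a 0).anAt (U_mem_nhds (pt_mem 0 z)) (hg _ (pt_mem 0 z)))
      rw [ξ_pt] at h1
      exact h1.differentiableAt
    have hF := (anAt_iff (pt_mem 1 0)).1
      ((sumTriv a a 1).anAt (U_mem_nhds (pt_mem 1 0)) hg')
    rw [ξ_pt] at hF
    -- The pole order costs `w ^ (m - 1)` and the gluing `w ^ a`; the exponent is at least 1 because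
    -- `a ≤ -m`.
    refine eq_zero_of_decay (K := -(a + (m - 1 : ℕ))) hd hF.continuousAt (by omega) ?_
    have e1 := (eventually_nhds_iff (pt_mem 1 0)).1 (hβ.eventually_injective (pt 1 0))
    have e2 := (eventually_nhds_iff (pt_mem 1 0)).1 hgt
    rw [ξ_pt] at e1 e2
    filter_upwards [nhdsWithin_le_nhds e1, nhdsWithin_le_nhds e2, self_mem_nhdsWithin]
      with w h1 h2 hw
    have hw0 : w ≠ 0 := hw
    have hU0 := pt_one_mem_U_zero hw0
    have h3 : g' (pt 1 w) = w ^ (m - 1) • g (pt 1 w) := by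
      apply h1 fun e => hinf (e ▸ hU0)
      rw [map_smul]
      refine h2.trans ((hst _ ⟨hU0, pt_mem 1 w⟩).trans ?_)
      rw [ξ_pt, ← hgs _ hU0]
    have h4 := sumTriv_map a hU0 (pt_mem 1 w) (g (pt 1 w))
    rw [ξ_pt] at h4
    have h5 : w ^ (-(a + ((m - 1 : ℕ) : ℤ))) * (w ^ (m - 1) * w ^ a) = 1 := by
      rw [← zpow_natCast, ← zpow_add₀ hw0, ← zpow_add₀ hw0]
      convert zpow_zero w using 2
      ring
    rw [pt_zero_inv hw0, h3, map_smul, h4, smul_smul, smul_smul, mul_assoc, h5,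
      one_smul]
  have hf : ∀ b, f b = 0 := by
    intro b
    refine Polynomial.funext fun z => ?_
    have h1 : g (pt 0 z) = 0 := ((sumTriv a a 0).map _).map_eq_zero_iff.1 (hzero z)
    have h2 := hgs _ (pt_mem 0 z)
    rw [h1, map_zero] at h2
    have h3 := congrFun h2 b
    simp only [s, ξ_pt] at h3
    rw [← h3, Polynomial.eval_zero]
    rfl
  ext ⟨j, b⟩
  have h1 := congrArg (fun P => P.coeff (m - 1 - j.val)) (hf b)
  simp only [f, Polynomial.finsetSum_coeff, Polynomial.coeff_monomial,
    Polynomial.coeff_zero] at h1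
  rw [Finset.sum_eq_single j] at h1
  · simpa using h1
  · intro i _ hij
    rw [if_neg]
    intro e
    exact hij (Fin.ext (by omega))
  · simp

end

lemma IsMod.comp_iso {F G : HolBundle} {ι : Type*} {J : Set ι} {p h : ι → CP1}
    {β : HolHom G triv} (hβ : IsMod β J p h) (φ : HolIso F G) : IsMod (β.comp φ.hom) J p h :=
  ⟨fun q hq => (hβ.bijective q hq).comp (φ.bijective q), fun j hj =>
    (hβ.isModAt j hj).comp_of_bijective _ (Filter.Eventually.of_forall φ.bijective)⟩

lemma IsMod.eigenRows_injective_of_hasHeckeLength {m : ℕ} {p h : Fin (2 * m) → CP1}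
    {G : HolBundle} {β : HolHom G triv} (hβ : IsMod β univ p h) (hp : Function.Injective p)
    (hU : ∀ i, p i ∈ U 0) (hG : HasHeckeLength G 0) :
    Function.Injective (eigenRows m (fun i => ξ 0 (p i)) fun i => rotLin (h i).rep).mulVec := by
  obtain ⟨a, b, ⟨φ⟩, hab⟩ := hG
  obtain rfl : a = b := by omega
  exact (hβ.comp_iso φ.symm).eigenRows_injective hp hU

/-! ### Gluing morphisms and bundles -/

namespace HolBundle

instance : MemTrivializationAtlas (F := Fin 2 → ℂ) (E := triv.Fib)
    (Bundle.Trivial.trivialization CP1 (Fin 2 → ℂ)) := ⟨rfl⟩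

/-- The identity trivialization of `𝒪 ⊕ 𝒪`. -/
def trivTriv (N : Set CP1) : HolTriv triv N :=
  (HolTriv.ofTrivialization (E := triv) (Bundle.Trivial.trivialization CP1 (Fin 2 → ℂ))).mono
    (subset_univ N)

lemma trivTriv_map (N : Set CP1) (x : CP1) (v : triv.Fib x) : (trivTriv N).map x v = v :=
  HolTriv.ofTrivialization_map (E := triv) (Bundle.Trivial.trivialization CP1 (Fin 2 → ℂ))
    (mem_univ x) v

end HolBundle

lemma CP1.AnAt.linear_apply {A : CP1 → (Fin 2 → ℂ) →ₗ[ℂ] (Fin 2 → ℂ)} {f : CP1 → Fin 2 → ℂ}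
    {x : CP1} (hA : ∀ v, AnAt (fun q => A q v) x) (hf : AnAt f x) :
    AnAt (fun q => A q (f q)) x := by
  rw [anAt_pi] at hf
  refine (((hf 0).smul (hA (Pi.single 0 1))).add ((hf 1).smul (hA (Pi.single 1 1)))).congr ?_
  refine Filter.Eventually.of_forall fun q => ?_
  rw [← map_smul, ← map_smul, ← map_add]
  congr 1
  ext k; fin_cases k <;> simp

open Classical in
lemma HolHom.exists_glue {F E : HolBundle} {N : Fin 2 → Set CP1} (hN : ∀ i, IsOpen (N i))
    (hcov : ∀ x ∉ N 0, x ∈ N 1) (ψ : ∀ i, HolTriv F (N i)) (φ : ∀ i, HolTriv E (N i))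
    (A : Fin 2 → CP1 → (Fin 2 → ℂ) →ₗ[ℂ] (Fin 2 → ℂ))
    (hA : ∀ i, ∀ x ∈ N i, ∀ v, AnAt (fun q => A i q v) x)
    (hcomp : ∀ x ∈ N 0, x ∈ N 1 → ∀ v, ((φ 0).map x).symm (A 0 x ((ψ 0).map x v)) =
      ((φ 1).map x).symm (A 1 x ((ψ 1).map x v))) :
    ∃ γ : HolHom F E, ∀ i, ∀ x ∈ N i, ∀ v,
      (φ i).map x (γ.map x v) = A i x ((ψ i).map x v) := by
  let γ : ∀ x, F.Fib x →ₗ[ℂ] E.Fib x := fun x =>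
    if x ∈ N 0 then ((φ 0).map x).symm.toLinearMap ∘ₗ A 0 x ∘ₗ ((ψ 0).map x).toLinearMap
    else ((φ 1).map x).symm.toLinearMap ∘ₗ A 1 x ∘ₗ ((ψ 1).map x).toLinearMap
  have h0 : ∀ x ∈ N 0, ∀ v, (φ 0).map x (γ x v) = A 0 x ((ψ 0).map x v) := by
    intro x hx v
    simp [γ, hx]
  have h1 : ∀ x ∈ N 1, ∀ v, (φ 1).map x (γ x v) = A 1 x ((ψ 1).map x v) := by
    intro x hx v
    by_cases hx0 : x ∈ N 0
    · rw [← LinearEquiv.eq_symm_apply, ← hcomp x hx0 hx, LinearEquiv.eq_symm_apply, h0 x hx0]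
    · simp [γ, hx0]
  have hγ : ∀ i, ∀ x ∈ N i, ∀ v, (φ i).map x (γ x v) = A i x ((ψ i).map x v) := by
    intro i
    fin_cases i
    exacts [h0, h1]
  refine ⟨HolHom.ofSections γ fun x s hs => ?_, hγ⟩
  obtain ⟨i, hi⟩ : ∃ i, x ∈ N i := by
    by_cases hx0 : x ∈ N 0
    exacts [⟨0, hx0⟩, ⟨1, hcov x hx0⟩]
  have hNx := (hN i).mem_nhds hi
  rw [(φ i).holAt_iff hNx]
  refine (AnAt.linear_apply (hA i x hi) ((ψ i).anAt hNx hs)).congr ?_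
  filter_upwards [hNx] with q hq
  exact hγ i q hq _

/-- The linear map of a matrix, as a continuous linear map. -/
def matCLM (M : Matrix (Fin 2) (Fin 2) ℂ) : (Fin 2 → ℂ) →L[ℂ] (Fin 2 → ℂ) :=
  LinearMap.toContinuousLinearMap (Matrix.toLin' M)

lemma anAt_matCLM {M : ℂ → Matrix (Fin 2) (Fin 2) ℂ} {x : CP1} (hx : x ∈ U 0)
    (hM : MatAn M (ξ 0 x)) : AnAt (fun q => matCLM (M (ξ 0 q))) x := by
  rw [anAt_iff hx]
  simp only [ξ_pt]
  have h1 : AnalyticAt ℂ (fun z i j => M z i j) (ξ 0 x) :=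
    analyticAt_pi_iff.2 fun i => analyticAt_pi_iff.2 fun j => hM i j
  let L : (Fin 2 → Fin 2 → ℂ) →ₗ[ℂ] ((Fin 2 → ℂ) →L[ℂ] (Fin 2 → ℂ)) :=
    LinearMap.toContinuousLinearMap.toLinearMap ∘ₗ Matrix.toLin'.toLinearMap
  exact (L.toContinuousLinearMap.analyticAt _).comp h1

lemma anAt_mulVec {M : ℂ → Matrix (Fin 2) (Fin 2) ℂ} {i : Fin 2} {x : CP1} (hx : x ∈ U i)
    (hM : MatAn M (ξ i x)) (v : Fin 2 → ℂ) : AnAt (fun q => (M (ξ i q)).mulVec v) x := by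
  rw [anAt_iff hx]
  simp only [ξ_pt]
  exact hM.mulVec analyticAt_const

/-- Gluing data over the cover of the projective line by `U 0` and an open set `V`. -/
structure Clutch (V : Set CP1) where
  mat : ℂ → Matrix (Fin 2) (Fin 2) ℂ
  isOpen : IsOpen V
  cover : ∀ x ∉ U 0, x ∈ V
  matAn : ∀ z, MatAn mat z
  det_ne_zero : ∀ x ∈ U 0 ∩ V, (mat (ξ 0 x)).det ≠ 0

namespace Clutch

variable {V : Set CP1} (c : Clutch V)

open Classical in
/-- The gluing data as a vector bundle core. -/
def core : VectorBundleCore ℂ CP1 (Fin 2 → ℂ) (Fin 2) where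
  baseSet i := if i = 0 then U 0 else V
  isOpen_baseSet i := by
    by_cases h : i = 0
    · rw [if_pos h]; exact isOpen_U 0
    · rw [if_neg h]; exact c.isOpen
  indexAt x := if x ∈ U 0 then 0 else 1
  mem_baseSet_at x := by
    by_cases h : x ∈ U 0
    · simp [h]
    · simpa [h] using c.cover x h
  coordChange i j x :=
    if i = j then ContinuousLinearMap.id ℂ _
    else if i = 0 then matCLM (c.mat (ξ 0 x)) else matCLM (c.mat (ξ 0 x))⁻¹
  coordChange_self i x _ v := by simp
  continuousOn_coordChange i j := by
    fin_cases i <;> fin_cases j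
    · simp [continuousOn_const]
    · intro x hx
      exact (anAt_matCLM hx.1 (c.matAn _)).continuousAt.continuousWithinAt
    · intro x hx
      have h := anAt_matCLM hx.2 ((c.matAn _).inv (c.det_ne_zero x ⟨hx.2, hx.1⟩))
      simpa using h.continuousAt.continuousWithinAt
    · simp [continuousOn_const]
  coordChange_comp i j k x hx v := by
    have key : x ∈ U 0 → x ∈ V → IsUnit (c.mat (ξ 0 x)).det := fun h0 h1 =>
      (c.det_ne_zero x ⟨h0, h1⟩).isUnit
    fin_cases i <;> fin_cases j <;> fin_cases k <;> try rfl
    · change (c.mat (ξ 0 x))⁻¹.mulVec ((c.mat (ξ 0 x)).mulVec v) = v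
      rw [Matrix.mulVec_mulVec, Matrix.nonsing_inv_mul _ (key hx.1.1 hx.1.2), Matrix.one_mulVec]
    · change (c.mat (ξ 0 x)).mulVec ((c.mat (ξ 0 x))⁻¹.mulVec v) = v
      rw [Matrix.mulVec_mulVec, Matrix.mul_nonsing_inv _ (key hx.1.2 hx.1.1), Matrix.one_mulVec]

instance : c.core.IsContMDiff 𝓘(ℂ) ω where
  contMDiffOn_coordChange i j := by
    fin_cases i <;> fin_cases j
    · simpa [core] using contMDiffOn_const
    · intro x hx
      exact ContMDiffAt.contMDiffWithinAt (anAt_matCLM hx.1 (c.matAn _))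
    · intro x hx
      have h := anAt_matCLM hx.2 ((c.matAn _).inv (c.det_ne_zero x ⟨hx.2, hx.1⟩))
      simpa [core] using ContMDiffAt.contMDiffWithinAt h
    · simpa [core] using contMDiffOn_const

/-- The bundle with the given gluing data. -/
abbrev bundle : HolBundle := ofCore c.core

/-- The cover of the projective line by `U 0` and `V`. -/
def cov (V : Set CP1) : Fin 2 → Set CP1 := ![U 0, V]

/-- The trivializations of the bundle over `U 0` and `V`. -/
def trivs (i : Fin 2) : HolTriv c.bundle (cov V i) :=
  (coreTriv c.core i).mono (by fin_cases i <;> exact subset_rfl)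

lemma trivs_one {x : CP1} (h0 : x ∈ U 0) (h1 : x ∈ V) (v : c.bundle.Fib x) :
    (c.trivs 1).map x v = (c.mat (ξ 0 x)).mulVec ((c.trivs 0).map x v) :=
  coreTriv_map_eq c.core 0 1 h0 h1 v

lemma isOpen_cov (hV : IsOpen V) (i : Fin 2) : IsOpen (cov V i) := by
  fin_cases i
  exacts [isOpen_U 0, hV]

/-- The morphism is `M` over `U 0` and the identity over `V`; the relation between the gluing
matrices is the compatibility on the overlap. -/
lemma exists_hom (d : Clutch V) (M : ℂ → Matrix (Fin 2) (Fin 2) ℂ) (hM : ∀ z, MatAn M z)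
    (h : ∀ z, d.mat z * M z = c.mat z) :
    ∃ γ : HolHom c.bundle d.bundle,
      (∀ x ∈ U 0, ∀ v, (d.trivs 0).map x (γ.map x v) =
        (M (ξ 0 x)).mulVec ((c.trivs 0).map x v)) ∧
      ∀ x ∈ V, ∀ v, (d.trivs 1).map x (γ.map x v) = (c.trivs 1).map x v := by
  obtain ⟨γ, hγ⟩ := HolHom.exists_glue (N := cov V) (isOpen_cov c.isOpen) c.cover c.trivs d.trivs
    ![fun x => Matrix.toLin' (M (ξ 0 x)), fun _ => LinearMap.id]
    (fun i => by
      fin_cases i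
      · exact fun x hx v => anAt_mulVec hx (hM _) v
      · exact fun x _ v => anAt_const v x)
    fun x h0 h1 v => by
      apply ((d.trivs 1).map x).injective
      rw [LinearEquiv.apply_symm_apply, d.trivs_one h0 h1, LinearEquiv.apply_symm_apply]
      change (d.mat (ξ 0 x)).mulVec ((M (ξ 0 x)).mulVec _) = (c.trivs 1).map x v
      rw [Matrix.mulVec_mulVec, h, c.trivs_one h0 h1]
  exact ⟨γ, hγ 0, hγ 1⟩

lemma exists_iso_triv (h : ∀ z, c.mat z = 1) : ∃ φ : HolIso c.bundle triv,
    ∀ x ∈ U 0, ∀ v, (φ.hom.map x v : Fin 2 → ℂ) = (c.trivs 0).map x v := by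
  have hid : ∀ x v, x ∈ U 0 → x ∈ V → (c.trivs 1).map x v = (c.trivs 0).map x v := by
    intro x v h0 h1
    rw [c.trivs_one h0 h1, h, Matrix.one_mulVec]
  obtain ⟨γ, hγ⟩ := HolHom.exists_glue (N := cov V) (isOpen_cov c.isOpen) c.cover c.trivs
    (fun i => trivTriv (cov V i)) (fun _ _ => LinearMap.id) (fun _ x _ v => anAt_const v x)
    fun x h0 h1 v => by
      apply ((trivTriv (cov V 1)).map x).injective
      rw [LinearEquiv.apply_symm_apply, trivTriv_map,
        ← trivTriv_map (cov V 0) x (((trivTriv (cov V 0)).map x).symm _),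
        LinearEquiv.apply_symm_apply]
      exact (hid x v h0 h1).symm
  obtain ⟨δ, hδ⟩ := HolHom.exists_glue (N := cov V) (isOpen_cov c.isOpen) c.cover
    (fun i => trivTriv (cov V i)) c.trivs (fun _ _ => LinearMap.id)
    (fun _ x _ v => anAt_const v x)
    fun x h0 h1 v => by
      apply ((c.trivs 1).map x).injective
      rw [LinearEquiv.apply_symm_apply, hid x _ h0 h1, LinearEquiv.apply_symm_apply]
      exact (trivTriv_map (cov V 0) x v).trans (trivTriv_map (cov V 1) x v).symm
  have hcov : ∀ x, ∃ i, x ∈ cov V i := fun x => by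
    by_cases hx : x ∈ U 0
    exacts [⟨0, hx⟩, ⟨1, c.cover x hx⟩]
  refine ⟨⟨γ, δ, fun x v => ?_, fun x v => ?_⟩, fun x hx v => ?_⟩
  · obtain ⟨i, hi⟩ := hcov x
    apply ((trivTriv (cov V i)).map x).injective
    exact (hγ i x hi _).trans (hδ i x hi v)
  · obtain ⟨i, hi⟩ := hcov x
    apply ((c.trivs i).map x).injective
    exact (hδ i x hi _).trans (hγ i x hi v)
  · exact (trivTriv_map (cov V 0) x _).symm.trans (hγ 0 x hx v)

end Clutch

/-- The composition of a trivialization with an isomorphism. -/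
def HolTriv.compInv {F E : HolBundle} {N : Set CP1} (ψ : HolTriv F N) (φ : HolIso F E) :
    HolTriv E N :=
  HolTriv.ofBijective (fun x => (ψ.map x).toLinearMap ∘ₗ φ.inv.map x)
    (fun x _ => (ψ.map x).bijective.comp (φ.symm.bijective x))
    (ψ.hol.comp φ.inv.hol.contMDiffOn fun _ hv => hv)

lemma IsHecke.comp_iso {F G E : HolBundle} {p : CP1} {α : HolHom F G} (h : IsHecke p α)
    (φ : HolIso G E) : IsHecke p (φ.hom.comp α) where
  bijective_away q hq := (φ.bijective q).comp (h.bijective_away q hq)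
  local_form := by
    obtain ⟨ζ, hζ, hp, ψG, ψF, hl⟩ := h.local_form
    refine ⟨ζ, hζ, hp, ψG.compInv φ, ψF, fun q hq v => ?_⟩
    rw [HolTriv.compInv, HolTriv.ofBijective_map _ _ hq, ← hl q hq]
    change ψG.map q (φ.inv.map q (φ.hom.map q _)) = _
    rw [φ.inv_hom]

/-! ### Hecke sequences with prescribed directions -/

/-- A matrix with first column `u`, invertible if `u` is not zero. -/
def colCompl (u : Fin 2 → ℂ) : Matrix (Fin 2) (Fin 2) ℂ :=
  if u 0 ≠ 0 then !![u 0, 0; u 1, 1] else !![u 0, 1; u 1, 0]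

lemma colCompl_apply_zero (u : Fin 2 → ℂ) (k : Fin 2) : colCompl u k 0 = u k := by
  unfold colCompl
  split_ifs <;> fin_cases k <;> rfl

lemma colCompl_det_ne_zero {u : Fin 2 → ℂ} (hu : u ≠ 0) : (colCompl u).det ≠ 0 := by
  unfold colCompl
  split_ifs with h
  · simpa using h
  · intro h1
    have h1 : u 1 = 0 := by simpa using h1
    refine hu (funext fun k => ?_)
    fin_cases k
    exacts [not_not.1 h, h1]

lemma Matrix.mulVec_bijective_of_det_ne_zero {C : Matrix (Fin 2) (Fin 2) ℂ} (h : C.det ≠ 0) :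
    Function.Bijective C.mulVec :=
  have hC := (Matrix.isUnit_iff_isUnit_det C).2 h.isUnit
  ⟨Matrix.mulVec_injective_iff_isUnit.2 hC, Matrix.mulVec_surjective_iff_isUnit.2 hC⟩

namespace CP1

variable {n : ℕ} (μ : Fin n → ℂ) (h : Fin n → CP1)

/-- The matrix, relative to `T`, of a Hecke modification at `μ` with direction `c`. -/
def stepMat (T : ℂ → Matrix (Fin 2) (Fin 2) ℂ) (μ : ℂ) (c : CP1) (z : ℂ) :
    Matrix (Fin 2) (Fin 2) ℂ :=
  colCompl ((T μ)⁻¹.mulVec c.rep) * !![1, 0; 0, z - μ]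

/-- The matrices of the composites in a sequence of Hecke modifications with directions `h`. -/
def dirMat : Fin (n + 1) → ℂ → Matrix (Fin 2) (Fin 2) ℂ :=
  Fin.induction (fun _ => 1) fun i T z => T z * stepMat T (μ i) (h i) z

lemma dirMat_succ (i : Fin n) (z : ℂ) : dirMat μ h i.succ z =
    dirMat μ h i.castSucc z * stepMat (dirMat μ h i.castSucc) (μ i) (h i) z :=
  rfl

lemma matAn_stepMat (T : ℂ → Matrix (Fin 2) (Fin 2) ℂ) (μ : ℂ) (c : CP1) (z : ℂ) :
    MatAn (stepMat T μ c) z := by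
  refine (MatAn.const _ z).mul fun i j => ?_
  fin_cases i <;> fin_cases j
  exacts [analyticAt_const, analyticAt_const, analyticAt_const,
    analyticAt_id.sub analyticAt_const]

lemma matAn_dirMat (i : Fin (n + 1)) (z : ℂ) : MatAn (dirMat μ h i) z := by
  induction i using Fin.induction with
  | zero => exact MatAn.const 1 z
  | succ i ih => exact ih.mul (matAn_stepMat _ _ _ z)

lemma dirMat_det_ne_zero (hμ : Function.Injective μ) (i : Fin (n + 1)) {z : ℂ}
    (hz : ∀ j : Fin n, j.castSucc < i → z ≠ μ j) : (dirMat μ h i z).det ≠ 0 := by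
  induction i using Fin.induction generalizing z with
  | zero => simp [dirMat]
  | succ i ih =>
    have hi := ih fun _ hj => hμ.ne fun e => (e ▸ hj).false
    rw [dirMat_succ, Matrix.det_mul, stepMat, Matrix.det_mul]
    refine mul_ne_zero (ih fun j hj => hz j (hj.trans i.castSucc_lt_succ)) (mul_ne_zero ?_ ?_)
    · refine colCompl_det_ne_zero fun h0 => (h i).rep_nonzero ?_
      have := congrArg (dirMat μ h i.castSucc (μ i)).mulVec h0
      rwa [Matrix.mulVec_mulVec, Matrix.mul_nonsing_inv _ hi.isUnit, Matrix.one_mulVec,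
        Matrix.mulVec_zero] at this
    · simpa [Matrix.det_fin_two_of, sub_eq_zero] using hz i i.castSucc_lt_succ

lemma dirMat_castSucc_det_ne_zero (hμ : Function.Injective μ) (i : Fin n) :
    (dirMat μ h i.castSucc (μ i)).det ≠ 0 :=
  dirMat_det_ne_zero μ h hμ _ fun _ hj => hμ.ne fun e => (e ▸ hj).false

/-- The first column of the step matrix is the line `h i` pulled back by the preceding composite,
which is invertible at `μ i`; composing brings it back to `h i`. -/
lemma dirMat_succ_mulVec (hμ : Function.Injective μ) (i : Fin n) (a : ℂ) :
    (dirMat μ h i.succ (μ i)).mulVec (Pi.single 0 a) = a • (h i).rep := by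
  have h1 : (stepMat (dirMat μ h i.castSucc) (μ i) (h i) (μ i)).mulVec (Pi.single 0 a) =
      a • (dirMat μ h i.castSucc (μ i))⁻¹.mulVec (h i).rep := by
    ext k
    simp [stepMat, Matrix.mul_apply, colCompl_apply_zero, mul_comm]
  rw [dirMat_succ, ← Matrix.mulVec_mulVec, h1, Matrix.mulVec_smul, Matrix.mulVec_mulVec,
    Matrix.mul_nonsing_inv _ (dirMat_castSucc_det_ne_zero μ h hμ i).isUnit, Matrix.one_mulVec]

lemma ξ_injOn_U (i : Fin 2) : InjOn (ξ i) (U i) := fun x hx y hy hxy => by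
  rw [← pt_ξ i x hx, hxy, pt_ξ i y hy]

end CP1

/-- The constant factor `C` is removed by changing the trivialization of the target by `C⁻¹`. -/
lemma Clutch.isHecke {p : CP1} {V : Set CP1} (hpU : p ∈ U 0)
    (c d : Clutch V) {C : Matrix (Fin 2) (Fin 2) ℂ} (hC : C.det ≠ 0)
    {γ : HolHom c.bundle d.bundle}
    (h0 : ∀ x ∈ U 0, ∀ v, (d.trivs 0).map x (γ.map x v) =
        (C * !![1, 0; 0, ξ 0 x - ξ 0 p]).mulVec ((c.trivs 0).map x v))
    (h1 : ∀ x ∈ V, ∀ v, (d.trivs 1).map x (γ.map x v) = (c.trivs 1).map x v) : IsHecke p γ := by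
  refine ⟨fun q hq => ?_, chart 0, chart_mem_maximalAtlas 0, hpU, ?_⟩
  · by_cases hqU : q ∈ U 0
    · have hdet : (C * !![1, 0; 0, ξ 0 q - ξ 0 p]).det ≠ 0 := by
        rw [Matrix.det_mul]
        refine mul_ne_zero hC ?_
        simpa [Matrix.det_fin_two_of, sub_eq_zero] using
          fun e => hq (ξ_injOn_U 0 hqU hpU e)
      have hb : Function.Bijective (C * !![1, 0; 0, ξ 0 q - ξ 0 p]).mulVec :=
        Matrix.mulVec_bijective_of_det_ne_zero hdet
      have : (γ.map q : _ → _) = ((d.trivs 0).map q).symm ∘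
          (C * !![1, 0; 0, ξ 0 q - ξ 0 p]).mulVec ∘ (c.trivs 0).map q := funext fun v => by
        rw [Function.comp_apply, LinearEquiv.eq_symm_apply]
        exact h0 q hqU v
      rw [this]
      exact ((d.trivs 0).map q).symm.bijective.comp (hb.comp ((c.trivs 0).map q).bijective)
    · have hqV := c.cover q hqU
      have : (γ.map q : _ → _) = ((d.trivs 1).map q).symm ∘ (c.trivs 1).map q := funext fun v => by
        rw [Function.comp_apply, LinearEquiv.eq_symm_apply]
        exact h1 q hqV v
      rw [this]
      exact ((d.trivs 1).map q).symm.bijective.comp ((c.trivs 1).map q).bijective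
  · have hCi := Matrix.nonsing_inv_mul _ hC.isUnit
    have hb : Function.Bijective C⁻¹.mulVec :=
      Matrix.mulVec_bijective_of_det_ne_zero (Matrix.isUnit_nonsing_inv_det C hC.isUnit).ne_zero
    let L : (Fin 2 → ℂ) →L[ℂ] (Fin 2 → ℂ) := matCLM C⁻¹
    refine ⟨HolTriv.ofBijective (fun x => L.toLinearMap ∘ₗ ((d.trivs 0).map x).toLinearMap)
      (fun x _ => hb.comp ((d.trivs 0).map x).bijective)
      (L.contDiff.contMDiff.comp_contMDiffOn (d.trivs 0).hol), c.trivs 0, fun q hq v => ?_⟩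
    refine (HolTriv.ofBijective_map _ _ hq _).trans ?_
    change C⁻¹.mulVec ((d.trivs 0).map q (γ.map q v)) = _
    rw [h0 q hq, Matrix.mulVec_mulVec, ← Matrix.mul_assoc, hCi, Matrix.one_mul]
    rfl

/-- Each bundle is glued from `U 0` and the complement of the points by the matrix of the desired
composite, which is invertible on the overlap. The composites are then these matrices over `U 0`. -/
lemma exists_heckeSeq {n : ℕ} {p : Fin n → CP1} (hp : Function.Injective p)
    (hU : ∀ i, p i ∈ U 0) (h : Fin n → CP1) :
    ∃ S : HeckeSeq triv p, ∀ i, IsDirection S i (h i) := by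
  have hμ : Function.Injective fun i => ξ 0 (p i) := fun i j e => hp (ξ_injOn_U 0 (hU i) (hU j) e)
  let μ := fun i => ξ 0 (p i)
  let c : Fin (n + 1) → Clutch (range p)ᶜ := fun i =>
    { mat := dirMat μ h i
      isOpen := (finite_range p).isClosed.isOpen_compl
      cover := fun x hx ⟨j, hj⟩ => hx (hj ▸ hU j)
      matAn := matAn_dirMat μ h i
      det_ne_zero := fun x hx => dirMat_det_ne_zero μ h hμ i fun j _ e =>
        hx.2 ⟨j, (ξ_injOn_U 0 hx.1 (hU j) e).symm⟩ }
  choose α hα0 hα1 using fun i : Fin n => (c i.succ).exists_hom (c i.castSucc)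
    (stepMat (dirMat μ h i.castSucc) (μ i) (h i)) (matAn_stepMat _ _ _) fun z => rfl
  obtain ⟨φ₀, hφ₀⟩ := (c 0).exists_iso_triv fun z => rfl
  let mods : Fin n → HolBundle := fun i => (c i.succ).bundle
  -- The glued bundle of index 0 is only isomorphic to 𝒪 ⊕ 𝒪, so it is replaced by it; the other
  -- bundles stay.
  let φ : ∀ i, HolIso (c i).bundle (bundleSeq triv mods i) :=
    Fin.cases φ₀ fun i => HolIso.refl (mods i)
  have hH : ∀ i, IsHecke (p i) (α i) := fun i => by
    refine Clutch.isHecke (hU i) _ _ ?_ (hα0 i) (hα1 i)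
    refine colCompl_det_ne_zero fun h0 => (h i).rep_nonzero ?_
    have := congrArg (dirMat μ h i.castSucc (μ i)).mulVec h0
    rwa [Matrix.mulVec_mulVec,
      Matrix.mul_nonsing_inv _ (dirMat_castSucc_det_ne_zero μ h hμ i).isUnit, Matrix.one_mulVec,
      Matrix.mulVec_zero] at this
  let S : HeckeSeq triv p :=
    { mods := mods
      map := fun i => (φ i.castSucc).hom.comp (α i)
      isHecke := fun i => (hH i).comp_iso (φ i.castSucc) }
  have hS : ∀ i, ∀ x ∈ U 0, ∀ v : (c i).bundle.Fib x,
      ((S.toBase i).map x ((φ i).hom.map x v) : Fin 2 → ℂ) =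
        (dirMat μ h i (ξ 0 x)).mulVec (((c i).trivs 0).map x v) := by
    intro i x hx
    induction i using Fin.induction with
    | zero =>
      intro v
      exact (hφ₀ x hx v).trans (Matrix.one_mulVec _).symm
    | succ i ih =>
      intro v
      rw [S.toBase_succ, dirMat_succ, ← Matrix.mulVec_mulVec, ← hα0 i x hx]
      exact ih (α i |>.map x v)
  refine ⟨S, fun i => ?_⟩
  obtain ⟨d, hd⟩ := S.exists_isDirection hp hU i
  have hd' : IsModAt (S.toBase i.succ) (p i) d := hd
  suffices h i = d by rw [this]; exact hd
  refine eq_of_lineForm fun w hw => ?_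
  rw [← (h i).mk_rep, lineForm_mk] at hw
  obtain ⟨a, rfl⟩ := hw
  refine (hd'.lineForm_eq_zero_iff _).2
    ⟨(φ i.succ).hom.map _ ((((c i.succ).trivs 0).map (p i)).symm (Pi.single 0 a)), ?_⟩
  rw [hS i.succ (p i) (hU i), LinearEquiv.apply_symm_apply]
  exact dirMat_succ_mulVec μ h hμ i a

/-! ### From a monic matrix polynomial to a balanced last bundle -/

/-- Take `C` with first column on `c`. The second row of `C⁻¹ M` vanishes at `μ`; dividing it by `z
- μ` leaves a matrix `B`, invertible at `μ` because the zero of `det M` is simple. -/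
lemma isEta_of_det {M : ℂ → Matrix (Fin 2) (Fin 2) ℂ} {μ : ℂ} {c : CP1} (hM : MatAn M μ)
    {u : ℂ → ℂ} (hu : ContinuousAt u μ) (hu0 : u μ ≠ 0) (hdet : ∀ z, (M z).det = (z - μ) * u z)
    (hc : ∀ v, lineForm c ((M μ).mulVec v) = 0) : IsEta M μ c := by
  set C := colCompl c.rep with hCdef
  have hC : C.det ≠ 0 := colCompl_det_ne_zero c.rep_nonzero
  let N : ℂ → Matrix (Fin 2) (Fin 2) ℂ := fun z => C⁻¹ * M z
  have hN : MatAn N μ := (MatAn.const C⁻¹ μ).mul hM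
  have hCN : ∀ z, C * N z = M z := fun z => by
    rw [← Matrix.mul_assoc, Matrix.mul_nonsing_inv _ hC.isUnit, Matrix.one_mul]
  have hN1 : ∀ k, N μ 1 k = 0 := fun k => by
    have h1 := hc (Pi.single k 1)
    rw [← c.mk_rep, lineForm_mk] at h1
    obtain ⟨a, ha⟩ := h1
    have h2 : C.mulVec (Pi.single 0 a) = a • c.rep := by
      ext j
      simp [hCdef, colCompl_apply_zero, mul_comm]
    rw [← h2, ← hCN, ← Matrix.mulVec_mulVec] at ha
    have h3 := congrFun ((Matrix.mulVec_bijective_of_det_ne_zero hC).1 ha) 1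
    simpa using h3
  let B : ℂ → Matrix (Fin 2) (Fin 2) ℂ := fun z =>
    !![N z 0 0, N z 0 1; dslope (fun z => N z 1 0) μ z, dslope (fun z => N z 1 1) μ z]
  have hB : MatAn B μ := fun i j => by
    fin_cases i <;> fin_cases j
    exacts [hN 0 0, hN 0 1, (hN 1 0).dslope_same, (hN 1 1).dslope_same]
  have hNB : ∀ z, N z = !![1, 0; 0, z - μ] * B z := fun z => by
    have hk : ∀ k, (z - μ) * dslope (fun z => N z 1 k) μ z = N z 1 k := fun k => by
      have := sub_smul_dslope (fun z => N z 1 k) μ z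
      rwa [hN1, sub_zero, smul_eq_mul] at this
    ext i j
    fin_cases i <;> fin_cases j <;> simp [B, Matrix.mul_apply, hk]
  have hBd : (B μ).det ≠ 0 := by
    have h1 : ∀ z ≠ μ, C.det * (B z).det = u z := fun z hz => by
      have := hdet z
      rw [← hCN, hNB, Matrix.det_mul, Matrix.det_mul, Matrix.det_fin_two_of] at this
      refine mul_left_cancel₀ (sub_ne_zero.2 hz) ?_
      linear_combination this
    have h2 : C.det * (B μ).det = u μ := by
      have h3 : ContinuousAt (fun z => C.det * (B z).det) μ :=
        continuousAt_const.mul hB.det.continuousAt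
      refine tendsto_nhds_unique (h3.tendsto.mono_left nhdsWithin_le_nhds)
        ((hu.tendsto.mono_left (nhdsWithin_le_nhds (s := {μ}ᶜ))).congr' ?_)
      filter_upwards [self_mem_nhdsWithin] with z hz using (h1 z hz).symm
    exact right_ne_zero_of_mul (h2 ▸ hu0)
  have h0 : ![C 0 0, C 1 0] = c.rep := by
    ext k; fin_cases k <;> simp [hCdef, colCompl_apply_zero]
  refine ⟨fun _ => C, B, fun i j => analyticAt_const, hB, hC, hBd,
    Filter.Eventually.of_forall fun z => ?_, h0 ▸ c.rep_nonzero, ?_⟩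
  · rw [Matrix.mul_assoc, ← hNB, hCN]
  · simp only [h0, Projectivization.mk_rep]

section

variable {m : ℕ} (Y : Fin m → Matrix (Fin 2) (Fin 2) ℂ)

/-- The matrix polynomial `z ^ m - ∑ j, z ^ (m - 1 - j) Y j`. -/
def monicMat (z : ℂ) : Matrix (Fin 2) (Fin 2) ℂ :=
  z ^ m • (1 : Matrix (Fin 2) (Fin 2) ℂ) - ∑ j, z ^ (m - 1 - j.val) • Y j

/-- The matrix polynomial `monicMat` in the coordinate near infinity. -/
def monicMatInf (w : ℂ) : Matrix (Fin 2) (Fin 2) ℂ := 1 - ∑ j, w ^ (j.val + 1) • Y j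

lemma monicMat_inv {w : ℂ} (hw : w ≠ 0) : monicMat Y w⁻¹ = w⁻¹ ^ m • monicMatInf Y w := by
  rw [monicMat, monicMatInf, smul_sub, Finset.smul_sum]
  congr 1
  refine Finset.sum_congr rfl fun j _ => ?_
  rw [smul_smul]
  congr 1
  obtain ⟨k, hk⟩ : ∃ k, m = k + (j.val + 1) := ⟨m - (j.val + 1), by omega⟩
  have e : w⁻¹ ^ m = w⁻¹ ^ k * w⁻¹ ^ (j.val + 1) := by rw [← pow_add, ← hk]
  rw [show m - 1 - j.val = k by omega, e, mul_assoc, ← mul_pow, inv_mul_cancel₀ hw, one_pow,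
    mul_one]

lemma monicMatInf_zero : monicMatInf Y 0 = 1 := by simp [monicMatInf]

lemma matAn_monicMat (z : ℂ) : MatAn (monicMat Y) z := fun i j => by
  simp only [monicMat, Matrix.sub_apply, Matrix.smul_apply, Matrix.sum_apply, smul_eq_mul]
  fun_prop

lemma matAn_monicMatInf (z : ℂ) : MatAn (monicMatInf Y) z := fun i j => by
  simp only [monicMatInf, Matrix.sub_apply, Matrix.smul_apply, Matrix.sum_apply, smul_eq_mul]
  fun_prop

lemma det_eq_zero_of_lineForm {M : Matrix (Fin 2) (Fin 2) ℂ} {c : CP1}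
    (hc : ∀ v, lineForm c (M.mulVec v) = 0) : M.det = 0 := by
  by_contra hM
  refine c.rep_nonzero (rotLin_injective (funext fun k => ?_))
  obtain ⟨v, hv⟩ := (Matrix.mulVec_bijective_of_det_ne_zero hM).2 (Pi.single k 1)
  have := hc v
  rw [hv, lineForm_apply] at this
  fin_cases k <;> simpa using this

variable {Y} {μ : Fin (2 * m) → ℂ} {h : Fin (2 * m) → CP1}

/-- The determinant vanishes at the 2m distinct `μ i`, and its quotient by ∏ (z - μᵢ) is entire and
tends to 1 at infinity, as `monicMatInf` is the identity there. -/
lemma monicMat_det (hμ : Function.Injective μ)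
    (hY : ∀ i v, lineForm (h i) ((monicMat Y (μ i)).mulVec v) = 0) (z : ℂ) :
    (monicMat Y z).det = ∏ i, (z - μ i) := by
  obtain ⟨g, hg, hfg⟩ := exists_eq_prod_mul (f := fun z => (monicMat Y z).det)
    (fun z => (matAn_monicMat Y z).det.differentiableAt) hμ Finset.univ
    fun i _ => det_eq_zero_of_lineForm (hY i)
  have hprod : ContinuousAt (fun w => ∏ i, (1 - μ i * w)) (0 : ℂ) := by fun_prop
  have hprod0 : ∏ i, (1 - μ i * (0 : ℂ)) ≠ 0 := by simp
  have h1 : ContinuousAt (fun w => (monicMatInf Y w).det / ∏ i, (1 - μ i * w)) 0 :=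
    (matAn_monicMatInf Y 0).det.continuousAt.div hprod hprod0
  have h2 : Filter.Tendsto (fun w => g w⁻¹) (𝓝[≠] 0) (𝓝 1) := by
    have h3 := h1.tendsto
    simp only [monicMatInf_zero, Matrix.det_one, mul_zero, sub_zero, Finset.prod_const_one,
      div_one] at h3
    refine (h3.mono_left nhdsWithin_le_nhds).congr' ?_
    filter_upwards [self_mem_nhdsWithin, nhdsWithin_le_nhds (hprod.eventually_ne hprod0)]
      with w (hw : w ≠ 0) hw0
    have h4 := hfg w⁻¹
    simp only [monicMat_inv Y hw, Matrix.det_smul, Fintype.card_fin, prod_inv_sub μ hw] at h4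
    rw [div_eq_iff hw0]
    refine mul_left_cancel₀ (pow_ne_zero (2 * m) (inv_ne_zero hw)) ?_
    rw [← pow_mul, mul_comm m 2] at h4
    linear_combination h4
  rw [hfg, eq_of_tendsto_inv hg h2, mul_one]

variable {p : Fin (2 * m) → CP1}

/-- The gluing factor `w ^ (-m)` of 𝒪(-m) ⊕ 𝒪(-m) absorbs the growth of the monic polynomial, so it
extends over infinity by `monicMatInf`, which is invertible at `w = 0`. The determinant formula
gives bijectivity elsewhere and simple zeros at the `μ i`. -/
lemma exists_isMod_of_monicMat (hp : Function.Injective p) (hU : ∀ i, p i ∈ U 0)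
    (hY : ∀ i v, lineForm (h i) ((monicMat Y (ξ 0 (p i))).mulVec v) = 0) :
    ∃ β : HolHom (sumO (-m) (-m)) triv, IsMod β univ p h := by
  have hμ : Function.Injective fun i => ξ 0 (p i) := fun i j e => hp (ξ_injOn_U 0 (hU i) (hU j) e)
  have hdet := monicMat_det hμ hY
  obtain ⟨β, hβ⟩ := HolHom.exists_glue isOpen_U (fun x hx => mem_U_one_of_not_mem hx)
    (sumTriv (-m) (-m)) (fun i => trivTriv (U i))
    ![fun x => Matrix.toLin' (monicMat Y (ξ 0 x)), fun x => Matrix.toLin' (monicMatInf Y (ξ 1 x))]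
    (fun i => by
      fin_cases i
      · exact fun x hx v => anAt_mulVec hx (matAn_monicMat Y _) v
      · exact fun x hx v => anAt_mulVec hx (matAn_monicMatInf Y _) v)
    fun x h0 h1 v => by
      have hx : ξ 0 x = (ξ 1 x)⁻¹ := eq_inv_of_mul_eq_one_left (ξ_mul_ξ 0 h0 h1)
      have e : (monicMat Y (ξ 0 x)).mulVec ((sumTriv (-m) (-m) 0).map x v) =
          (monicMatInf Y (ξ 1 x)).mulVec ((sumTriv (-m) (-m) 1).map x v) := by
        rw [sumTriv_map (-m) h0 h1, Matrix.mulVec_smul, hx,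
          monicMat_inv Y (w := ξ 1 x) (ξ_ne_zero 0 h0 h1),
          Matrix.smul_mulVec, zpow_neg, zpow_natCast, inv_pow]
      rw [LinearEquiv.symm_apply_eq]
      refine e.trans ?_
      rw [trivTriv_map, ← trivTriv_map (U 1) x (((trivTriv (U 1)).map x).symm _),
        LinearEquiv.apply_symm_apply]
      rfl
  have hβ0 : ∀ x ∈ U 0, ∀ v, (β.map x v : Fin 2 → ℂ) =
      (monicMat Y (ξ 0 x)).mulVec ((sumTriv (-m) (-m) 0).map x v) := fun x hx v =>
    (trivTriv_map (U 0) x _).symm.trans (hβ 0 x hx v)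
  refine ⟨β, fun q hq => ?_, fun i _ => ⟨U 0, isOpen_U 0, hU i, subset_rfl,
    sumTriv (-m) (-m) 0, monicMat Y, hβ0, ?_⟩⟩
  · by_cases hqU : q ∈ U 0
    · have hd : (monicMat Y (ξ 0 q)).det ≠ 0 := by
        rw [hdet, Finset.prod_ne_zero_iff]
        exact fun i _ => sub_ne_zero.2 fun e => hq i (mem_univ i) (ξ_injOn_U 0 hqU (hU i) e)
      have : (β.map q : _ → _) = (monicMat Y (ξ 0 q)).mulVec ∘ (sumTriv (-m) (-m) 0).map q :=
        funext fun v => hβ0 q hqU v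
      rw [this]
      exact (Matrix.mulVec_bijective_of_det_ne_zero hd).comp
        ((sumTriv (-m) (-m) 0).map q).bijective
    · have h1 := mem_U_one_of_not_mem hqU
      have hξ : ξ 1 q = 0 := by
        have : q.rep 0 = 0 := not_not.1 hqU
        simp [ξ, this]
      have : (β.map q : _ → _) = (sumTriv (-m) (-m) 1).map q := funext fun v => by
        refine ((trivTriv_map (U 1) q _).symm.trans (hβ 1 q h1 v)).trans ?_
        change (monicMatInf Y (ξ 1 q)).mulVec _ = _
        rw [hξ, monicMatInf_zero, Matrix.one_mulVec]
      rw [this]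
      exact ((sumTriv (-m) (-m) 1).map q).bijective
  · refine isEta_of_det (matAn_monicMat Y _)
      (u := fun z => ∏ j ∈ Finset.univ.erase i, (z - ξ 0 (p j))) (by fun_prop) ?_ (fun z => ?_)
      (hY i)
    · rw [Finset.prod_ne_zero_iff]
      exact fun j hj => sub_ne_zero.2 (hμ.ne (Finset.ne_of_mem_erase hj).symm)
    · rw [hdet, ← Finset.mul_prod_erase _ (fun i => z - ξ 0 (p i)) (Finset.mem_univ i)]

/-- The first block column of PA = DP reads ∑ μᵢᵐ⁻¹⁻ʲ lᵢYⱼ = μᵢᵐ lᵢ, which says that `l i`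
annihilates the monic polynomial at `μ i`. -/
lemma lineForm_monicMat_of_eigenRows {A : Matrix (Fin m × Fin 2) (Fin m × Fin 2) ℂ} (hm : m ≠ 0)
    (hA : eigenRows m μ (fun i => rotLin (h i).rep) * A =
      Matrix.diagonal μ * eigenRows m μ fun i => rotLin (h i).rep)
    (i : Fin (2 * m)) (v : Fin 2 → ℂ) :
    lineForm (h i) ((monicMat (fun j => Matrix.of fun a b =>
      A (j, a) (⟨0, Nat.pos_of_ne_zero hm⟩, b)) (μ i)).mulVec v) = 0 := by
  set l := rotLin (h i).rep with hl
  have h1 : ∀ b, ∑ j : Fin m, ∑ a, μ i ^ (m - 1 - j.val) * l a *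
      A (j, a) (⟨0, Nat.pos_of_ne_zero hm⟩, b) = μ i ^ m * l b := fun b => by
    have := congrFun (congrFun hA i) (⟨0, Nat.pos_of_ne_zero hm⟩, b)
    rw [Matrix.mul_apply, Matrix.diagonal_mul, Fintype.sum_prod_type] at this
    simp only [eigenRows_apply] at this
    rw [this, ← mul_assoc, ← pow_succ', Nat.sub_zero, Nat.sub_add_cancel (Nat.pos_of_ne_zero hm)]
  have h2 : ∀ b, l 0 * ∑ j : Fin m, μ i ^ (m - 1 - j.val) *
      A (j, 0) (⟨0, Nat.pos_of_ne_zero hm⟩, b) + l 1 * ∑ j : Fin m, μ i ^ (m - 1 - j.val) *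
      A (j, 1) (⟨0, Nat.pos_of_ne_zero hm⟩, b) = μ i ^ m * l b := fun b => by
    rw [← h1, Finset.mul_sum, Finset.mul_sum, ← Finset.sum_add_distrib]
    refine Finset.sum_congr rfl fun j _ => ?_
    rw [Fin.sum_univ_two]
    ring
  rw [lineForm_apply, ← hl]
  simp only [monicMat, Matrix.mulVec, dotProduct, Fin.sum_univ_two, Matrix.sub_apply,
    Matrix.smul_apply, Matrix.sum_apply, Matrix.of_apply, smul_eq_mul, Matrix.one_apply]
  simp only [Fin.isValue, if_true, zero_ne_one, one_ne_zero, if_false]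
  linear_combination -v 0 * h2 0 - v 1 * h2 1

end

/-! ### Assembly of the three maps -/

lemma rot_eq_mk (c : CP1) (h : rotLin c.rep ≠ 0) :
    rot c = Projectivization.mk ℂ (rotLin c.rep) h := by
  conv_lhs => rw [← c.mk_rep]
  rfl

/-- The matrix with rows `μ i ^ (m - 1 - j) • l i`, where `l i` is a linear form with kernel
`h i`. -/
abbrev dirRows (m : ℕ) (μ : Fin (2 * m) → ℂ) (h : Fin (2 * m) → CP1) :
    Matrix (Fin (2 * m)) (Fin m × Fin 2) ℂ :=
  eigenRows m μ fun i => rotLin (h i).rep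

section

variable {m : ℕ} {μ : Fin (2 * m) → ℂ} {h : Fin (2 * m) → CP1}
  {A : Matrix (Fin m × Fin 2) (Fin m × Fin 2) ℂ}

lemma isWoodwardPoint_iff_eq_rot (hμ : Function.Injective μ) (hm : m ≠ 0)
    (hP : Function.Injective (dirRows m μ h).mulVec)
    (hA : dirRows m μ h * A = Matrix.diagonal μ * dirRows m μ h) (k : Fin (2 * m)) (c : CP1) :
    IsWoodwardPoint A (μ k) c ↔ c = rot (h k) := by
  rw [isWoodwardPoint_iff hμ hm hP hA, rot_eq_mk]

lemma SeidelSmith.exists_dirRows (hμ : Function.Injective μ) (hm : m ≠ 0)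
    (hA : A ∈ SeidelSmith m μ) : ∃ h : Fin (2 * m) → CP1,
      Function.Injective (dirRows m μ h).mulVec ∧
      dirRows m μ h * A = Matrix.diagonal μ * dirRows m μ h := by
  obtain ⟨l, hl, hinj, hlA⟩ := SeidelSmith.exists_eigenRows hμ hm hA
  have h1 : ∀ i, ∃ c : CP1, ∃ a : ℂ, a ≠ 0 ∧ rotLin c.rep = a • l i := fun i => by
    have hne : rotLin (l i) ≠ 0 := fun h0 => hl i (rotLin_injective (h0.trans (map_zero _).symm))
    obtain ⟨a, ha⟩ := Projectivization.exists_smul_eq_mk_rep ℂ (rotLin (l i)) hne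
    -- The kernel of the form `l i` is spanned by `rotLin (l i)`; the sign comes from `rotLin`
    -- squaring to -1.
    refine ⟨Projectivization.mk ℂ (rotLin (l i)) hne, -a, neg_ne_zero.2 a.ne_zero, ?_⟩
    rw [← ha, Units.smul_def, map_smul, rotLin_rotLin, smul_neg, neg_smul]
  choose h a ha hh using h1
  have e : dirRows m μ h = Matrix.diagonal a * eigenRows m μ l := by
    ext i x
    rw [Matrix.diagonal_mul, eigenRows_apply]
    refine (eigenRows_apply i x).trans ?_
    rw [hh, Pi.smul_apply, smul_eq_mul]
    ring
  refine ⟨h, fun v w hvw => hinj (funext fun i => ?_), ?_⟩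
  · have := congrFun hvw i
    rw [e, ← Matrix.mulVec_mulVec, ← Matrix.mulVec_mulVec, Matrix.mulVec_diagonal,
      Matrix.mulVec_diagonal] at this
    exact mul_left_cancel₀ (ha i) this
  · rw [e, Matrix.mul_assoc, hlA, ← Matrix.mul_assoc, ← Matrix.mul_assoc,
      Matrix.diagonal_mul_diagonal, Matrix.diagonal_mul_diagonal]
    simp only [mul_comm]

lemma exists_of_dirRows (hP : Function.Injective (dirRows m μ h).mulVec) :
    ∃ A : Matrix (Fin m × Fin 2) (Fin m × Fin 2) ℂ,
      dirRows m μ h * A = Matrix.diagonal μ * dirRows m μ h := by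
  obtain ⟨Q, h1, -⟩ := exists_inverse_eigenRows hP
  exact ⟨Q * (Matrix.diagonal μ * dirRows m μ h), by rw [← Matrix.mul_assoc, h1, Matrix.one_mul]⟩

lemma eq_of_dirRows {B : Matrix (Fin m × Fin 2) (Fin m × Fin 2) ℂ}
    (hP : Function.Injective (dirRows m μ h).mulVec)
    (hA : dirRows m μ h * A = Matrix.diagonal μ * dirRows m μ h)
    (hB : dirRows m μ h * B = Matrix.diagonal μ * dirRows m μ h) : A = B := by
  obtain ⟨Q, -, h2⟩ := exists_inverse_eigenRows hP
  rw [← Matrix.one_mul A, ← h2, Matrix.mul_assoc, hA, ← hB, ← Matrix.mul_assoc, h2, Matrix.one_mul]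

end

section

variable {m : ℕ} {p h : Fin (2 * m) → CP1}

lemma HeckeSeq.isMod_toBase_last (S : HeckeSeq triv p) (hp : Function.Injective p)
    (hh : ∀ i, IsDirection S i (h i)) : IsMod (S.toBase (Fin.last (2 * m))) univ p h := by
  convert S.isMod_toBase hp hh (Fin.last (2 * m))
  exact (eq_univ_of_forall fun j => j.castSucc_lt_last).symm

lemma HeckeSpace.dirRows_injective (hp : Function.Injective p) (hU : ∀ i, p i ∈ U 0)
    (x : HeckeSpace p) :
    Function.Injective (dirRows m (fun i => ξ 0 (p i)) (HTot.dirs x.1)).mulVec := by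
  obtain ⟨x, S, rfl, hS⟩ := x
  rw [Nat.mul_mod_right] at hS
  exact (S.isMod_toBase_last hp fun i => (HTot.isDirection_iff hp hU rfl i _).2 rfl
    ).eigenRows_injective_of_hasHeckeLength hp hU hS

lemma HeckeSeq.cls_mem_heckeSpace {A : Matrix (Fin m × Fin 2) (Fin m × Fin 2) ℂ} (hm : m ≠ 0)
    (hp : Function.Injective p) (hU : ∀ i, p i ∈ U 0) (S : HeckeSeq triv p)
    (hh : ∀ i, IsDirection S i (h i))
    (hA : dirRows m (fun i => ξ 0 (p i)) h * A =
      Matrix.diagonal (fun i => ξ 0 (p i)) * dirRows m (fun i => ξ 0 (p i)) h) :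
    S.cls ∈ HeckeSpace p := by
  obtain ⟨β, hβ⟩ := exists_isMod_of_monicMat hp hU (lineForm_monicMat_of_eigenRows hm hA)
  obtain ⟨φ, -⟩ := hβ.exists_iso (S.isMod_toBase_last hp hh)
  exact ⟨S, rfl, -m, -m, ⟨φ⟩, by simp⟩

end

theorem mainTheorem8 (m : ℕ) (hm : m = 1 ∨ m = 2) (p : Fin (2 * m) → CP1)
    (hp : Function.Injective p) (hU : ∀ i, p i ∈ CP1.U 0) :
    ∃ (K : HeckeSpace p → SeidelSmith m (fun i => CP1.ξ 0 (p i)))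
      (H : HeckeSpace p → MSpace (2 * m))
      (W : SeidelSmith m (fun i => CP1.ξ 0 (p i)) → MSpace (2 * m)),
      IsKamnitzerMap K ∧ Function.Bijective K ∧
      IsHeckeEmbedding H ∧ Function.Injective H ∧
      IsWoodwardEmbedding W ∧ Function.Injective W ∧
      ∀ x : HeckeSpace p, W (K x) = rotM (2 * m) (H x) := by
  have hm0 : m ≠ 0 := by omega
  have hμ : Function.Injective fun i => ξ 0 (p i) := fun i j e => hp (ξ_injOn_U 0 (hU i) (hU j) e)
  have hP := HeckeSpace.dirRows_injective hp hU
  choose K hK using fun x => exists_of_dirRows (hP x)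
  let K' : HeckeSpace p → SeidelSmith m (fun i => ξ 0 (p i)) := fun x =>
    ⟨K x, mem_seidelSmith_of_eigenRows (hP x) (hK x)⟩
  let H : HeckeSpace p → MSpace (2 * m) := fun x =>
    ⟨HTot.dirs x.1, mem_mSpace_of_eigenRows (hP x)⟩
  have hH : Function.Injective H := fun x y hxy =>
    Subtype.ext (HTot.dirs_injective hp hU (congrArg Subtype.val hxy))
  have hW : ∀ x k c, IsWoodwardPoint (K' x).1 (ξ 0 (p k)) c ↔ c = rot (HTot.dirs x.1 k) :=
    fun x => isWoodwardPoint_iff_eq_rot hμ hm0 (hP x) (hK x)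
  -- The Woodward points of the matrix are the rotated directions, so the matrix determines the
  -- directions and hence the class.
  have hKinj : Function.Injective K' := fun x y hxy => hH (Subtype.ext (funext fun k => by
    have h1 := (hW y k _).1 (hxy ▸ (hW x k _).2 rfl)
    have h2 := congrArg rot h1
    rwa [rot_rot, rot_rot] at h2))
  have hKsurj : Function.Surjective K' := fun A => by
    obtain ⟨h, hinj, hA⟩ := SeidelSmith.exists_dirRows hμ hm0 A.2
    obtain ⟨S, hS⟩ := exists_heckeSeq hp hU h
    refine ⟨⟨S.cls, S.cls_mem_heckeSpace hm0 hp hU hS hA⟩, Subtype.ext ?_⟩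
    have hd : HTot.dirs S.cls = h := funext fun i =>
      ((HTot.isDirection_iff hp hU rfl i _).1 (hS i)).symm
    have hKx := hK ⟨S.cls, S.cls_mem_heckeSpace hm0 hp hU hS hA⟩
    simp only [hd] at hKx
    exact eq_of_dirRows hinj hKx hA
  let e := Equiv.ofBijective K' ⟨hKinj, hKsurj⟩
  -- W is taken to be Φ ∘ H ∘ K⁻¹: its values lie in ℳ, and injectivity and the identity with Φ ∘ H
  -- are immediate. That it computes the Woodward points is `hW`.
  refine ⟨K', H, fun A => rotM (2 * m) (H (e.symm A)), ?_, ⟨hKinj, hKsurj⟩, ?_, hH, ?_,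
    (rotM (2 * m)).injective.comp (hH.comp e.symm.injective), fun x => ?_⟩
  · intro x S hS A
    rw [S.isKamnitzerMatrix_iff hp hU
      (fun i => (HTot.isDirection_iff hp hU hS i _).2 rfl) (hP x)]
    exact ⟨fun hA => eq_of_dirRows (hP x) hA (hK x), fun hA => hA ▸ hK x⟩
  · exact fun x S hS i c => HTot.isDirection_iff hp hU hS i c
  · intro A k c
    have := hW (e.symm A) k c
    rwa [show K' (e.symm A) = A from e.apply_symm_apply A] at this
  · exact congrArg (fun y => rotM (2 * m) (H y)) (e.symm_apply_apply x)
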